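/- **Setting.** Let $k$ be a field complete with respect to a non-Archimedean absolute value (the trivial one is allowed). Banach spaces over $k$ are complete normed spaces whose norm satisfies the strong triangle inequality; morphisms are the bounded linear maps, and $\hat\otimes$ is the completed tensor product. An *IndBanach space* is a small filtered diagram $X=\text{"colim"}_i X_i$ of Banach spaces, with $\mathrm{Hom}(X,Y)=\lim_i\operatorname{colim}_j\mathrm{Hom}(X_i,Y_j)$ and $X\hat\otimes Y=\text{"colim"}_{i,j}X_i\hat\otimes Y_j$; a Banach space is regarded as a constant diagram. An *IndBanach algebra* is an associative unital algebra object in this monoidal category. For a Banach space $V$ and $c>0$ let $V_c$ be $V$ with its norm multiplied by $c$, and put $$V[\![\hbar]\!]:=\prod_{n\ge 0}V\cdot\hbar^n=\underset{(r_n)\in\mathbb R_{>0}^{\mathbb N}}{\text{"colim"}}\Big\{(v_n)_{n}\in \textstyle\prod_n V_{r_n}:\ \sup_n r_n\|v_n\|<\infty\Big\},$$ the transition maps being the inclusions when the $r_n$ decrease. With the Cauchy product, $k[\![\hbar]\!]$ is a commutative IndBanach algebra, and $V[\![\hbar]\!]$ is a $k[\![\hbar]\!]$-algebra if $V$ is a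 Banach algebra. A *$k[\![\hbar]\!]$-algebra* is an IndBanach algebra $A$ with a unital associative action $k[\![\hbar]\!]\hat\otimes A\to A$ for which the multiplication of $A$ is $k[\![\hbar]\!]$-bilinear. $A/\hbar A$ denotes the cokernel of $\hbar:A\to A$, with the algebra structure for which $A\to A/\hbar A$ is a morphism of algebras. **Root datum.** Let $\Phi$ be a free $\mathbb Z$-module, $(\alpha_i)_{i\in I}$ a $\mathbb Z$-linearly independent family in $\Phi$, $(\cdot,\cdot):\Phi\times\Phi\to\mathbb Q$ a symmetric bilinear form such that $(\alpha_i,\alpha_i)$ is a positive even integer for all $i$ and $(\alpha_i,\alpha_j)\le 0$ for $i\ne j$, and let $\lambda_i\in\mathrm{Hom}(\Phi,\mathbb Z)$ satisfy $\lambda_i(\alpha)=2(\alpha_i,\alpha)/(\alpha_i,\alpha_i)$ for $\alpha\in\Phi$. **The algebra $U(\mathfrak g)^{an}_{r,s}$.** Let $U(\mathfrak g)$ be the unital associative $k$-algebra with generators $F_i,H_i,E_i$ ($i\in I$) and relations $$[H_i,H_j]=0,\quad [H_i,E_j]=(\alpha_i,\alpha_j)E_j,\quad [H_i,F_j]=-(\alpha_i,\alpha_j)F_j,\quad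 [E_i,F_j]=\delta_{ij}H_i,$$ and, for $i\neq j$ and $m=1-\lambda_i(\alpha_j)$, the Serre relations $$\sum_{l=0}^{m}(-1)^l\binom ml x_i^{m-l}x_jx_i^l=0\qquad(x=E\text{ and }x=F).$$ Let $r,s>0$ be real numbers with $1\le rs$. Define $\|x\|$, for $x\in U(\mathfrak g)$, as the infimum of the $C\ge0$ for which $x$ is a finite linear combination $$x=\sum c_{a,b,d}\,F_{a_1}\cdots F_{a_p}H_{b_1}\cdots H_{b_t}E_{d_1}\cdots E_{d_u},\qquad |c_{a,b,d}|\,r^{p}s^{u}\le C\ \text{ for all finite sequences } a,b,d\text{ in } I.$$ This is a submultiplicative ultrametric seminorm, and $U(\mathfrak g)^{an}_{r,s}$ is the completion of $U(\mathfrak g)$ for it. (Equivalently, $U(\mathfrak g)^{an}_{r,s}=U^-_r\,\hat\otimes\,\mathscr H_0\,\hat\otimes\,U^+_s$, where $\mathscr H_0$ is the completed polynomial algebra in the $H_i$ with all monomials of norm $1$, and $U^-_r$, $U^+_s$ are the quotients of the completed tensor algebras on the $F_i$ of norm $r$, respectively on the $E_i$ of norm $s$, by the closed ideals generated by the Serre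 relations.) **Bounded cohomology.** Let $\mathfrak g_{r,s}$ be the smallest closed Lie subalgebra of $U(\mathfrak g)^{an}_{r,s}$ (with the commutator bracket and the induced norm) containing all $F_i,H_i,E_i$. It acts on $M=U(\mathfrak g)^{an}_{r,s}$ by $x\cdot m=xm-mx$. Let $C^n_b$ be the space of bounded alternating $n$-linear maps $\mathfrak g_{r,s}^n\to M$, and $$\delta_n f(x_1,\dots,x_{n+1})=\sum_{1\le i<j\le n+1}(-1)^{i+j}f([x_i,x_j],x_1,..,\hat{x_i},..,\hat{x_j},..,x_{n+1})+\sum_{1\le i\le n+1}(-1)^{i+1}x_i\cdot f(x_1,..,\hat{x_i},..,x_{n+1}).$$ Put $H^n_b(\mathfrak g,U(\mathfrak g)^{an}_{r,s}):=\operatorname{Ker}(\delta_n)/\operatorname{Im}(\delta_{n-1})$. **Theorem.** Let $A$ be an IndBanach $k[\![\hbar]\!]$-algebra with a $k[\![\hbar]\!]$-linear isomorphism $\varphi:A\to U(\mathfrak g)^{an}_{r,s}[\![\hbar]\!]$ of IndBanach spaces that preserves the unit, and suppose that the induced isomorphism $\theta:A/\hbar A\to U(\mathfrak g)^{an}_{r,s}$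 is an isomorphism of algebras. If $H^2_b(\mathfrak g,U(\mathfrak g)^{an}_{r,s})=0$, then there is an isomorphism $\psi:A\to U(\mathfrak g)^{an}_{r,s}[\![\hbar]\!]$ of $k[\![\hbar]\!]$-algebras which induces $\theta$ modulo $\hbar$, i.e. the composite of $\psi$ with $\sum_n v_n\hbar^n\mapsto v_0$ equals the composite of $A\to A/\hbar A$ with $\theta$. -/

import Mathlib

namespace AnalyticRigidity

open CategoryTheory
open scoped ENNReal

universe u v w v₁ w₁ v₂ w₂ v₃ w₃ v₄ w₄

/-! ### Non-Archimedean Banach spaces and bounded maps -/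

/-- A bounded `k`-linear map.  (The valuation of `k` may be trivial, so boundedness is required
explicitly; it is then stronger than continuity.) -/
structure BddLin (k : Type u) [NormedField k] (E : Type w₁) (F : Type w₂)
    [NormedAddCommGroup E] [NormedSpace k E] [NormedAddCommGroup F] [NormedSpace k F] where
  lin : E →ₗ[k] F
  bdd : ∃ C : ℝ, ∀ x, ‖lin x‖ ≤ C * ‖x‖

/-- A bounded `k`-bilinear map `E × F → G`; these are the bounded linear maps out of the completed
tensor product of `E` and `F`, by its universal property. -/
structure BddBilin (k : Type u) [NormedField k] (E : Type w₁) (F : Type w₂) (G : Type w₃)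
    [NormedAddCommGroup E] [NormedSpace k E] [NormedAddCommGroup F] [NormedSpace k F]
    [NormedAddCommGroup G] [NormedSpace k G] where
  lin : E →ₗ[k] F →ₗ[k] G
  bdd : ∃ C : ℝ, ∀ x y, ‖lin x y‖ ≤ C * ‖x‖ * ‖y‖

section Ban

variable {k : Type u} [NormedField k] {E : Type w₁} {F : Type w₂} {G : Type w₃}
  [NormedAddCommGroup E] [NormedSpace k E] [NormedAddCommGroup F] [NormedSpace k F]
  [NormedAddCommGroup G] [NormedSpace k G]

@[ext] theorem BddLin.ext {f g : BddLin k E F} (h : ∀ x, f.lin x = g.lin x) : f = g := by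
  cases f; cases g; congr; exact LinearMap.ext h

/-- The identity, as a bounded map. -/
def BddLin.id : BddLin k E E := ⟨LinearMap.id, 1, fun x => by simp⟩

/-- Composition `g ∘ f` of bounded maps. -/
def BddLin.comp (g : BddLin k F G) (f : BddLin k E F) : BddLin k E G where
  lin := g.lin ∘ₗ f.lin
  bdd := by
    obtain ⟨C, hC⟩ := f.bdd
    obtain ⟨D, hD⟩ := g.bdd
    refine ⟨|D| * C, fun x => (hD _).trans ?_⟩
    calc D * ‖f.lin x‖ ≤ |D| * ‖f.lin x‖ := by gcongr; exact le_abs_self D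
      _ ≤ |D| * (C * ‖x‖) := by gcongr; exact hC x
      _ = |D| * C * ‖x‖ := by ring

end Ban

/-- A `k`-Banach space whose norm satisfies the strong triangle inequality. -/
structure Ban (k : Type u) [NormedField k] where
  carrier : Type w
  [grp : NormedAddCommGroup carrier]
  [space : NormedSpace k carrier]
  [complete : CompleteSpace carrier]
  [ultra : IsUltrametricDist carrier]

attribute [instance] Ban.grp Ban.space Ban.complete Ban.ultra

/-- The category of (non-Archimedean) `k`-Banach spaces and bounded linear maps. -/
instance Ban.category (k : Type u) [NormedField k] : Category (Ban.{u, w} k) where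
  Hom V W := BddLin k V.carrier W.carrier
  id _ := BddLin.id
  comp f g := BddLin.comp g f

/-! ### IndBanach spaces -/

/-- An IndBanach space: a small filtered diagram of Banach spaces, thought of as the formal
colimit of that diagram. -/
structure IndBan (k : Type u) [NormedField k] where
  ι : Type v
  [cat : SmallCategory ι]
  [filtered : IsFiltered ι]
  diag : ι ⥤ Ban.{u, w} k

attribute [instance] IndBan.cat IndBan.filtered

section IndBan

variable {k : Type u} [NormedField k]

/-- The Banach space at stage `i` of the diagram. -/
abbrev IndBan.sp (X : IndBan.{u, v, w} k) (i : X.ι) : Type w := (X.diag.obj i).carrier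

/-- The transition maps of the diagram. -/
def IndBan.tr (X : IndBan.{u, v, w} k) {i j : X.ι} (a : i ⟶ j) : X.sp i →ₗ[k] X.sp j :=
  BddLin.lin (X.diag.map a)

theorem IndBan.tr_id (X : IndBan.{u, v, w} k) (i : X.ι) (x : X.sp i) : X.tr (𝟙 i) x = x := by
  unfold IndBan.tr; rw [X.diag.map_id]; rfl

theorem IndBan.tr_comp (X : IndBan.{u, v, w} k) {i j l : X.ι} (a : i ⟶ j) (b : j ⟶ l)
    (x : X.sp i) : X.tr (a ≫ b) x = X.tr b (X.tr a x) := by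
  unfold IndBan.tr; rw [X.diag.map_comp]; rfl

/-- Two maps `f`, `g` from a set into two stages of `X` are identified in the formal colimit: they
become equal after transition to a common later stage. -/
def IndBan.EvEq (X : IndBan.{u, v, w} k) {T : Type*} {i j : X.ι} (f : T → X.sp i)
    (g : T → X.sp j) : Prop :=
  ∃ (l : X.ι) (a : i ⟶ l) (b : j ⟶ l), ∀ t, X.tr a (f t) = X.tr b (g t)

/-- A generalised element `k → X`, given by an element of some stage. -/
structure IndBan.Elem (X : IndBan.{u, v, w} k) where
  idx : X.ι
  val : X.sp idx

/-- A representative of a morphism of IndBanach spaces, that is of an element of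
`lim_i colim_j Hom (X i, Y j)`.  Two representatives give the same morphism iff they are related
by `IndBan.Hom.Equiv`. -/
structure IndBan.Hom (X : IndBan.{u, v₁, w₁} k) (Y : IndBan.{u, v₂, w₂} k) where
  idx : X.ι → Y.ι
  map : ∀ i, BddLin k (X.sp i) (Y.sp (idx i))
  compat : ∀ {i i' : X.ι} (a : i ⟶ i'),
    Y.EvEq (fun x => (map i).lin x) (fun x => (map i').lin (X.tr a x))

/-- Equality of the morphisms of IndBanach spaces represented by `f` and `g`. -/
def IndBan.Hom.Equiv {X : IndBan.{u, v₁, w₁} k} {Y : IndBan.{u, v₂, w₂} k}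
    (f g : IndBan.Hom X Y) : Prop :=
  ∀ i, Y.EvEq (fun x => (f.map i).lin x) (fun x => (g.map i).lin x)

/-- The morphism represented by `f` is zero. -/
def IndBan.Hom.IsZero {X : IndBan.{u, v₁, w₁} k} {Y : IndBan.{u, v₂, w₂} k}
    (f : IndBan.Hom X Y) : Prop :=
  ∀ i, Y.EvEq (fun x => (f.map i).lin x) (fun _ => (0 : Y.sp (f.idx i)))

/-- The identity morphism. -/
def IndBan.Hom.id (X : IndBan.{u, v, w} k) : IndBan.Hom X X where
  idx i := i
  map _ := BddLin.id
  compat {i i'} a := ⟨i', a, 𝟙 i', fun x => by rw [X.tr_id]; rfl⟩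

/-- The composition `g ∘ f` of morphisms of IndBanach spaces. -/
def IndBan.Hom.comp {X : IndBan.{u, v₁, w₁} k} {Y : IndBan.{u, v₂, w₂} k}
    {Z : IndBan.{u, v₃, w₃} k} (g : IndBan.Hom Y Z) (f : IndBan.Hom X Y) : IndBan.Hom X Z where
  idx i := g.idx (f.idx i)
  map i := (g.map (f.idx i)).comp (f.map i)
  compat {i i'} a := by
    obtain ⟨l, b, b', h⟩ := f.compat a
    obtain ⟨m, c, c', hc⟩ := g.compat b
    obtain ⟨n, d, d', hd⟩ := g.compat b'
    obtain ⟨p, e, e', he⟩ : ∃ (p : Z.ι) (e : m ⟶ p) (e' : n ⟶ p), c' ≫ e = d' ≫ e' := by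
      refine ⟨IsFiltered.coeq (c' ≫ IsFiltered.leftToMax m n) (d' ≫ IsFiltered.rightToMax m n),
        IsFiltered.leftToMax m n ≫ IsFiltered.coeqHom _ _,
        IsFiltered.rightToMax m n ≫ IsFiltered.coeqHom _ _, ?_⟩
      simpa using IsFiltered.coeq_condition (c' ≫ IsFiltered.leftToMax m n)
        (d' ≫ IsFiltered.rightToMax m n)
    refine ⟨p, c ≫ e, d ≫ e', fun x => ?_⟩
    have h1 := hc ((f.map i).lin x)
    have h2 := hd ((f.map i').lin (X.tr a x))
    have h3 := h x
    simp only [BddLin.comp, LinearMap.comp_apply, IndBan.tr_comp] at *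
    rw [h1, h2, h3, ← IndBan.tr_comp, ← IndBan.tr_comp, he]

/-- An isomorphism of IndBanach spaces. -/
structure IndBan.Iso (X : IndBan.{u, v₁, w₁} k) (Y : IndBan.{u, v₂, w₂} k) where
  hom : IndBan.Hom X Y
  inv : IndBan.Hom Y X
  hom_inv : (inv.comp hom).Equiv (IndBan.Hom.id X)
  inv_hom : (hom.comp inv).Equiv (IndBan.Hom.id Y)

/-- A representative of a morphism `X ⊗ Y → Z` from the completed tensor product of IndBanach
spaces, that is of an element of
`lim_{i, j} colim_l Hom (X i ⊗ Y j, Z l) = lim_{i, j} colim_l Bilin (X i, Y j; Z l)`. -/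
structure IndBan.Bihom (X : IndBan.{u, v₁, w₁} k) (Y : IndBan.{u, v₂, w₂} k)
    (Z : IndBan.{u, v₃, w₃} k) where
  idx : X.ι → Y.ι → Z.ι
  map : ∀ i j, BddBilin k (X.sp i) (Y.sp j) (Z.sp (idx i j))
  compat : ∀ {i i' : X.ι} {j j' : Y.ι} (a : i ⟶ i') (b : j ⟶ j'),
    Z.EvEq (fun p : X.sp i × Y.sp j => (map i j).lin p.1 p.2)
      (fun p => (map i' j').lin (X.tr a p.1) (Y.tr b p.2))

/-- Evaluation of a morphism `X ⊗ Y → Z` at a generalised element `k → X`. -/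
def IndBan.Bihom.leftAt {X : IndBan.{u, v₁, w₁} k} {Y : IndBan.{u, v₂, w₂} k}
    {Z : IndBan.{u, v₃, w₃} k} (m : IndBan.Bihom X Y Z) (e : X.Elem) : IndBan.Hom Y Z where
  idx j := m.idx e.idx j
  map j :=
    { lin := (m.map e.idx j).lin e.val
      bdd := by
        obtain ⟨C, hC⟩ := (m.map e.idx j).bdd
        exact ⟨C * ‖e.val‖, fun y => hC _ _⟩ }
  compat {j j'} b := by
    obtain ⟨l, c, d, h⟩ := m.compat (𝟙 e.idx) b
    exact ⟨l, c, d, fun y => by simpa [IndBan.tr_id] using h (e.val, y)⟩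

/-- `q : Y → Q` is a cokernel of `f : X → Y`. -/
def IndBan.IsCokernel {X : IndBan.{u, v₁, w₁} k} {Y : IndBan.{u, v₂, w₂} k}
    {Q : IndBan.{u, v₃, w₃} k} (f : IndBan.Hom X Y) (q : IndBan.Hom Y Q) : Prop :=
  (q.comp f).IsZero ∧
  ∀ (Z : IndBan.{u, v₃, w₃} k) (g : IndBan.Hom Y Z), (g.comp f).IsZero →
    ∃ h : IndBan.Hom Q Z, (h.comp q).Equiv g ∧
      ∀ h' : IndBan.Hom Q Z, (h'.comp q).Equiv g → h'.Equiv h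

/-- A Banach space, regarded as a constant diagram. -/
def IndBan.const (k : Type u) [NormedField k] (V : Type w) [NormedAddCommGroup V]
    [NormedSpace k V] [CompleteSpace V] [IsUltrametricDist V] : IndBan.{u, 0, w} k where
  ι := PUnit
  diag := (Functor.const PUnit).obj ⟨V⟩

/-! ### IndBanach algebras -/

/-- An IndBanach algebra: an associative unital algebra object `(X, mul, one)` of the monoidal
category of IndBanach spaces.  Each axiom is an equality of morphisms out of a tensor power of
`X`, stated at every stage. -/
structure IndBanAlg (k : Type u) [NormedField k] extends IndBan.{u, v, w} k where
  mul : IndBan.Bihom toIndBan toIndBan toIndBan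
  one : toIndBan.Elem
  one_mul : ∀ i, toIndBan.EvEq (fun x => (mul.map one.idx i).lin one.val x)
    (fun x : toIndBan.sp i => x)
  mul_one : ∀ i, toIndBan.EvEq (fun x => (mul.map i one.idx).lin x one.val)
    (fun x : toIndBan.sp i => x)
  mul_assoc : ∀ i j l, toIndBan.EvEq
    (fun p : toIndBan.sp i × toIndBan.sp j × toIndBan.sp l =>
      (mul.map (mul.idx i j) l).lin ((mul.map i j).lin p.1 p.2.1) p.2.2)
    (fun p => (mul.map i (mul.idx j l)).lin p.1 ((mul.map j l).lin p.2.1 p.2.2))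

/-- An algebra over the (commutative) IndBanach algebra `R`: an IndBanach algebra with an
`R`-module structure `act` for which the multiplication is `R`-bilinear. -/
structure IndBanAlgOver {k : Type u} [NormedField k] (R : IndBanAlg.{u, v₁, w₁} k)
    extends IndBanAlg.{u, v, w} k where
  act : IndBan.Bihom R.toIndBan toIndBan toIndBan
  one_act : ∀ i, toIndBan.EvEq (fun x => (act.map R.one.idx i).lin R.one.val x)
    (fun x : toIndBan.sp i => x)
  mul_act : ∀ a b i, toIndBan.EvEq
    (fun p : R.sp a × R.sp b × toIndBan.sp i =>
      (act.map (R.mul.idx a b) i).lin ((R.mul.map a b).lin p.1 p.2.1) p.2.2)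
    (fun p => (act.map a (act.idx b i)).lin p.1 ((act.map b i).lin p.2.1 p.2.2))
  act_mul_left : ∀ a i j, toIndBan.EvEq
    (fun p : R.sp a × toIndBan.sp i × toIndBan.sp j =>
      (act.map a (mul.idx i j)).lin p.1 ((mul.map i j).lin p.2.1 p.2.2))
    (fun p => (mul.map (act.idx a i) j).lin ((act.map a i).lin p.1 p.2.1) p.2.2)
  act_mul_right : ∀ a i j, toIndBan.EvEq
    (fun p : R.sp a × toIndBan.sp i × toIndBan.sp j =>
      (act.map a (mul.idx i j)).lin p.1 ((mul.map i j).lin p.2.1 p.2.2))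
    (fun p => (mul.map i (act.idx a j)).lin p.2.1 ((act.map a j).lin p.1 p.2.2))

/-- The morphism `f` preserves units. -/
def IndBanAlg.PreservesOne {A : IndBanAlg.{u, v₁, w₁} k} {B : IndBanAlg.{u, v₂, w₂} k}
    (f : IndBan.Hom A.toIndBan B.toIndBan) : Prop :=
  B.EvEq (fun _ : Unit => (f.map A.one.idx).lin A.one.val) (fun _ => B.one.val)

/-- The morphism `f` is a morphism of (unital) IndBanach algebras. -/
def IndBanAlg.IsAlgHom {A : IndBanAlg.{u, v₁, w₁} k} {B : IndBanAlg.{u, v₂, w₂} k}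
    (f : IndBan.Hom A.toIndBan B.toIndBan) : Prop :=
  IndBanAlg.PreservesOne f ∧
  ∀ i j, B.EvEq
    (fun p : A.sp i × A.sp j => (f.map (A.mul.idx i j)).lin ((A.mul.map i j).lin p.1 p.2))
    (fun p => (B.mul.map (f.idx i) (f.idx j)).lin ((f.map i).lin p.1) ((f.map j).lin p.2))

/-- The morphism `f` is `R`-linear. -/
def IndBanAlgOver.IsLinear {R : IndBanAlg.{u, v₁, w₁} k} {A : IndBanAlgOver.{u, v₂, w₂} R}
    {B : IndBanAlgOver.{u, v₃, w₃} R} (f : IndBan.Hom A.toIndBan B.toIndBan) : Prop :=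
  ∀ a i, B.EvEq
    (fun p : R.sp a × A.sp i => (f.map (A.act.idx a i)).lin ((A.act.map a i).lin p.1 p.2))
    (fun p => (B.act.map a (f.idx i)).lin p.1 ((f.map i).lin p.2))

/-- A Banach algebra (with contracting multiplication), regarded as an IndBanach algebra. -/
def IndBanAlg.const (k : Type u) [NormedField k] (V : Type w) [NormedRing V]
    [NormedAlgebra k V] [CompleteSpace V] [IsUltrametricDist V] : IndBanAlg.{u, 0, w} k where
  toIndBan := IndBan.const k V
  mul :=
    { idx := fun _ _ => PUnit.unit
      map := fun _ _ => ⟨LinearMap.mul k V, 1, fun x y => by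
        rw [_root_.one_mul]; exact norm_mul_le (α := V) x y⟩
      compat := fun _ _ => ⟨PUnit.unit, 𝟙 _, 𝟙 _, fun _ => rfl⟩ }
  one := ⟨PUnit.unit, (1 : V)⟩
  one_mul _ := ⟨PUnit.unit, 𝟙 _, 𝟙 _, fun x => _root_.one_mul (M := V) x⟩
  mul_one _ := ⟨PUnit.unit, 𝟙 _, 𝟙 _, fun x => _root_.mul_one (M := V) x⟩
  mul_assoc _ _ _ := ⟨PUnit.unit, 𝟙 _, 𝟙 _, fun p => _root_.mul_assoc (G := V) p.1 p.2.1 p.2.2⟩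

end IndBan
/-! ### Formal power series with Banach coefficients -/

/-- The Banach space `V` with its norm rescaled by `c > 0`. -/
def Scaled (_c : {c : ℝ // 0 < c}) (V : Type w) : Type w := V

section Scaled

variable (c : {c : ℝ // 0 < c}) (V : Type w)

instance [NormedAddCommGroup V] : AddCommGroup (Scaled c V) := inferInstanceAs (AddCommGroup V)

instance [NormedAddCommGroup V] : NormedAddCommGroup (Scaled c V) :=
  AddGroupNorm.toNormedAddCommGroup
    { toFun := fun x => (c : ℝ) * ‖(show V from x)‖
      map_zero' := by
        have : ‖(0 : V)‖ = 0 := norm_zero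
        exact (congrArg _ this).trans (mul_zero _)
      add_le' := fun x y =>
        (mul_le_mul_of_nonneg_left (norm_add_le (E := V) x y) (le_of_lt c.2)).trans_eq (mul_add _ _ _)
      neg' := fun x => congrArg _ (norm_neg (E := V) x)
      eq_zero_of_map_eq_zero' := fun x hx => by
        have h := (mul_eq_zero.1 hx).resolve_left (ne_of_gt c.2)
        exact norm_eq_zero.1 h }

theorem Scaled.norm_def [NormedAddCommGroup V] (x : Scaled c V) :
    ‖x‖ = c * ‖(show V from x)‖ := rfl

instance (k : Type u) [NormedField k] [NormedAddCommGroup V] [NormedSpace k V] :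
    Module k (Scaled c V) := inferInstanceAs (Module k V)

instance (k : Type u) [NormedField k] [NormedAddCommGroup V] [NormedSpace k V] :
    NormedSpace k (Scaled c V) where
  norm_smul_le a x := by
    have h : ‖a • (show V from x)‖ = ‖a‖ * ‖(show V from x)‖ := norm_smul _ _
    exact le_of_eq ((congrArg _ h).trans (mul_left_comm _ _ _))

instance [NormedAddCommGroup V] [IsUltrametricDist V] : IsUltrametricDist (Scaled c V) := by
  refine IsUltrametricDist.isUltrametricDist_of_forall_norm_add_le_max_norm fun x y => ?_
  have h : ‖(show V from x) + (show V from y)‖ ≤ max ‖(show V from x)‖ ‖(show V from y)‖ :=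
    IsUltrametricDist.norm_add_le_max _ _
  rw [Scaled.norm_def, Scaled.norm_def, Scaled.norm_def, ← mul_max_of_nonneg _ _ (le_of_lt c.2)]
  exact mul_le_mul_of_nonneg_left h (le_of_lt c.2)

instance [NormedAddCommGroup V] [CompleteSpace V] : CompleteSpace (Scaled c V) := by
  have hc : (0 : ℝ) < c := c.2
  let f : V →+ Scaled c V := AddMonoidHom.id V
  have h1 : ∀ x : V, ‖f x‖ = c * ‖x‖ := fun _ => rfl
  refine Metric.complete_of_cauchySeq_tendsto fun s hs => ?_
  have hs' : CauchySeq (fun n => (show V from s n)) := by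
    rw [Metric.cauchySeq_iff'] at hs ⊢
    intro ε hε
    obtain ⟨N, hN⟩ := hs (c * ε) (by positivity)
    refine ⟨N, fun n hn => ?_⟩
    have := hN n hn
    rw [dist_eq_norm] at this ⊢
    have h2 : ‖s n - s N‖ = c * ‖(show V from s n) - (show V from s N)‖ := rfl
    rw [h2] at this
    exact lt_of_mul_lt_mul_left this hc.le
  obtain ⟨x, hx⟩ := cauchySeq_tendsto_of_complete hs'
  refine ⟨f x, ?_⟩
  rw [Metric.tendsto_atTop] at hx ⊢
  intro ε hε
  obtain ⟨N, hN⟩ := hx (ε / c) (by positivity)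
  refine ⟨N, fun n hn => ?_⟩
  have := hN n hn
  rw [dist_eq_norm] at this ⊢
  have h2 : ‖s n - f x‖ = c * ‖(show V from s n) - x‖ := rfl
  rw [h2]
  rwa [lt_div_iff₀' hc] at this

end Scaled

/-- Sequences `(r_n)` of positive reals, ordered so that larger sequences have smaller terms. -/
structure Weights where
  toFun : ℕ → {c : ℝ // 0 < c}

instance : CoeFun Weights (fun _ => ℕ → {c : ℝ // 0 < c}) := ⟨Weights.toFun⟩

instance : Preorder Weights where
  le r r' := ∀ n, (r' n : ℝ) ≤ r n
  le_refl _ _ := le_rfl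
  le_trans _ _ _ h h' n := (h' n).trans (h n)

instance : Nonempty Weights := ⟨⟨fun _ => ⟨1, one_pos⟩⟩⟩

instance : IsDirectedOrder Weights where
  directed r r' := ⟨⟨fun n => ⟨min (r n : ℝ) (r' n), lt_min (r n).2 (r' n).2⟩⟩,
    fun _ => min_le_left _ _, fun _ => min_le_right _ _⟩

/-- The contracting product of the rescaled spaces `V_{r_n}`: sequences `(v_n)` in `V` with
`sup r_n ‖v_n‖ < ∞`, normed by this supremum. -/
abbrev WSeq (r : Weights) (V : Type w) [NormedAddCommGroup V] : Type w :=
  lp (fun n => Scaled (r n) V) ∞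

section WSeq

variable {k : Type u} [NormedField k] {V : Type w} [NormedAddCommGroup V] [NormedSpace k V]

instance WSeq.ultra (r : Weights) [IsUltrametricDist V] : IsUltrametricDist (WSeq r V) := by
  refine IsUltrametricDist.isUltrametricDist_of_forall_norm_add_le_max_norm fun x y => ?_
  refine lp.norm_le_of_forall_le (le_max_of_le_left (norm_nonneg x)) fun n => ?_
  refine (IsUltrametricDist.norm_add_le_max (x n) (y n)).trans ?_
  exact max_le_max (lp.norm_apply_le_norm ENNReal.top_ne_zero x n)
    (lp.norm_apply_le_norm ENNReal.top_ne_zero y n)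

/-- The `n`-th coefficient. -/
noncomputable def WSeq.coeff (k : Type u) [NormedField k] [NormedSpace k V] {r : Weights} (n : ℕ) :
    WSeq r V →ₗ[k] V where
  toFun v := v n
  map_add' _ _ := rfl
  map_smul' _ _ := rfl

theorem WSeq.ext {r : Weights} {v v' : WSeq r V}
    (h : ∀ n, WSeq.coeff k n v = WSeq.coeff k n v') : v = v' :=
  lp.ext (funext h)

theorem WSeq.norm_coeff_le {r : Weights} (v : WSeq r V) (n : ℕ) :
    r n * ‖WSeq.coeff k n v‖ ≤ ‖v‖ :=
  lp.norm_apply_le_norm ENNReal.top_ne_zero v n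

theorem WSeq.norm_le {r : Weights} {v : WSeq r V} {C : ℝ} (hC : 0 ≤ C)
    (h : ∀ n, r n * ‖WSeq.coeff k n v‖ ≤ C) : ‖v‖ ≤ C :=
  lp.norm_le_of_forall_le hC h

/-- The element with given coefficients. -/
noncomputable def WSeq.mk (r : Weights) (v : ℕ → V) (h : ∃ C : ℝ, ∀ n, r n * ‖v n‖ ≤ C) : WSeq r V :=
  ⟨(fun n => v n : ∀ n, Scaled (r n) V), by
    obtain ⟨C, hC⟩ := h
    refine memℓp_infty (E := fun n => Scaled (r n) V) ⟨C, ?_⟩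
    rintro _ ⟨n, rfl⟩
    exact hC n⟩

@[simp] theorem WSeq.coeff_mk (r : Weights) (v : ℕ → V) (h : ∃ C : ℝ, ∀ n, r n * ‖v n‖ ≤ C)
    (n : ℕ) : WSeq.coeff k n (WSeq.mk r v h) = v n := rfl

/-- The `n`-th coefficient, as a bounded map. -/
noncomputable def WSeq.coeffBdd (k : Type u) [NormedField k] (V : Type w) [NormedAddCommGroup V]
    [NormedSpace k V] (n : ℕ) (r : Weights) : BddLin k (WSeq r V) V where
  lin := WSeq.coeff k n
  bdd := ⟨(r n : ℝ)⁻¹, fun v => by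
    have hr : (0 : ℝ) < r n := (r n).2
    rw [inv_mul_eq_div, le_div_iff₀' hr]
    exact WSeq.norm_coeff_le v n⟩

/-- The inclusion of weighted sequence spaces when the weights decrease. -/
noncomputable def WSeq.incl (k : Type u) [NormedField k] [NormedSpace k V] {r r' : Weights} (h : r ≤ r') :
    BddLin k (WSeq r V) (WSeq r' V) where
  lin :=
    { toFun := fun v => WSeq.mk r' (fun n => WSeq.coeff k n v) ⟨‖v‖, fun n =>
        (mul_le_mul_of_nonneg_right (h n) (norm_nonneg _)).trans (WSeq.norm_coeff_le v n)⟩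
      map_add' := fun _ _ => rfl
      map_smul' := fun _ _ => rfl }
  bdd := ⟨1, fun v => by
    rw [one_mul]
    exact WSeq.norm_le (k := k) (norm_nonneg v) fun n =>
      (mul_le_mul_of_nonneg_right (h n) (norm_nonneg _)).trans (WSeq.norm_coeff_le (k := k) v n)⟩

end WSeq

section Conv

variable {k : Type u} [NormedField k] {E : Type w₁} {F : Type w₂} {G : Type w₃}
  [NormedAddCommGroup E] [NormedSpace k E] [NormedAddCommGroup F] [NormedSpace k F]
  [NormedAddCommGroup G] [NormedSpace k G] [IsUltrametricDist G]

/-- The weights receiving Cauchy products of series with weights `r` and `r'`. -/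
noncomputable def Weights.conv (r r' : Weights) : Weights where
  toFun n := ⟨(Finset.HasAntidiagonal.antidiagonal n).inf' ⟨(0, n), by simp⟩
      fun p => (r p.1 : ℝ) * r' p.2,
    (Finset.lt_inf'_iff _).2 fun p _ => mul_pos (r p.1).2 (r' p.2).2⟩

theorem WSeq.cauchy_bound (β : E →ₗ[k] F →ₗ[k] G) (hβ : ∀ x y, ‖β x y‖ ≤ ‖x‖ * ‖y‖)
    (r r' : Weights) (x : WSeq r E) (y : WSeq r' F) (n : ℕ) :
    (Weights.conv r r' n : ℝ) * ‖∑ p ∈ Finset.HasAntidiagonal.antidiagonal n,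
      β (WSeq.coeff k p.1 x) (WSeq.coeff k p.2 y)‖ ≤ ‖x‖ * ‖y‖ := by
  have hpos : (0 : ℝ) < Weights.conv r r' n := (Weights.conv r r' n).2
  rw [← le_div_iff₀' hpos]
  refine IsUltrametricDist.norm_sum_le_of_forall_le_of_nonneg (by positivity) fun p hp => ?_
  rw [le_div_iff₀' hpos]
  have h1 : (Weights.conv r r' n : ℝ) ≤ r p.1 * r' p.2 := Finset.inf'_le _ hp
  have hr : (0 : ℝ) < r p.1 := (r p.1).2
  have hr' : (0 : ℝ) < r' p.2 := (r' p.2).2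
  calc (Weights.conv r r' n : ℝ) * ‖β (WSeq.coeff k p.1 x) (WSeq.coeff k p.2 y)‖
      ≤ (r p.1 * r' p.2) * (‖WSeq.coeff k p.1 x‖ * ‖WSeq.coeff k p.2 y‖) := by
        gcongr
        exact hβ _ _
    _ = (r p.1 * ‖WSeq.coeff k p.1 x‖) * (r' p.2 * ‖WSeq.coeff k p.2 y‖) := by ring
    _ ≤ ‖x‖ * ‖y‖ := by
        gcongr
        · exact WSeq.norm_coeff_le x _
        · exact WSeq.norm_coeff_le y _

/-- The Cauchy product extending a contracting bilinear map `β : E × F → G`: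
`(∑ x_i ħ^i, ∑ y_j ħ^j) ↦ ∑ β(x_i, y_j) ħ^(i+j)`. -/
noncomputable def WSeq.cauchy (β : E →ₗ[k] F →ₗ[k] G) (hβ : ∀ x y, ‖β x y‖ ≤ ‖x‖ * ‖y‖)
    (r r' : Weights) : BddBilin k (WSeq r E) (WSeq r' F) (WSeq (Weights.conv r r') G) where
  lin := LinearMap.mk₂ k (fun (x : WSeq r E) (y : WSeq r' F) =>
        WSeq.mk (Weights.conv r r') (fun n => ∑ p ∈ Finset.HasAntidiagonal.antidiagonal n,
          β (WSeq.coeff k p.1 x) (WSeq.coeff k p.2 y)) ⟨_, WSeq.cauchy_bound β hβ r r' x y⟩)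
      (fun x x' y => WSeq.ext (k := k) fun n => by simp [Finset.sum_add_distrib])
      (fun c x y => WSeq.ext (k := k) fun n => by simp [Finset.smul_sum])
      (fun x y y' => WSeq.ext (k := k) fun n => by simp [Finset.sum_add_distrib])
      (fun c x y => WSeq.ext (k := k) fun n => by simp [Finset.smul_sum])
  bdd := ⟨1, fun x y => by
    rw [one_mul]
    exact WSeq.norm_le (k := k) (by positivity) (WSeq.cauchy_bound β hβ r r' x y)⟩

theorem WSeq.coeff_cauchy (β : E →ₗ[k] F →ₗ[k] G) (hβ : ∀ x y, ‖β x y‖ ≤ ‖x‖ * ‖y‖)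
    (r r' : Weights) (x : WSeq r E) (y : WSeq r' F) (n : ℕ) :
    WSeq.coeff k n ((WSeq.cauchy β hβ r r').lin x y) =
    ∑ p ∈ Finset.HasAntidiagonal.antidiagonal n,
      β (WSeq.coeff k p.1 x) (WSeq.coeff k p.2 y) := rfl

end Conv

section PowerSeries

variable (k : Type u) [NormedField k] (V : Type w) [NormedAddCommGroup V] [NormedSpace k V]
  [CompleteSpace V] [IsUltrametricDist V]

/-- The IndBanach space `V⟦ħ⟧ = ∏_n V·ħ^n`; this product of IndBanach spaces is
`colim_{(r_n)} ∏^{≤1}_n V_{r_n}`. -/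
noncomputable def pSeries : IndBan.{u, 0, w} k where
  ι := Weights
  diag :=
    { obj := fun r => ⟨WSeq r V⟩
      map := fun a => WSeq.incl k (leOfHom a)
      map_id := fun _ => rfl
      map_comp := fun _ _ => rfl }

variable {k V}

theorem pSeries.coeff_tr {r r' : Weights} (a : r ⟶ r') (v : WSeq r V) (n : ℕ) :
    WSeq.coeff k n ((pSeries k V).tr (i := r) (j := r') a v : WSeq r' V) = WSeq.coeff k n v := rfl

theorem pSeries.evEq {T : Type*} {r r' : Weights} {f : T → WSeq r V} {g : T → WSeq r' V}
    (h : ∀ t n, WSeq.coeff k n (f t) = WSeq.coeff k n (g t)) :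
    (pSeries k V).EvEq (i := r) (j := r') f g := by
  obtain ⟨l, (hl : r ≤ l), (hl' : r' ≤ l)⟩ := exists_ge_ge r r'
  exact ⟨l, homOfLE (X := Weights) hl, homOfLE (X := Weights) hl', fun t => WSeq.ext (k := k) (h t)⟩

variable (k V)

/-- The morphism `V⟦ħ⟧ → V`, `∑ v_n ħ^n ↦ v_n`. -/
noncomputable def pSeries.coeffHom (n : ℕ) : IndBan.Hom (pSeries k V) (IndBan.const k V) where
  idx _ := PUnit.unit
  map r := WSeq.coeffBdd k V n r
  compat _ := ⟨PUnit.unit, 𝟙 _, 𝟙 _, fun _ => rfl⟩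

/-- Reduction modulo `ħ`, `V⟦ħ⟧ → V`. -/
noncomputable def pSeries.modHbar : IndBan.Hom (pSeries k V) (IndBan.const k V) := pSeries.coeffHom k V 0

end PowerSeries

section PowerSeriesAlg

variable (k : Type u) [NormedField k] (V : Type w) [NormedRing V] [NormedAlgebra k V]

/-- The constant series `1`. -/
noncomputable def WSeq.one : WSeq ⟨fun _ => ⟨1, one_pos⟩⟩ V :=
  WSeq.mk _ (fun n => if n = 0 then 1 else 0) ⟨‖(1 : V)‖, fun n => by split <;> simp⟩

/-- The series `ħ`. -/
noncomputable def WSeq.hbar : WSeq ⟨fun _ => ⟨1, one_pos⟩⟩ V :=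
  WSeq.mk _ (fun n => if n = 1 then 1 else 0) ⟨‖(1 : V)‖, fun n => by split <;> simp⟩

/-- The formal power series underlying a weighted sequence. -/
noncomputable def WSeq.ps {r : Weights} (v : WSeq r V) : PowerSeries V :=
  PowerSeries.mk fun n => WSeq.coeff k n v

variable {V}

theorem WSeq.ext_ps {r r' : Weights} {v : WSeq r V} {v' : WSeq r' V}
    (h : WSeq.ps k V v = WSeq.ps k V v') (n : ℕ) : WSeq.coeff k n v = WSeq.coeff k n v' := by
  simpa [WSeq.ps] using congrArg (PowerSeries.coeff n) h

theorem WSeq.ps_one : WSeq.ps k V (WSeq.one V) = 1 := by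
  ext n
  simp [WSeq.ps, WSeq.one, PowerSeries.coeff_one]

theorem map_algebraMap_comm (f : PowerSeries k) (g : PowerSeries V) :
    g * PowerSeries.map (algebraMap k V) f = PowerSeries.map (algebraMap k V) f * g := by
  ext n
  rw [PowerSeries.coeff_mul, PowerSeries.coeff_mul, ← Finset.Nat.sum_antidiagonal_swap]
  simp [Algebra.commutes]

variable (V) [IsUltrametricDist V]

/-- The Cauchy product on `V⟦ħ⟧`. -/
noncomputable def WSeq.mul (r r' : Weights) :
    BddBilin k (WSeq r V) (WSeq r' V) (WSeq (Weights.conv r r') V) :=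
  WSeq.cauchy (LinearMap.mul k V) norm_mul_le r r'

/-- The action of `k⟦ħ⟧` on `V⟦ħ⟧`. -/
noncomputable def WSeq.smul (r r' : Weights) :
    BddBilin k (WSeq r k) (WSeq r' V) (WSeq (Weights.conv r r') V) :=
  WSeq.cauchy (LinearMap.lsmul k V) norm_smul_le r r'

variable {V}

theorem WSeq.ps_mul {r r' : Weights} (x : WSeq r V) (y : WSeq r' V) :
    WSeq.ps k V ((WSeq.mul k V r r').lin x y) = WSeq.ps k V x * WSeq.ps k V y := by
  ext n
  rw [PowerSeries.coeff_mul]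
  simp only [WSeq.ps, PowerSeries.coeff_mk]
  rfl

theorem WSeq.ps_smul {r r' : Weights} (x : WSeq r k) (y : WSeq r' V) :
    WSeq.ps k V ((WSeq.smul k V r r').lin x y) =
      PowerSeries.map (algebraMap k V) (WSeq.ps k k x) * WSeq.ps k V y := by
  ext n
  rw [PowerSeries.coeff_mul]
  simp only [WSeq.ps, PowerSeries.coeff_map, PowerSeries.coeff_mk, ← Algebra.smul_def]
  rfl

variable (V) [CompleteSpace V]

/-- For a Banach algebra `V`, the IndBanach algebra `V⟦ħ⟧` of formal power series. -/
noncomputable def pSeriesAlg : IndBanAlg.{u, 0, w} k where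
  toIndBan := pSeries k V
  mul :=
    { idx := Weights.conv
      map := WSeq.mul k V
      compat := fun _ _ => pSeries.evEq (V := V) fun _ _ => rfl }
  one := { idx := ⟨fun _ => ⟨1, one_pos⟩⟩, val := WSeq.one V }
  one_mul r :=
    have h (r : Weights) (x : WSeq r V) : WSeq.ps k V ((WSeq.mul k V _ r).lin (WSeq.one V) x)
        = WSeq.ps k V x := by rw [WSeq.ps_mul, WSeq.ps_one, _root_.one_mul]
    pSeries.evEq (V := V) (r' := r) fun x => WSeq.ext_ps k (r' := r) (h r x)
  mul_one r :=
    have h (r : Weights) (x : WSeq r V) : WSeq.ps k V ((WSeq.mul k V r _).lin x (WSeq.one V))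
        = WSeq.ps k V x := by rw [WSeq.ps_mul, WSeq.ps_one, _root_.mul_one]
    pSeries.evEq (V := V) (r' := r) fun x => WSeq.ext_ps k (r' := r) (h r x)
  mul_assoc r r' r'' :=
    have h {r r' r'' : Weights} (x : WSeq r V) (y : WSeq r' V) (z : WSeq r'' V) :
        WSeq.ps k V ((WSeq.mul k V _ _).lin ((WSeq.mul k V _ _).lin x y) z) =
          WSeq.ps k V ((WSeq.mul k V _ _).lin x ((WSeq.mul k V _ _).lin y z)) := by
      simp only [WSeq.ps_mul, _root_.mul_assoc]
    pSeries.evEq (V := V) fun p => WSeq.ext_ps k (by exact h p.1 p.2.1 p.2.2)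

/-- The IndBanach algebra `k⟦ħ⟧`. -/
noncomputable abbrev kPowerSeries [IsUltrametricDist k] [CompleteSpace k] :
    IndBanAlg.{u, 0, u} k :=
  pSeriesAlg k k

variable [IsUltrametricDist k] [CompleteSpace k]

/-- For a Banach algebra `V`, the `k⟦ħ⟧`-algebra `V⟦ħ⟧`. -/
noncomputable def pSeriesAlgOver : IndBanAlgOver.{u, 0, w} (kPowerSeries k) where
  toIndBanAlg := pSeriesAlg k V
  act :=
    { idx := Weights.conv
      map := WSeq.smul k V
      compat := fun _ _ => pSeries.evEq (V := V) fun _ _ => rfl }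
  one_act r :=
    have h (r : Weights) (x : WSeq r V) : WSeq.ps k V ((WSeq.smul k V _ r).lin (WSeq.one k) x)
        = WSeq.ps k V x := by rw [WSeq.ps_smul, WSeq.ps_one, map_one, _root_.one_mul]
    pSeries.evEq (V := V) (r' := r) fun x => WSeq.ext_ps k (r' := r) (h r x)
  mul_act a b r :=
    have h {a b r : Weights} (x : WSeq a k) (y : WSeq b k) (z : WSeq r V) :
        WSeq.ps k V ((WSeq.smul k V _ _).lin ((WSeq.mul k k _ _).lin x y) z) =
          WSeq.ps k V ((WSeq.smul k V _ _).lin x ((WSeq.smul k V _ _).lin y z)) := by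
      simp only [WSeq.ps_smul, WSeq.ps_mul, map_mul, _root_.mul_assoc]
    pSeries.evEq (V := V) fun p => WSeq.ext_ps k (by exact h p.1 p.2.1 p.2.2)
  act_mul_left a r r' :=
    have h {a r r' : Weights} (x : WSeq a k) (y : WSeq r V) (z : WSeq r' V) :
        WSeq.ps k V ((WSeq.smul k V _ _).lin x ((WSeq.mul k V _ _).lin y z)) =
          WSeq.ps k V ((WSeq.mul k V _ _).lin ((WSeq.smul k V _ _).lin x y) z) := by
      simp only [WSeq.ps_smul, WSeq.ps_mul, _root_.mul_assoc]
    pSeries.evEq (V := V) fun p => WSeq.ext_ps k (by exact h p.1 p.2.1 p.2.2)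
  act_mul_right a r r' :=
    have h {a r r' : Weights} (x : WSeq a k) (y : WSeq r V) (z : WSeq r' V) :
        WSeq.ps k V ((WSeq.smul k V _ _).lin x ((WSeq.mul k V _ _).lin y z)) =
          WSeq.ps k V ((WSeq.mul k V _ _).lin y ((WSeq.smul k V _ _).lin x z)) := by
      rw [WSeq.ps_smul, WSeq.ps_mul, WSeq.ps_mul, WSeq.ps_smul, ← _root_.mul_assoc,
        ← _root_.mul_assoc, map_algebraMap_comm]
    pSeries.evEq (V := V) fun p => WSeq.ext_ps k (by exact h p.1 p.2.1 p.2.2)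

variable {k}

/-- Multiplication by `ħ` on a `k⟦ħ⟧`-algebra. -/
noncomputable def hbarMul (A : IndBanAlgOver.{u, v₁, w₁} (kPowerSeries k)) :
    IndBan.Hom A.toIndBan A.toIndBan :=
  A.act.leftAt { idx := ⟨fun _ => ⟨1, one_pos⟩⟩, val := WSeq.hbar k }

end PowerSeriesAlg


/-! ### Bounded Lie algebra cohomology -/

section Cohomology

variable (k : Type u) [NormedField k] (g : Type v) [LieRing g] [LieAlgebra k g] [Norm g]
  (M : Type w) [NormedAddCommGroup M] [NormedSpace k M] [LieRingModule g M] [LieModule k g M]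

/-- Bounded alternating `n`-linear maps from `g` to `M`. -/
def boundedCochains (n : ℕ) : Submodule k ((Fin n → g) → M) where
  carrier := {f | (∃ φ : g [⋀^Fin n]→ₗ[k] M, ⇑φ = f) ∧ ∃ C : ℝ, ∀ x, ‖f x‖ ≤ C * ∏ i, ‖x i‖}
  zero_mem' := ⟨⟨0, rfl⟩, 0, fun x => by simp⟩
  add_mem' := by
    rintro f f' ⟨⟨φ, rfl⟩, C, hC⟩ ⟨⟨φ', rfl⟩, C', hC'⟩
    refine ⟨⟨φ + φ', rfl⟩, C + C', fun x => ?_⟩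
    rw [add_mul]
    exact (norm_add_le _ _).trans (add_le_add (hC x) (hC' x))
  smul_mem' := by
    rintro c f ⟨⟨φ, rfl⟩, C, hC⟩
    refine ⟨⟨c • φ, rfl⟩, ‖c‖ * C, fun x => ?_⟩
    rw [mul_assoc]
    exact (norm_smul_le c (φ x)).trans (mul_le_mul_of_nonneg_left (hC x) (norm_nonneg c))

variable {g M}

/-- The sum `∑_{i < j} (-1)^(i+j) f([x_i, x_j], x_0, .., x̂_i, .., x̂_j, .., x_n)`. -/
def bracketSum : ∀ n : ℕ, ((Fin n → g) → M) → (Fin (n + 1) → g) → M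
  | 0, _, _ => 0
  | n + 1, f, x => ∑ j : Fin (n + 2), ∑ i : Fin (n + 1),
      if i.castSucc < j then
        (-1 : ℤ) ^ (i.val + j.val) •
          f (Fin.cons ⁅x i.castSucc, x j⁆ (i.removeNth (j.removeNth x)) : Fin (n + 1) → g)
      else 0

/-- The Chevalley–Eilenberg differential
`δ f (x_0, .., x_n) = ∑_{i < j} (-1)^(i+j) f([x_i, x_j], .., x̂_i, .., x̂_j, ..)`
`+ ∑_i (-1)^i x_i f(.., x̂_i, ..)`. -/
def ceDifferential (n : ℕ) : ((Fin n → g) → M) →ₗ[k] ((Fin (n + 1) → g) → M) where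
  toFun f x := bracketSum n f x + ∑ i : Fin (n + 1), (-1 : ℤ) ^ i.val • ⁅x i, f (i.removeNth x)⁆
  map_add' f f' := by
    have h : ∀ x : Fin (n + 1) → g, bracketSum n (f + f') x = bracketSum n f x + bracketSum n f' x := by
      intro x
      cases n with
      | zero => simp [bracketSum]
      | succ n =>
        simp only [bracketSum, ← Finset.sum_add_distrib]
        refine Finset.sum_congr rfl fun j _ => Finset.sum_congr rfl fun i _ => ?_
        split <;> simp
    funext x
    simp only [h, Pi.add_apply, lie_add, smul_add, Finset.sum_add_distrib]
    abel
  map_smul' c f := by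
    have h : ∀ x : Fin (n + 1) → g, bracketSum n (c • f) x = c • bracketSum n f x := by
      intro x
      cases n with
      | zero => simp [bracketSum]
      | succ n =>
        simp only [bracketSum, Finset.smul_sum]
        refine Finset.sum_congr rfl fun j _ => Finset.sum_congr rfl fun i _ => ?_
        split
        · rw [Pi.smul_apply, smul_comm]
        · simp
    funext x
    simp only [h, Pi.smul_apply, lie_smul, smul_add, Finset.smul_sum, RingHom.id_apply]
    congr 1
    exact Finset.sum_congr rfl fun i _ => smul_comm _ _ _

variable (g M)

/-- Bounded `n`-cocycles. -/
def boundedCocycles (n : ℕ) : Submodule k ((Fin n → g) → M) :=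
  boundedCochains k g M n ⊓ LinearMap.ker (ceDifferential k n)

/-- Bounded `n`-coboundaries. -/
def boundedCoboundaries : ∀ n : ℕ, Submodule k ((Fin n → g) → M)
  | 0 => ⊥
  | n + 1 => (boundedCochains k g M n).map (ceDifferential k n)

/-- The `n`-th bounded Lie algebra cohomology `H_b^n(g, M)`. -/
abbrev BoundedCohomology (n : ℕ) : Type (max v w) :=
  boundedCocycles k g M n ⧸ (boundedCoboundaries k g M n).comap (boundedCocycles k g M n).subtype

end Cohomology

/-! ### Root data and completed enveloping algebras -/

/-- A root datum with weight lattice `Φ` and simple roots indexed by `I` (the root lattice is the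
span of the simple roots). -/
structure RootDatum (I : Type v) (Φ : Type w) [AddCommGroup Φ] where
  free : Module.Free ℤ Φ
  root : I → Φ
  linearIndependent : LinearIndependent ℤ root
  form : Φ →ₗ[ℤ] Φ →ₗ[ℤ] ℚ
  form_symm : ∀ x y, form x y = form y x
  form_self : ∀ i, ∃ n : ℕ, 0 < n ∧ form (root i) (root i) = 2 * n
  form_nonpos : ∀ i j, i ≠ j → form (root i) (root j) ≤ 0
  coroot : I → Φ →ₗ[ℤ] ℤ
  coroot_eq : ∀ i x, (coroot i x : ℚ) = 2 * form (root i) x / form (root i) (root i)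

/-- The Chevalley generators. -/
inductive ChevalleyGen (I : Type v) : Type v
  | F (i : I)
  | H (i : I)
  | E (i : I)

section Enveloping

variable (k : Type u) [NormedField k] {I : Type v} {Φ : Type w} [AddCommGroup Φ]
  (D : RootDatum I Φ)

/-- The Serre element
`∑_l (-1)^l (m choose l) x^(m-l) y x^l` for `m = 1 - λ_i(α_j)`, where `x = v_i` and `y = v_j`. -/
def serre {R : Type*} [Ring R] (D : RootDatum I Φ) (v : I → R) (i j : I) : R :=
  let m := (1 - D.coroot i (D.root j)).toNat
  ∑ l ∈ Finset.range (m + 1), ((-1 : ℤ) ^ l * (m.choose l : ℤ)) • (v i ^ (m - l) * v j * v i ^ l)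

/-- The defining relations of the enveloping algebra. -/
inductive EnvRel : FreeAlgebra k (ChevalleyGen I) → FreeAlgebra k (ChevalleyGen I) → Prop
  | HH (i j : I) : EnvRel (FreeAlgebra.ι k (.H i) * FreeAlgebra.ι k (.H j))
      (FreeAlgebra.ι k (.H j) * FreeAlgebra.ι k (.H i))
  | HE (i j : I) : EnvRel
      (FreeAlgebra.ι k (.H i) * FreeAlgebra.ι k (.E j) -
        FreeAlgebra.ι k (.E j) * FreeAlgebra.ι k (.H i))
      ((D.form (D.root i) (D.root j) : k) • FreeAlgebra.ι k (.E j))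
  | HF (i j : I) : EnvRel
      (FreeAlgebra.ι k (.H i) * FreeAlgebra.ι k (.F j) -
        FreeAlgebra.ι k (.F j) * FreeAlgebra.ι k (.H i))
      (-(D.form (D.root i) (D.root j) : k) • FreeAlgebra.ι k (.F j))
  | EF (i : I) : EnvRel
      (FreeAlgebra.ι k (.E i) * FreeAlgebra.ι k (.F i) -
        FreeAlgebra.ι k (.F i) * FreeAlgebra.ι k (.E i))
      (FreeAlgebra.ι k (.H i))
  | EF_ne (i j : I) : i ≠ j → EnvRel
      (FreeAlgebra.ι k (.E i) * FreeAlgebra.ι k (.F j) -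
        FreeAlgebra.ι k (.F j) * FreeAlgebra.ι k (.E i)) 0
  | serreE (i j : I) : i ≠ j → EnvRel (serre D (fun i => FreeAlgebra.ι k (.E i)) i j) 0
  | serreF (i j : I) : i ≠ j → EnvRel (serre D (fun i => FreeAlgebra.ι k (.F i)) i j) 0

/-- Radii `r, s > 0` with `1 ≤ r s`. -/
structure Radii where
  r : ℝ
  s : ℝ
  r_pos : 0 < r
  s_pos : 0 < s
  one_le : 1 ≤ r * s

/-- The enveloping algebra `U(g)` over `k`; it carries the norm depending on the radii `ρ` that is
defined below. -/
def Env (_ρ : Radii) : Type (max u v) := RingQuot (EnvRel k D)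

instance (ρ : Radii) : Ring (Env k D ρ) := inferInstanceAs (Ring (RingQuot (EnvRel k D)))

instance (ρ : Radii) : Algebra k (Env k D ρ) :=
  inferInstanceAs (Algebra k (RingQuot (EnvRel k D)))

variable (ρ : Radii)

namespace Env

/-- The images of the generators in `U(g)`. -/
def gen (x : ChevalleyGen I) : Env k D ρ :=
  RingQuot.mkAlgHom k (EnvRel k D) (FreeAlgebra.ι k x)

variable {k}

theorem H_E (i j : I) : gen k D ρ (.H i) * gen k D ρ (.E j) =
    gen k D ρ (.E j) * gen k D ρ (.H i) +
      (D.form (D.root i) (D.root j) : k) • gen k D ρ (.E j) := by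
  have h := RingQuot.mkAlgHom_rel k (EnvRel.HE (k := k) (D := D) i j)
  rw [map_sub, map_mul, map_mul, map_smul] at h
  rw [← sub_eq_iff_eq_add']
  exact h

theorem H_F (i j : I) : gen k D ρ (.H i) * gen k D ρ (.F j) =
    gen k D ρ (.F j) * gen k D ρ (.H i) +
      (-(D.form (D.root i) (D.root j) : k)) • gen k D ρ (.F j) := by
  have h := RingQuot.mkAlgHom_rel k (EnvRel.HF (k := k) (D := D) i j)
  rw [map_sub, map_mul, map_mul, map_smul] at h
  rw [← sub_eq_iff_eq_add']
  exact h

theorem E_F (i : I) : gen k D ρ (.E i) * gen k D ρ (.F i) =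
    gen k D ρ (.F i) * gen k D ρ (.E i) + gen k D ρ (.H i) := by
  have h := RingQuot.mkAlgHom_rel k (EnvRel.EF (k := k) (D := D) i)
  rw [map_sub, map_mul, map_mul] at h
  rw [← sub_eq_iff_eq_add']
  exact h

theorem E_F_ne (i j : I) (hij : i ≠ j) : gen k D ρ (.E i) * gen k D ρ (.F j) =
    gen k D ρ (.F j) * gen k D ρ (.E i) := by
  have h := RingQuot.mkAlgHom_rel k (EnvRel.EF_ne (k := k) (D := D) i j hij)
  rw [map_sub, map_mul, map_mul, map_zero] at h
  exact sub_eq_zero.1 h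

variable (k)

/-- The triangular monomial `F_{a_1} F_{a_2} ⋯ H_{b_1} H_{b_2} ⋯ E_{c_1} E_{c_2} ⋯`, the image of
`v_{a_1} v_{a_2} ⋯ ⊗ H_{b_1} H_{b_2} ⋯ ⊗ v_{c_1} v_{c_2} ⋯`. -/
def triMon (t : List I × List I × List I) : Env k D ρ :=
  (t.1.map fun i => gen k D ρ (.F i)).prod *
    ((t.2.1.map fun i => gen k D ρ (.H i)).prod * (t.2.2.map fun i => gen k D ρ (.E i)).prod)

/-- The norm `r^|a| s^|c|` of `v_{a_1} v_{a_2} ⋯ ⊗ H_{b_1} H_{b_2} ⋯ ⊗ v_{c_1} v_{c_2} ⋯` in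
`T_r(V) ⊗ H ⊗ T_s(V)`. -/
def triWeight (t : List I × List I × List I) : ℝ := ρ.r ^ t.1.length * ρ.s ^ t.2.2.length

/-- Elements of `U(g)` that are the image of an element of norm at most `C`. -/
def triBall (C : ℝ) : Set (Env k D ρ) :=
  {x | ∃ c : (List I × List I × List I) →₀ k, (∀ t, ‖c t‖ * triWeight ρ t ≤ C) ∧
    Finsupp.linearCombination k (triMon k D ρ) c = x}

/-- The quotient norm on `U(g)` of the norm of `T_r(V) ⊗ H ⊗ T_s(V)`, along
`T_r(V) ⊗ H ⊗ T_s(V) → U⁻ ⊗ U⁰ ⊗ U⁺ = U(g)`. -/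
noncomputable instance : Norm (Env k D ρ) := ⟨fun x => sInf {C | x ∈ triBall k D ρ C}⟩

variable {k}

theorem triWeight_pos (t : List I × List I × List I) : 0 < triWeight ρ t :=
  mul_pos (pow_pos ρ.r_pos _) (pow_pos ρ.s_pos _)

theorem triBall_nonneg {C : ℝ} {x : Env k D ρ} (h : x ∈ triBall k D ρ C) : 0 ≤ C := by
  obtain ⟨c, hc, -⟩ := h
  exact (mul_nonneg (norm_nonneg _) (triWeight_pos ρ ([], [], [])).le).trans (hc ([], [], []))

theorem triBall_mono {C C' : ℝ} (hC : C ≤ C') {x : Env k D ρ} (h : x ∈ triBall k D ρ C) :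
    x ∈ triBall k D ρ C' := by
  obtain ⟨c, hc, rfl⟩ := h
  exact ⟨c, fun t => (hc t).trans hC, rfl⟩

theorem triBall_zero {C : ℝ} (hC : 0 ≤ C) : (0 : Env k D ρ) ∈ triBall k D ρ C :=
  ⟨0, fun t => by simpa using hC, map_zero _⟩

theorem triBall_smul {C : ℝ} (a : k) {x : Env k D ρ} (h : x ∈ triBall k D ρ C) :
    a • x ∈ triBall k D ρ (‖a‖ * C) := by
  obtain ⟨c, hc, rfl⟩ := h
  refine ⟨a • c, fun t => ?_, map_smul _ _ _⟩
  rw [Finsupp.smul_apply, smul_eq_mul, norm_mul, mul_assoc]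
  exact mul_le_mul_of_nonneg_left (hc t) (norm_nonneg a)

theorem triBall_mon (t : List I × List I × List I) :
    triMon k D ρ t ∈ triBall k D ρ (triWeight ρ t) := by
  classical
  refine ⟨Finsupp.single t 1, fun t' => ?_, by simp⟩
  by_cases h : t = t'
  · subst h; simp
  · rw [Finsupp.single_apply, if_neg h, norm_zero, zero_mul]; exact (triWeight_pos ρ t).le

theorem env_norm_nonneg (x : Env k D ρ) : 0 ≤ ‖x‖ :=
  Real.sInf_nonneg fun _ h => triBall_nonneg D ρ h

theorem norm_le_of_mem {C : ℝ} {x : Env k D ρ} (h : x ∈ triBall k D ρ C) : ‖x‖ ≤ C :=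
  csInf_le ⟨0, fun _ h => triBall_nonneg D ρ h⟩ h

theorem env_norm_zero : ‖(0 : Env k D ρ)‖ = 0 :=
  le_antisymm (norm_le_of_mem D ρ (triBall_zero D ρ le_rfl)) (env_norm_nonneg D ρ 0)

variable [IsUltrametricDist k]

theorem triBall_add {C : ℝ} {x y : Env k D ρ} (hx : x ∈ triBall k D ρ C)
    (hy : y ∈ triBall k D ρ C) : x + y ∈ triBall k D ρ C := by
  obtain ⟨c, hc, rfl⟩ := hx
  obtain ⟨d, hd, rfl⟩ := hy
  refine ⟨c + d, fun t => ?_, map_add _ _ _⟩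
  rw [Finsupp.add_apply]
  refine (mul_le_mul_of_nonneg_right (IsUltrametricDist.norm_add_le_max _ _)
    (triWeight_pos ρ t).le).trans ?_
  rw [max_mul_of_nonneg _ _ (triWeight_pos ρ t).le]
  exact max_le (hc t) (hd t)

theorem triBall_linear {K : ℝ} (hK : 0 ≤ K) (L : Env k D ρ →ₗ[k] Env k D ρ)
    (hL : ∀ t, L (triMon k D ρ t) ∈ triBall k D ρ (K * triWeight ρ t)) {C : ℝ} {x : Env k D ρ}
    (hx : x ∈ triBall k D ρ C) : L x ∈ triBall k D ρ (K * C) := by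
  have hC := triBall_nonneg D ρ hx
  obtain ⟨c, hc, rfl⟩ := hx
  rw [Finsupp.linearCombination_apply, Finsupp.sum, map_sum]
  refine Finset.sum_induction _ (· ∈ triBall k D ρ (K * C)) (fun _ _ => triBall_add D ρ)
    (triBall_zero D ρ (mul_nonneg hK hC)) fun t _ => ?_
  rw [map_smul]
  refine triBall_mono D ρ ?_ (triBall_smul D ρ (c t) (hL t))
  calc ‖c t‖ * (K * triWeight ρ t) = K * (‖c t‖ * triWeight ρ t) := by ring
    _ ≤ K * C := mul_le_mul_of_nonneg_left (hc t) hK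

theorem F_mul_mem (i : I) {C : ℝ} {x : Env k D ρ} (hx : x ∈ triBall k D ρ C) :
    gen k D ρ (.F i) * x ∈ triBall k D ρ (ρ.r * C) := by
  refine triBall_linear D ρ ρ.r_pos.le (LinearMap.mulLeft k (gen k D ρ (.F i))) (fun t => ?_) hx
  have h := triBall_mon (k := k) D ρ (i :: t.1, t.2)
  have h1 : triMon k D ρ (i :: t.1, t.2) = gen k D ρ (.F i) * triMon k D ρ t := by
    simp only [triMon, List.map_cons, List.prod_cons, mul_assoc]
  have h2 : triWeight ρ (i :: t.1, t.2) = ρ.r * triWeight ρ t := by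
    simp only [triWeight, List.length_cons, pow_succ]; ring
  rwa [h1, h2] at h

theorem norm_form_le (i j : I) : ‖(D.form (D.root i) (D.root j) : k)‖ ≤ 1 := by
  obtain ⟨n, hn, hn'⟩ := D.form_self i
  have h := D.coroot_eq i (D.root j)
  have hn0 : (n : ℚ) ≠ 0 := by exact_mod_cast hn.ne'
  have h1 : D.form (D.root i) (D.root j) = ((n * D.coroot i (D.root j) : ℤ) : ℚ) := by
    push_cast
    rw [h, hn']
    field_simp
  rw [h1, Rat.cast_intCast]
  exact IsUltrametricDist.norm_intCast_le_one k _

theorem H_mul_mon (i : I) (t : List I × List I × List I) :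
    gen k D ρ (.H i) * triMon k D ρ t ∈ triBall k D ρ (triWeight ρ t) := by
  obtain ⟨a, b, c⟩ := t
  induction a with
  | nil =>
    have h := triBall_mon (k := k) D ρ ([], i :: b, c)
    simpa only [triMon, triWeight, List.map_cons, List.prod_cons, List.map_nil, List.prod_nil,
      one_mul, mul_assoc] using h
  | cons j a ih =>
    have h0 : triMon k D ρ (j :: a, b, c) = gen k D ρ (.F j) * triMon k D ρ (a, b, c) := by
      simp only [triMon, List.map_cons, List.prod_cons, mul_assoc]
    have h1 : gen k D ρ (.H i) * triMon k D ρ (j :: a, b, c) =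
        gen k D ρ (.F j) * (gen k D ρ (.H i) * triMon k D ρ (a, b, c)) +
        (-(D.form (D.root i) (D.root j) : k)) • triMon k D ρ (j :: a, b, c) := by
      rw [h0, ← mul_assoc, H_F, add_mul, smul_mul_assoc, mul_assoc]
    have h2 : triWeight ρ (j :: a, b, c) = ρ.r * triWeight ρ (a, b, c) := by
      simp only [triWeight, List.length_cons, pow_succ]; ring
    rw [h1]
    refine triBall_add D ρ (h2 ▸ F_mul_mem D ρ j ih) ?_
    refine triBall_mono D ρ ?_ (triBall_smul D ρ _ (triBall_mon (k := k) D ρ (j :: a, b, c)))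
    rw [norm_neg]
    exact mul_le_of_le_one_left (triWeight_pos ρ _).le (norm_form_le D i j)

theorem H_mul_mem (i : I) {C : ℝ} {x : Env k D ρ} (hx : x ∈ triBall k D ρ C) :
    gen k D ρ (.H i) * x ∈ triBall k D ρ C := by
  have := triBall_linear D ρ zero_le_one (LinearMap.mulLeft k (gen k D ρ (.H i)))
    (fun t => by rw [one_mul]; exact H_mul_mon D ρ i t) hx
  rwa [one_mul] at this

theorem E_mul_mon (i : I) (t : List I × List I × List I) :
    gen k D ρ (.E i) * triMon k D ρ t ∈ triBall k D ρ (ρ.s * triWeight ρ t) := by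
  obtain ⟨a, b, c⟩ := t
  induction a with
  | nil =>
    induction b with
    | nil =>
      have h := triBall_mon (k := k) D ρ ([], [], i :: c)
      have h2 : triWeight ρ ([], [], i :: c) = ρ.s * triWeight ρ ([], [], c) := by
        simp only [triWeight, List.length_cons, List.length_nil, pow_succ]; ring
      rw [h2] at h
      simpa only [triMon, List.map_cons, List.prod_cons, List.map_nil, List.prod_nil,
        one_mul, mul_assoc] using h
    | cons j b ih =>
      have h0 : triMon k D ρ ([], j :: b, c) = gen k D ρ (.H j) * triMon k D ρ ([], b, c) := by
        simp only [triMon, List.map_cons, List.prod_cons, List.map_nil, List.prod_nil, one_mul,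
          mul_assoc]
      have h1 : gen k D ρ (.E i) * triMon k D ρ ([], j :: b, c) =
          gen k D ρ (.H j) * (gen k D ρ (.E i) * triMon k D ρ ([], b, c)) +
          (-(D.form (D.root j) (D.root i) : k)) •
            (gen k D ρ (.E i) * triMon k D ρ ([], b, c)) := by
        rw [h0, ← mul_assoc, ← mul_assoc, H_E, add_mul, smul_mul_assoc, neg_smul]
        abel
      rw [h1]
      refine triBall_add D ρ (H_mul_mem D ρ j ih) ?_
      refine triBall_mono D ρ ?_ (triBall_smul D ρ _ ih)
      rw [norm_neg]
      exact mul_le_of_le_one_left (triBall_nonneg D ρ ih) (norm_form_le D j i)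
  | cons j a ih =>
    have h0 : triMon k D ρ (j :: a, b, c) = gen k D ρ (.F j) * triMon k D ρ (a, b, c) := by
      simp only [triMon, List.map_cons, List.prod_cons, mul_assoc]
    have h2 : ρ.s * triWeight ρ (j :: a, b, c) = ρ.r * (ρ.s * triWeight ρ (a, b, c)) := by
      simp only [triWeight, List.length_cons, pow_succ]; ring
    have h3 := F_mul_mem D ρ j ih
    rw [h2, h0, ← mul_assoc (gen k D ρ (.E i))]
    by_cases hij : i = j
    · subst hij
      rw [E_F, add_mul, mul_assoc]
      refine triBall_add D ρ h3 (triBall_mono D ρ ?_ (H_mul_mon D ρ i (a, b, c)))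
      rw [← mul_assoc ρ.r]
      exact le_mul_of_one_le_left (triWeight_pos ρ _).le ρ.one_le
    · rwa [E_F_ne D ρ i j hij, mul_assoc]

theorem E_mul_mem (i : I) {C : ℝ} {x : Env k D ρ} (hx : x ∈ triBall k D ρ C) :
    gen k D ρ (.E i) * x ∈ triBall k D ρ (ρ.s * C) :=
  triBall_linear D ρ ρ.s_pos.le (LinearMap.mulLeft k (gen k D ρ (.E i))) (E_mul_mon D ρ i) hx

theorem triBall_mul {C C' : ℝ} {x y : Env k D ρ} (hx : x ∈ triBall k D ρ C)
    (hy : y ∈ triBall k D ρ C') : x * y ∈ triBall k D ρ (C * C') := by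
  have hC := triBall_nonneg D ρ hx
  have hC' := triBall_nonneg D ρ hy
  have key : ∀ t, triMon k D ρ t * y ∈ triBall k D ρ (triWeight ρ t * C') := by
    rintro ⟨a, b, c⟩
    induction a with
    | nil =>
      induction b with
      | nil =>
        induction c with
        | nil => simpa [triMon, triWeight] using hy
        | cons i c ih =>
          have h1 : triMon k D ρ ([], [], i :: c) * y =
              gen k D ρ (.E i) * (triMon k D ρ ([], [], c) * y) := by
            simp only [triMon, List.map_cons, List.prod_cons, List.map_nil, List.prod_nil,
              one_mul, mul_assoc]
          have h2 : triWeight ρ ([], [], i :: c) * C' =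
              ρ.s * (triWeight ρ ([], [], c) * C') := by
            simp only [triWeight, List.length_cons, List.length_nil, pow_succ]; ring
          rw [h1, h2]
          exact E_mul_mem D ρ i ih
      | cons i b ih =>
        have h1 : triMon k D ρ ([], i :: b, c) * y =
            gen k D ρ (.H i) * (triMon k D ρ ([], b, c) * y) := by
          simp only [triMon, List.map_cons, List.prod_cons, List.map_nil, List.prod_nil,
            one_mul, mul_assoc]
        rw [h1]
        exact H_mul_mem D ρ i ih
    | cons i a ih =>
      have h1 : triMon k D ρ (i :: a, b, c) * y =
          gen k D ρ (.F i) * (triMon k D ρ (a, b, c) * y) := by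
        simp only [triMon, List.map_cons, List.prod_cons, mul_assoc]
      have h2 : triWeight ρ (i :: a, b, c) * C' = ρ.r * (triWeight ρ (a, b, c) * C') := by
        simp only [triWeight, List.length_cons, pow_succ]; ring
      rw [h1, h2]
      exact F_mul_mem D ρ i ih
  obtain ⟨c, hc, rfl⟩ := hx
  rw [Finsupp.linearCombination_apply, Finsupp.sum, Finset.sum_mul]
  refine Finset.sum_induction _ (· ∈ triBall k D ρ (C * C')) (fun _ _ => triBall_add D ρ)
    (triBall_zero D ρ (mul_nonneg hC hC')) fun t _ => ?_
  rw [smul_mul_assoc]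
  refine triBall_mono D ρ ?_ (triBall_smul D ρ (c t) (key t))
  rw [← mul_assoc]
  exact mul_le_mul_of_nonneg_right (hc t) hC'

theorem exists_mem_triBall (x : Env k D ρ) : ∃ C, x ∈ triBall k D ρ C := by
  let π : FreeAlgebra k (ChevalleyGen I) →ₐ[k] Env k D ρ := RingQuot.mkAlgHom k (EnvRel k D)
  obtain ⟨x, rfl⟩ : ∃ y, π y = x := RingQuot.mkAlgHom_surjective k (EnvRel k D) x
  induction x using FreeAlgebra.induction with
  | grade0 a =>
    have h := triBall_smul D ρ a (triBall_mon (k := k) D ρ ([], [], []))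
    have h1 : triMon k D ρ ([], [], []) = 1 := by simp [triMon]
    rw [h1] at h
    rw [AlgHom.commutes, Algebra.algebraMap_eq_smul_one]
    exact ⟨_, h⟩
  | grade1 x =>
    change ∃ C, gen k D ρ x ∈ triBall k D ρ C
    cases x with
    | F i =>
      have h := triBall_mon (k := k) D ρ ([i], [], [])
      have h1 : triMon k D ρ ([i], [], []) = gen k D ρ (.F i) := by simp [triMon]
      exact ⟨_, h1 ▸ h⟩
    | H i =>
      have h := triBall_mon (k := k) D ρ ([], [i], [])
      have h1 : triMon k D ρ ([], [i], []) = gen k D ρ (.H i) := by simp [triMon]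
      exact ⟨_, h1 ▸ h⟩
    | E i =>
      have h := triBall_mon (k := k) D ρ ([], [], [i])
      have h1 : triMon k D ρ ([], [], [i]) = gen k D ρ (.E i) := by simp [triMon]
      exact ⟨_, h1 ▸ h⟩
  | mul x y hx hy =>
    obtain ⟨C, hC⟩ := hx
    obtain ⟨C', hC'⟩ := hy
    exact ⟨C * C', by rw [map_mul]; exact triBall_mul D ρ hC hC'⟩
  | add x y hx hy =>
    obtain ⟨C, hC⟩ := hx
    obtain ⟨C', hC'⟩ := hy
    exact ⟨max C C', by
      rw [map_add]
      exact triBall_add D ρ (triBall_mono D ρ (le_max_left _ _) hC)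
        (triBall_mono D ρ (le_max_right _ _) hC')⟩

theorem mem_of_norm_lt {C : ℝ} {x : Env k D ρ} (h : ‖x‖ < C) : x ∈ triBall k D ρ C := by
  obtain ⟨C', hC', hlt⟩ := exists_lt_of_csInf_lt (exists_mem_triBall D ρ x) h
  exact triBall_mono D ρ hlt.le hC'

theorem env_norm_add_le_max (x y : Env k D ρ) : ‖x + y‖ ≤ max ‖x‖ ‖y‖ :=
  le_of_forall_gt_imp_ge_of_dense fun _ hC => norm_le_of_mem D ρ (triBall_add D ρ
    (mem_of_norm_lt D ρ ((le_max_left _ _).trans_lt hC))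
    (mem_of_norm_lt D ρ ((le_max_right _ _).trans_lt hC)))

theorem env_norm_smul_le (a : k) (x : Env k D ρ) : ‖a • x‖ ≤ ‖a‖ * ‖x‖ := by
  refine le_of_forall_pos_le_add fun ε hε => ?_
  have h := norm_le_of_mem D ρ (triBall_smul D ρ a
    (mem_of_norm_lt D ρ (lt_add_of_pos_right ‖x‖ (div_pos hε (b := ‖a‖ + 1) (by positivity)))))
  refine h.trans ?_
  rw [mul_add]
  gcongr
  rw [mul_div_assoc', div_le_iff₀ (by positivity)]
  nlinarith [norm_nonneg a]

theorem env_norm_mul_le (x y : Env k D ρ) : ‖x * y‖ ≤ ‖x‖ * ‖y‖ := by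
  have h1 : ∀ C, ‖x‖ < C → ∀ C', ‖y‖ < C' → ‖x * y‖ ≤ C * C' := fun C hC C' hC' =>
    norm_le_of_mem D ρ (triBall_mul D ρ (mem_of_norm_lt D ρ hC) (mem_of_norm_lt D ρ hC'))
  have hx := env_norm_nonneg D ρ x
  have hy := env_norm_nonneg D ρ y
  refine le_of_forall_pos_le_add fun ε hε => ?_
  obtain ⟨δ, hδ, hδ1⟩ : ∃ δ > 0, (‖x‖ + δ) * (‖y‖ + δ) < ‖x‖ * ‖y‖ + ε := by
    have hc : Filter.Tendsto (fun δ : ℝ => (‖x‖ + δ) * (‖y‖ + δ)) (nhds 0) (nhds (‖x‖ * ‖y‖)) := by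
      have : Continuous fun δ : ℝ => (‖x‖ + δ) * (‖y‖ + δ) := by fun_prop
      simpa using this.tendsto 0
    have h2 := hc.eventually (gt_mem_nhds (lt_add_of_pos_right (‖x‖ * ‖y‖) hε))
    obtain ⟨δ, hδ, hδ0⟩ := ((h2.filter_mono (nhdsWithin_le_nhds (s := Set.Ioi 0))).and
      self_mem_nhdsWithin).exists
    exact ⟨δ, hδ0, hδ⟩
  exact (h1 _ (lt_add_of_pos_right _ hδ) _ (lt_add_of_pos_right _ hδ)).trans hδ1.le

theorem env_norm_neg_le (x : Env k D ρ) : ‖-x‖ ≤ ‖x‖ := by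
  have h := env_norm_smul_le D ρ (-1) x
  rwa [norm_neg, norm_one, one_mul, neg_one_smul] at h

/-- `U(g)` as a seminormed ring. -/
noncomputable instance : SeminormedRing (Env k D ρ) where
  __ := (inferInstance : Ring (Env k D ρ))
  __ := (inferInstance : Norm (Env k D ρ))
  __ := AddGroupSeminorm.toSeminormedAddCommGroup (E := Env k D ρ)
    { toFun := fun x => ‖x‖
      map_zero' := env_norm_zero D ρ
      add_le' := fun x y => (env_norm_add_le_max D ρ x y).trans
        (max_le_add_of_nonneg (env_norm_nonneg D ρ x) (env_norm_nonneg D ρ y))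
      neg' := fun x => le_antisymm (env_norm_neg_le D ρ x) (by
        simpa using env_norm_neg_le D ρ (-x)) }
  norm_mul_le := env_norm_mul_le D ρ

noncomputable instance : NormedAlgebra k (Env k D ρ) where
  norm_smul_le := env_norm_smul_le D ρ

instance : IsUltrametricDist (Env k D ρ) :=
  IsUltrametricDist.isUltrametricDist_of_forall_norm_add_le_max_norm (env_norm_add_le_max D ρ)

end Env

variable [IsUltrametricDist k]

/-- The Banach algebra `U(g)_{r,s}^an`, the completion of `U(g)`. -/
def CompletedEnv : Type (max u v) := UniformSpace.Completion (Env k D ρ)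

noncomputable instance : NormedRing (CompletedEnv k D ρ) :=
  inferInstanceAs (NormedRing (UniformSpace.Completion (Env k D ρ)))

instance : CompleteSpace (CompletedEnv k D ρ) :=
  inferInstanceAs (CompleteSpace (UniformSpace.Completion (Env k D ρ)))

noncomputable instance : NormedAlgebra k (CompletedEnv k D ρ) where
  __ := (UniformSpace.Completion.algebra (Env k D ρ) k :
    Algebra k (UniformSpace.Completion (Env k D ρ)))
  norm_smul_le a x := norm_smul_le a (show UniformSpace.Completion (Env k D ρ) from x)

instance : IsUltrametricDist (CompletedEnv k D ρ) := by
  refine IsUltrametricDist.isUltrametricDist_of_forall_norm_add_le_max_norm ?_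
  change ∀ x y : UniformSpace.Completion (Env k D ρ), ‖x + y‖ ≤ max ‖x‖ ‖y‖
  intro x y
  induction x, y using UniformSpace.Completion.induction_on₂ with
  | hp =>
    exact isClosed_le (continuous_norm.comp (continuous_fst.add continuous_snd))
      ((continuous_norm.comp continuous_fst).max (continuous_norm.comp continuous_snd))
  | ih x y =>
    rw [← UniformSpace.Completion.coe_add, UniformSpace.Completion.norm_coe,
      UniformSpace.Completion.norm_coe, UniformSpace.Completion.norm_coe]
    exact IsUltrametricDist.norm_add_le_max x y

/-- The generators of `U(g)_{r,s}^an`. -/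
noncomputable def CompletedEnv.gen (x : ChevalleyGen I) : CompletedEnv k D ρ :=
  ((Env.gen k D ρ x : Env k D ρ) : UniformSpace.Completion (Env k D ρ))

/-- The commutator bracket `[x, y] = x y - y x`. -/
noncomputable instance : LieRing (CompletedEnv k D ρ) := LieRing.ofAssociativeRing

noncomputable instance : LieAlgebra k (CompletedEnv k D ρ) := LieAlgebra.ofAssociativeAlgebra

/-- The Banach Lie algebra `g_{r,s}`: the closed Lie subalgebra of `U(g)_{r,s}^an` generated by
all `F_i`, `H_i` and `E_i`.  It acts on `U(g)_{r,s}^an` by `x · m = x m - m x`. -/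
noncomputable def gLie : LieSubalgebra k (CompletedEnv k D ρ) :=
  sInf {L | IsClosed (L : Set (CompletedEnv k D ρ)) ∧
    ∀ x : ChevalleyGen I, CompletedEnv.gen k D ρ x ∈ L}

/-- The induced norm on `g_{r,s}`. -/
noncomputable instance : Norm (gLie k D ρ) := ⟨fun x => ‖(x : CompletedEnv k D ρ)‖⟩

theorem gLie_lie_apply (x : gLie k D ρ) (m : CompletedEnv k D ρ) :
    ⁅x, m⁆ = (x : CompletedEnv k D ρ) * m - m * x := rfl

end Enveloping

end AnalyticRigidity

open AnalyticRigidity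

namespace AnalyticRigidity

open CategoryTheory
open scoped ENNReal

universe u v w v₁ w₁ v₂ w₂ v₃ w₃ w₄

/-! ### Equality of generalised elements of IndBanach spaces -/

section EvEq

variable {k : Type u} [NormedField k] {X : IndBan.{u, v₁, w₁} k} {Y : IndBan.{u, v₂, w₂} k}
  {Z : IndBan.{u, v₃, w₃} k} {T : Type*}

/-! Write `V` for the completed enveloping algebra. The weights in `V⟦ħ⟧` are arbitrary positive
sequences and the transition maps are inclusions. Hence every formal power series over `V` occurs in
some stage, and two elements of stages agree in the formal colimit iff their power series agree.
Transporting the multiplication of `A` along `φ` therefore gives an honest `ħ`-bilinear associative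
product on power series, a `StarProduct`, of which only the boundedness of each coefficient has to
be remembered (`exists_starProduct`). Its order-zero term is the product of `V`, because `θ` is
multiplicative.

The star product is trivialized through the Lie algebra rather than through Hochschild cohomology.
The inclusion of `gLie` in `V` is lifted, one power of `ħ` at a time, to a Lie homomorphism `L` into
`V⟦ħ⟧` with the star commutator. If the failure of the homomorphism property vanishes below order
`n`, then its `n`-th coefficient is a bounded 2-cocycle with values in `V`, by a Bianchi identity
(`lieDefect_jacobi`). A bounded primitive `h` exists since `H²_b = 0`, and subtracting `ħ^n h`
removes order `n` (`IsBddLift.exists_correction`, `exists_lie_lift`).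

All defining relations of `U(g)` are statements about brackets, the Serre relations being iterated
commutators (`serre_eq_iterate`). So `L` extends to an algebra homomorphism `Ψ` from `U(g)` to the
star algebra (`Env.exists_algHom`). The analytic point is that each coefficient of `Ψ` is bounded,
although `Ψ` is only controlled on generators and monomials are arbitrarily long. Weights decaying
fast enough make the balls of power series multiplicative with constant exactly 1 and put the image
of every generator in the ball of its own weight (`exists_isAdapted`, `StarProduct.seriesBall_mul`).
Then `Ψ` is contracting for the triangular norm (`StarProduct.algHom_mem_seriesBall`).

Consequently the coefficients of `Ψ` extend to bounded operators `T n` on `V` with `T 0 = id`, and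
`∑ T n ħ^n` carries the Cauchy product to the star product (`StarProduct.exists_trivialization`).
This series is invertible over the ring of bounded operators, and `ψ` is `φ` followed by its
inverse. -/

theorem IndBan.EvEq.symm {i j : X.ι} {f : T → X.sp i} {g : T → X.sp j} (h : X.EvEq f g) :
    X.EvEq g f := by
  obtain ⟨l, a, b, h⟩ := h
  exact ⟨l, b, a, fun t => (h t).symm⟩

theorem IndBan.EvEq.trans {i j l : X.ι} {f : T → X.sp i} {g : T → X.sp j} {h : T → X.sp l}
    (h₁ : X.EvEq f g) (h₂ : X.EvEq g h) : X.EvEq f h := by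
  obtain ⟨m, a, b, h₁⟩ := h₁
  obtain ⟨n, c, d, h₂⟩ := h₂
  obtain ⟨p, e, e', he⟩ := IsFiltered.span b c
  refine ⟨p, a ≫ e, d ≫ e', fun t => ?_⟩
  rw [X.tr_comp, X.tr_comp, h₁, ← h₂, ← X.tr_comp, ← X.tr_comp, he]

theorem IndBan.EvEq.precomp {S : Type*} {i j : X.ι} {f : T → X.sp i} {g : T → X.sp j}
    (h : X.EvEq f g) (p : S → T) : X.EvEq (fun s => f (p s)) (fun s => g (p s)) := by
  obtain ⟨l, a, b, h⟩ := h
  exact ⟨l, a, b, fun s => h (p s)⟩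

theorem IndBan.EvEq.map (h : IndBan.Hom X Y) {i j : X.ι} {f : T → X.sp i} {g : T → X.sp j}
    (hfg : X.EvEq f g) : Y.EvEq (fun t => (h.map i).lin (f t)) (fun t => (h.map j).lin (g t)) := by
  obtain ⟨l, a, b, e⟩ := hfg
  have h₁ := (h.compat a).precomp f
  have h₂ := (h.compat b).precomp g
  simp only [e] at h₁
  exact h₁.trans h₂.symm

theorem IndBan.EvEq.map₂ (h : IndBan.Bihom X Y Z) {i j : X.ι} {f : T → X.sp i} {g : T → X.sp j}
    (hfg : X.EvEq f g) {i' j' : Y.ι} {f' : T → Y.sp i'} {g' : T → Y.sp j'} (hfg' : Y.EvEq f' g') :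
    Z.EvEq (fun t => (h.map i i').lin (f t) (f' t)) (fun t => (h.map j j').lin (g t) (g' t)) := by
  obtain ⟨l, a, b, e⟩ := hfg
  obtain ⟨l', a', b', e'⟩ := hfg'
  have h₁ := (h.compat a a').precomp fun t => (f t, f' t)
  have h₂ := (h.compat b b').precomp fun t => (g t, g' t)
  simp only [e, e'] at h₁
  exact h₁.trans h₂.symm

theorem IndBan.EvEq.const_eq {V : Type w} [NormedAddCommGroup V]
    [NormedSpace k V] [CompleteSpace V] [IsUltrametricDist V] {i j : PUnit} {f g : T → V}
    (h : (IndBan.const k V).EvEq (i := i) (j := j) f g) (t : T) : f t = g t := by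
  obtain ⟨_, _, _, h⟩ := h
  exact h t

theorem IndBan.EvEq.of_const_eq {V : Type w} [NormedAddCommGroup V]
    [NormedSpace k V] [CompleteSpace V] [IsUltrametricDist V] {i j : PUnit} {f g : T → V}
    (h : ∀ t, f t = g t) : (IndBan.const k V).EvEq (i := i) (j := j) f g :=
  ⟨PUnit.unit, 𝟙 _, 𝟙 _, h⟩

end EvEq

/-! ### The power series of an element of a stage of `V⟦ħ⟧` -/

section Series

variable {k : Type u} [NormedField k] {V : Type w} [NormedRing V] [NormedAlgebra k V]

theorem WSeq.coeff_ps {r : Weights} (x : WSeq r V) (n : ℕ) :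
    PowerSeries.coeff n (WSeq.ps k V x) = WSeq.coeff k n x := PowerSeries.coeff_mk _ _

/-- The power series of a weighted sequence, as a linear map. -/
noncomputable def WSeq.psLin (k : Type u) [NormedField k] [NormedAlgebra k V] (r : Weights) :
    WSeq r V →ₗ[k] PowerSeries V where
  toFun := WSeq.ps k V
  map_add' x y := by ext n; simp [WSeq.coeff_ps]
  map_smul' c x := by ext n; simp [WSeq.coeff_ps]

/-- Weights for which the given two power series are bounded. -/
theorem WSeq.exists_ps_eq₂ (F G : PowerSeries V) :
    ∃ (r : Weights) (x y : WSeq r V), WSeq.ps k V x = F ∧ WSeq.ps k V y = G := by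
  -- Weights may decay at any rate, so the inverse size of the coefficients serves as weight; both
  -- series are treated at once so that they share a stage.
  let r : Weights := ⟨fun n => ⟨(1 + ‖PowerSeries.coeff n F‖ + ‖PowerSeries.coeff n G‖)⁻¹,
    by positivity⟩⟩
  have hF : ∀ n, (r n : ℝ) * ‖PowerSeries.coeff n F‖ ≤ 1 := fun n => by
    rw [inv_mul_le_iff₀ (by positivity)]
    linarith [norm_nonneg (PowerSeries.coeff n G)]
  have hG : ∀ n, (r n : ℝ) * ‖PowerSeries.coeff n G‖ ≤ 1 := fun n => by
    rw [inv_mul_le_iff₀ (by positivity)]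
    linarith [norm_nonneg (PowerSeries.coeff n F)]
  refine ⟨r, WSeq.mk r (fun n => PowerSeries.coeff n F) ⟨1, hF⟩,
    WSeq.mk r (fun n => PowerSeries.coeff n G) ⟨1, hG⟩, ?_, ?_⟩ <;>
  · ext n
    rw [WSeq.coeff_ps, WSeq.coeff_mk]

theorem WSeq.ps_hbar : WSeq.ps k V (WSeq.hbar V) = PowerSeries.X := by
  ext n
  rw [WSeq.coeff_ps, PowerSeries.coeff_X]
  rfl

/-- The constant sequence `v, 0, 0, …`. -/
noncomputable def WSeq.const (k : Type u) [NormedField k] [NormedAlgebra k V] :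
    BddLin k V (WSeq ⟨fun _ => ⟨1, one_pos⟩⟩ V) where
  lin :=
    { toFun := fun v => WSeq.mk _ (fun n => if n = 0 then v else 0)
        ⟨‖v‖, fun n => by split <;> simp⟩
      map_add' := fun v w => WSeq.ext (k := k) fun n => by
        rw [map_add]; simp only [WSeq.coeff_mk]; split <;> simp
      map_smul' := fun c v => WSeq.ext (k := k) fun n => by
        rw [map_smul]; simp only [WSeq.coeff_mk]; split <;> simp }
  bdd := ⟨1, fun v => WSeq.norm_le (k := k) (by positivity) fun n => by
    simp only [LinearMap.coe_mk, AddHom.coe_mk, WSeq.coeff_mk]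
    split <;> simp⟩

theorem WSeq.ps_const (v : V) : WSeq.ps k V ((WSeq.const k).lin v) = PowerSeries.C v := by
  ext n
  rw [WSeq.coeff_ps, PowerSeries.coeff_C]
  rfl

variable [CompleteSpace V] [IsUltrametricDist V]

/-- The transition maps are inclusions and keep all coefficients. Together with
`pSeries.evEq_of_ps`, this replaces equality in the formal colimit by equality of power series. -/
theorem pSeries.ps_eq_of_evEq {T : Type*} {r r' : Weights} {f : T → WSeq r V} {g : T → WSeq r' V}
    (h : (pSeries k V).EvEq (i := r) (j := r') f g) (t : T) :
    WSeq.ps k V (f t) = WSeq.ps k V (g t) := by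
  obtain ⟨l, a, b, h⟩ := h
  ext n
  have := congrArg (WSeq.coeff k (r := l) n) (h t)
  rw [WSeq.coeff_ps, WSeq.coeff_ps]
  exact this

theorem pSeries.evEq_of_ps {T : Type*} {r r' : Weights} {f : T → WSeq r V} {g : T → WSeq r' V}
    (h : ∀ t, WSeq.ps k V (f t) = WSeq.ps k V (g t)) :
    (pSeries k V).EvEq (i := r) (j := r') f g :=
  pSeries.evEq fun t n => WSeq.ext_ps k (h t) n

/-- The power series of the values of a morphism to `V⟦ħ⟧`. -/
noncomputable def IndBan.Hom.series {X : IndBan.{u, v₁, w₁} k} (f : IndBan.Hom X (pSeries k V))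
    (i : X.ι) : X.sp i →ₗ[k] PowerSeries V :=
  WSeq.psLin k (f.idx i) ∘ₗ (f.map i).lin

theorem IndBan.Hom.series_eq_of_evEq {X : IndBan.{u, v₁, w₁} k}
    (f : IndBan.Hom X (pSeries k V)) {T : Type*} {i j : X.ι} {a : T → X.sp i} {b : T → X.sp j}
    (h : X.EvEq a b) (t : T) : f.series i (a t) = f.series j (b t) :=
  pSeries.ps_eq_of_evEq (h.map f) t

/-- Apply `φ.inv` to the equality in `V⟦ħ⟧` and cancel it against `φ.hom`. So `series` is jointly
injective on the stages of `X`, up to identification in the colimit. -/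
theorem IndBan.Iso.evEq_of_series_eq {X : IndBan.{u, v₁, w₁} k} (φ : IndBan.Iso X (pSeries k V))
    {T : Type*} {i j : X.ι} {a : T → X.sp i} {b : T → X.sp j}
    (h : ∀ t, φ.hom.series i (a t) = φ.hom.series j (b t)) : X.EvEq a b :=
  ((φ.hom_inv i).precomp a).symm.trans <|
    ((pSeries.evEq_of_ps h).map φ.inv).trans ((φ.hom_inv j).precomp b)

theorem IndBan.Iso.series_inv {X : IndBan.{u, v₁, w₁} k} (φ : IndBan.Iso X (pSeries k V))
    (r : Weights) (x : WSeq r V) :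
    φ.hom.series (φ.inv.idx r) ((φ.inv.map r).lin x) = WSeq.ps k V x :=
  pSeries.ps_eq_of_evEq (φ.inv_hom r) x

/-- Surjectivity for pairs: a common stage is what allows sums to be formed when additivity of a
transported map is checked. -/
theorem IndBan.Iso.exists_series_eq₂ {X : IndBan.{u, v₁, w₁} k} (φ : IndBan.Iso X (pSeries k V))
    (F G : PowerSeries V) :
    ∃ (i : X.ι) (a b : X.sp i), φ.hom.series i a = F ∧ φ.hom.series i b = G := by
  obtain ⟨r, x, y, rfl, rfl⟩ := WSeq.exists_ps_eq₂ (k := k) F G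
  exact ⟨φ.inv.idx r, (φ.inv.map r).lin x, (φ.inv.map r).lin y, φ.series_inv r x, φ.series_inv r y⟩

theorem IndBan.Iso.exists_series_eq {X : IndBan.{u, v₁, w₁} k} (φ : IndBan.Iso X (pSeries k V))
    (F : PowerSeries V) : ∃ (i : X.ι) (a : X.sp i), φ.hom.series i a = F := by
  obtain ⟨i, a, -, h, -⟩ := φ.exists_series_eq₂ F F
  exact ⟨i, a, h⟩

theorem IndBan.Hom.exists_coeff_series {X : IndBan.{u, v₁, w₁} k}
    (f : IndBan.Hom X (pSeries k V)) (i : X.ι) (n : ℕ) :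
    ∃ g : BddLin k (X.sp i) V, ∀ x, g.lin x = PowerSeries.coeff n (f.series i x) :=
  ⟨BddLin.comp (F := WSeq (f.idx i) V) (WSeq.coeffBdd k V n _) (f.map i),
    fun _ => (WSeq.coeff_ps (k := k) (r := f.idx i) _ n).symm⟩

/-- Constant series all lie in the stage with weights 1. A single bounded map from `V` to one stage
of `X` thus covers all constants, which is what gives uniform bounds for the transported product. -/
theorem IndBan.Iso.exists_const_lift {X : IndBan.{u, v₁, w₁} k}
    (φ : IndBan.Iso X (pSeries k V)) : ∃ (i : X.ι) (f : BddLin k V (X.sp i)),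
      ∀ v, φ.hom.series i (f.lin v) = PowerSeries.C v :=
  ⟨_, BddLin.comp (φ.inv.map _) (WSeq.const k),
    fun _ => (φ.series_inv _ _).trans (WSeq.ps_const _)⟩

/-- A bilinear morphism on `X`, transported to power series along `φ`. -/
theorem IndBan.Iso.exists_transport_bihom {X : IndBan.{u, v₁, w₁} k}
    (φ : IndBan.Iso X (pSeries k V)) (μ : IndBan.Bihom X X X) :
    ∃ m : PowerSeries V →ₗ[k] PowerSeries V →ₗ[k] PowerSeries V, ∀ i j (a : X.sp i) (b : X.sp j),
      m (φ.hom.series i a) (φ.hom.series j b) = φ.hom.series _ ((μ.map i j).lin a b) := by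
  obtain ⟨m, hm⟩ : ∃ m : PowerSeries V → PowerSeries V → PowerSeries V,
      ∀ i j (a : X.sp i) (b : X.sp j),
        m (φ.hom.series i a) (φ.hom.series j b) = φ.hom.series _ ((μ.map i j).lin a b) := by
    -- The product of two series is computed on arbitrary representatives; by `evEq_of_series_eq`
    -- any other choice is identified with these in the colimit, so the result is independent of it.
    choose idx rep hrep using φ.exists_series_eq
    refine ⟨fun F G => φ.hom.series _ ((μ.map _ _).lin (rep F) (rep G)), fun i j a b => ?_⟩
    have h₁ := φ.evEq_of_series_eq (T := Unit) (a := fun _ => rep (φ.hom.series i a))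
      (b := fun _ => a) fun _ => hrep _
    have h₂ := φ.evEq_of_series_eq (T := Unit) (a := fun _ => rep (φ.hom.series j b))
      (b := fun _ => b) fun _ => hrep _
    exact φ.hom.series_eq_of_evEq (h₁.map₂ μ h₂) ()
  refine ⟨LinearMap.mk₂ k m ?_ ?_ ?_ ?_, fun i j a b => hm i j a b⟩
  · intro F F' G
    obtain ⟨i, a, a', rfl, rfl⟩ := φ.exists_series_eq₂ F F'
    obtain ⟨j, b, rfl⟩ := φ.exists_series_eq G
    rw [← map_add, hm, hm, hm, map_add, LinearMap.add_apply, map_add]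
  · intro c F G
    obtain ⟨i, a, rfl⟩ := φ.exists_series_eq F
    obtain ⟨j, b, rfl⟩ := φ.exists_series_eq G
    rw [← map_smul, hm, hm, map_smul, LinearMap.smul_apply, map_smul]
  · intro F G G'
    obtain ⟨i, a, rfl⟩ := φ.exists_series_eq F
    obtain ⟨j, b, b', rfl, rfl⟩ := φ.exists_series_eq₂ G G'
    rw [← map_add, hm, hm, hm, map_add, map_add]
  · intro c F G
    obtain ⟨i, a, rfl⟩ := φ.exists_series_eq F
    obtain ⟨j, b, rfl⟩ := φ.exists_series_eq G
    rw [← map_smul, hm, hm, map_smul, map_smul]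

end Series

/-! ### Star products -/

/-- A unital associative `k⟦ħ⟧`-bilinear multiplication on `V⟦ħ⟧`, with bounded coefficients, which
deforms the multiplication of `V`. -/
structure StarProduct (k : Type u) [NormedField k] (V : Type w) [NormedRing V]
    [NormedAlgebra k V] where
  mul : PowerSeries V →ₗ[k] PowerSeries V →ₗ[k] PowerSeries V
  X_mul : ∀ F G, mul (PowerSeries.X * F) G = PowerSeries.X * mul F G
  mul_X : ∀ F G, mul F (PowerSeries.X * G) = PowerSeries.X * mul F G
  assoc : ∀ F G H, mul (mul F G) H = mul F (mul G H)
  one_mul : ∀ F, mul 1 F = F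
  mul_one : ∀ F, mul F 1 = F
  coeff_zero : ∀ F G, PowerSeries.coeff 0 (mul F G) =
    PowerSeries.coeff 0 F * PowerSeries.coeff 0 G
  bdd : ∀ n, ∃ C : ℝ, ∀ v w, ‖PowerSeries.coeff n (mul (PowerSeries.C v) (PowerSeries.C w))‖ ≤
    C * ‖v‖ * ‖w‖

theorem BddBilin.exists_bound_comp {k : Type u} [NormedField k] {E : Type w₁} {F : Type w₂}
    {G : Type w₃} {W : Type w₄} [NormedAddCommGroup E] [NormedSpace k E] [NormedAddCommGroup F]
    [NormedSpace k F] [NormedAddCommGroup G] [NormedSpace k G] [NormedAddCommGroup W]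
    [NormedSpace k W] (m : BddBilin k F F G) (f : BddLin k E F) (g : BddLin k G W) :
    ∃ C : ℝ, ∀ v w, ‖g.lin (m.lin (f.lin v) (f.lin w))‖ ≤ C * ‖v‖ * ‖w‖ := by
  obtain ⟨C₁, h₁⟩ := f.bdd
  obtain ⟨C₂, h₂⟩ := m.bdd
  obtain ⟨C₃, h₃⟩ := g.bdd
  have h₁' : ∀ v, ‖f.lin v‖ ≤ |C₁| * ‖v‖ := fun v =>
    (h₁ v).trans (mul_le_mul_of_nonneg_right (le_abs_self _) (norm_nonneg _))
  refine ⟨|C₃| * (|C₂| * (|C₁| * |C₁|)), fun v w => (h₃ _).trans ?_⟩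
  calc C₃ * ‖m.lin (f.lin v) (f.lin w)‖
      ≤ |C₃| * (|C₂| * (|C₁| * ‖v‖) * (|C₁| * ‖w‖)) := by
        refine mul_le_mul (le_abs_self _) ((h₂ _ _).trans ?_) (norm_nonneg _) (abs_nonneg _)
        exact mul_le_mul (mul_le_mul (le_abs_self _) (h₁' v) (norm_nonneg _) (abs_nonneg _))
          (h₁' w) (norm_nonneg _) (by positivity)
    _ = |C₃| * (|C₂| * (|C₁| * |C₁|)) * ‖v‖ * ‖w‖ := by ring

/-! ### Transport of the multiplication of `A` to power series. -/

section Transport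

variable {k : Type u} [NormedField k] [CompleteSpace k] [IsUltrametricDist k]
  {V : Type w} [NormedRing V] [NormedAlgebra k V] [CompleteSpace V] [IsUltrametricDist V]
  {A : IndBanAlgOver.{u, v₁, w₁} (kPowerSeries k)}

theorem IndBanAlgOver.IsLinear.series_act {f : IndBan.Hom A.toIndBan (pSeries k V)}
    (hf : IndBanAlgOver.IsLinear (B := pSeriesAlgOver k V) f) (r : Weights) (i : A.ι)
    (x : WSeq r k) (a : A.sp i) :
    f.series _ ((A.act.map r i).lin x a) =
      PowerSeries.map (algebraMap k V) (WSeq.ps k k x) * f.series i a :=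
  (pSeries.ps_eq_of_evEq (hf r i) (x, a)).trans (WSeq.ps_smul k (r := r) x _)

theorem IndBanAlgOver.IsLinear.series_hbar {f : IndBan.Hom A.toIndBan (pSeries k V)}
    (hf : IndBanAlgOver.IsLinear (B := pSeriesAlgOver k V) f) (i : A.ι) (a : A.sp i) :
    f.series _ ((A.act.map ⟨fun _ => ⟨1, one_pos⟩⟩ i).lin (WSeq.hbar k) a) =
      PowerSeries.X * f.series i a := by
  rw [hf.series_act, WSeq.ps_hbar, PowerSeries.map_X]

/-- The multiplication of `A`, transported to power series along `φ`. -/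
theorem exists_starProduct (φ : IndBan.Iso A.toIndBan (pSeries k V))
    (hφ : IndBanAlgOver.IsLinear (B := pSeriesAlgOver k V) φ.hom)
    (hφ_one : φ.hom.series A.one.idx A.one.val = 1)
    (hφ_mul : ∀ i j (a : A.sp i) (b : A.sp j),
      PowerSeries.coeff 0 (φ.hom.series _ ((A.mul.map i j).lin a b)) =
        PowerSeries.coeff 0 (φ.hom.series i a) * PowerSeries.coeff 0 (φ.hom.series j b)) :
    ∃ M : StarProduct k V, ∀ i j (a : A.sp i) (b : A.sp j),
      φ.hom.series _ ((A.mul.map i j).lin a b) =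
        M.mul (φ.hom.series i a) (φ.hom.series j b) := by
  obtain ⟨m, hm⟩ := φ.exists_transport_bihom A.mul
  refine ⟨⟨m, fun F G => ?_, fun F G => ?_, fun F G H => ?_, fun F => ?_, fun F => ?_,
    fun F G => ?_, fun n => ?_⟩, fun i j a b => (hm i j a b).symm⟩
  · obtain ⟨i, a, rfl⟩ := φ.exists_series_eq F
    obtain ⟨j, b, rfl⟩ := φ.exists_series_eq G
    rw [← hφ.series_hbar, hm, hm, ← hφ.series_hbar]
    exact (φ.hom.series_eq_of_evEq (A.act_mul_left _ i j) (WSeq.hbar k, a, b)).symm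
  · obtain ⟨i, a, rfl⟩ := φ.exists_series_eq F
    obtain ⟨j, b, rfl⟩ := φ.exists_series_eq G
    rw [← hφ.series_hbar, hm, hm, ← hφ.series_hbar]
    exact (φ.hom.series_eq_of_evEq (A.act_mul_right _ i j) (WSeq.hbar k, a, b)).symm
  · obtain ⟨i, a, rfl⟩ := φ.exists_series_eq F
    obtain ⟨j, b, rfl⟩ := φ.exists_series_eq G
    obtain ⟨l, c, rfl⟩ := φ.exists_series_eq H
    rw [hm, hm, hm, hm]
    exact φ.hom.series_eq_of_evEq (A.mul_assoc i j l) (a, b, c)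
  · obtain ⟨i, a, rfl⟩ := φ.exists_series_eq F
    rw [← hφ_one, hm]
    exact φ.hom.series_eq_of_evEq (A.one_mul i) a
  · obtain ⟨i, a, rfl⟩ := φ.exists_series_eq F
    rw [← hφ_one, hm]
    exact φ.hom.series_eq_of_evEq (A.mul_one i) a
  · obtain ⟨i, a, rfl⟩ := φ.exists_series_eq F
    obtain ⟨j, b, rfl⟩ := φ.exists_series_eq G
    rw [hm, hφ_mul]
  -- On constants the product factors as a bounded map into one stage, the bounded multiplication of
  -- that stage, and a bounded coefficient map.
  · obtain ⟨i, f, hf⟩ := φ.exists_const_lift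
    obtain ⟨g, hg⟩ := φ.hom.exists_coeff_series (A.mul.idx i i) n
    obtain ⟨C, hC⟩ := BddBilin.exists_bound_comp (A.mul.map i i) f g
    refine ⟨C, fun v w => ?_⟩
    rw [← hf, ← hf, hm, ← hg]
    exact hC v w

end Transport

/-! ### `ħ`-linear maps of power series -/

section XLinear

variable {V : Type w₁} {W : Type w₂} [Ring V] [Ring W]

/-- Split off the constant term, `F = X * F' + C`, and induct on `n`. Order `n` of the image sees
only finitely many coefficients of `F`, so `ħ`-linearity alone determines the map from its values on
constants, without any continuity. -/
theorem coeff_apply_of_X_linear (L : PowerSeries V →+ PowerSeries W)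
    (hL : ∀ F, L (PowerSeries.X * F) = PowerSeries.X * L F) (n : ℕ) (F : PowerSeries V) :
    PowerSeries.coeff n (L F) = ∑ p ∈ Finset.HasAntidiagonal.antidiagonal n,
      PowerSeries.coeff p.2 (L (PowerSeries.C (PowerSeries.coeff p.1 F))) := by
  induction n generalizing F with
  | zero =>
    conv_lhs => rw [F.eq_X_mul_shift_add_const, map_add, hL]
    simp
  | succ n ih =>
    conv_lhs => rw [F.eq_X_mul_shift_add_const, map_add, hL, map_add, PowerSeries.coeff_succ_X_mul,
      ih]
    simp [Finset.Nat.antidiagonal_succ, add_comm]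

theorem ext_of_X_linear {L L' : PowerSeries V →+ PowerSeries W}
    (hL : ∀ F, L (PowerSeries.X * F) = PowerSeries.X * L F)
    (hL' : ∀ F, L' (PowerSeries.X * F) = PowerSeries.X * L' F)
    (h : ∀ v, L (PowerSeries.C v) = L' (PowerSeries.C v)) (F : PowerSeries V) : L F = L' F := by
  ext n
  rw [coeff_apply_of_X_linear L hL, coeff_apply_of_X_linear L' hL']
  simp only [h]

end XLinear

/-! ### Coefficients of a star product. -/

namespace StarProduct

variable {k : Type u} [NormedField k] {V : Type w} [NormedRing V] [NormedAlgebra k V]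
  (M : StarProduct k V)

theorem X_pow_mul (n : ℕ) (F G : PowerSeries V) :
    M.mul (PowerSeries.X ^ n * F) G = PowerSeries.X ^ n * M.mul F G := by
  induction n with
  | zero => simp
  | succ n ih => rw [pow_succ', mul_assoc, M.X_mul, ih, mul_assoc]

theorem mul_X_pow (n : ℕ) (F G : PowerSeries V) :
    M.mul F (PowerSeries.X ^ n * G) = PowerSeries.X ^ n * M.mul F G := by
  induction n with
  | zero => simp
  | succ n ih => rw [pow_succ', mul_assoc, M.mul_X, ih, mul_assoc]

theorem coeff_mul_left (n : ℕ) (F G : PowerSeries V) :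
    PowerSeries.coeff n (M.mul F G) = ∑ p ∈ Finset.HasAntidiagonal.antidiagonal n,
      PowerSeries.coeff p.2 (M.mul (PowerSeries.C (PowerSeries.coeff p.1 F)) G) :=
  coeff_apply_of_X_linear (M.mul.flip G).toAddMonoidHom (fun F => M.X_mul F G) n F

theorem coeff_mul_right (n : ℕ) (F G : PowerSeries V) :
    PowerSeries.coeff n (M.mul F G) = ∑ p ∈ Finset.HasAntidiagonal.antidiagonal n,
      PowerSeries.coeff p.2 (M.mul F (PowerSeries.C (PowerSeries.coeff p.1 G))) :=
  coeff_apply_of_X_linear (M.mul F).toAddMonoidHom (fun G => M.mul_X F G) n G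

theorem coeff_mul (n : ℕ) (F G : PowerSeries V) :
    PowerSeries.coeff n (M.mul F G) = ∑ p ∈ Finset.HasAntidiagonal.antidiagonal n,
      ∑ q ∈ Finset.HasAntidiagonal.antidiagonal p.2,
        PowerSeries.coeff q.2 (M.mul (PowerSeries.C (PowerSeries.coeff p.1 F))
          (PowerSeries.C (PowerSeries.coeff q.1 G))) := by
  rw [coeff_mul_left]
  exact Finset.sum_congr rfl fun p _ => M.coeff_mul_right _ _ _

/-- A star product is compatible with truncation modulo `ħ^(n+1)`; the order-by-order construction
and the passage to its limit rest on this. -/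
theorem coeff_mul_congr {n : ℕ} {F F' G G' : PowerSeries V}
    (hF : ∀ m ≤ n, PowerSeries.coeff m F = PowerSeries.coeff m F')
    (hG : ∀ m ≤ n, PowerSeries.coeff m G = PowerSeries.coeff m G') :
    PowerSeries.coeff n (M.mul F G) = PowerSeries.coeff n (M.mul F' G') := by
  rw [coeff_mul, coeff_mul]
  refine Finset.sum_congr rfl fun p hp => Finset.sum_congr rfl fun q hq => ?_
  have h₁ := Finset.HasAntidiagonal.mem_antidiagonal.1 hp
  have h₂ := Finset.HasAntidiagonal.mem_antidiagonal.1 hq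
  rw [hF _ (by omega), hG _ (by omega)]

theorem bdd_nonneg : ∃ C : ℕ → ℝ, (∀ n, 0 ≤ C n) ∧ ∀ n v w,
    ‖PowerSeries.coeff n (M.mul (PowerSeries.C v) (PowerSeries.C w))‖ ≤ C n * ‖v‖ * ‖w‖ := by
  choose C hC using M.bdd
  refine ⟨fun n => |C n|, fun n => abs_nonneg _, fun n v w => (hC n v w).trans ?_⟩
  gcongr
  exact le_abs_self _

end StarProduct

/-! ### Lifting Lie algebra homomorphisms along a deformation -/

section LiePrimitive

variable {k : Type u} [NormedField k] {g : Type v} [LieRing g] [LieAlgebra k g] [Norm g]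
  {V : Type w} [NormedAddCommGroup V] [NormedSpace k V] [LieRingModule g V] [LieModule k g V]

/-- The alternating map associated to an alternating bilinear map. -/
def alternatingOfBilinear (B : g →ₗ[k] g →ₗ[k] V) (hB : ∀ x, B x x = 0) :
    g [⋀^Fin 2]→ₗ[k] V where
  toFun x := B (x 0) (x 1)
  map_update_add' x i a b := by fin_cases i <;> simp
  map_update_smul' x i c a := by fin_cases i <;> simp
  map_eq_zero_of_eq' x i j hij hne := by
    have h : x 0 = x 1 := by
      fin_cases i <;> fin_cases j <;> first | exact absurd rfl hne | exact hij | exact hij.symm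
    rw [h, hB]

/-- If `H²_b(g, V) = 0`, then every bounded `2`-cocycle is the coboundary of a bounded map. -/
theorem exists_bounded_primitive (hH : Subsingleton (BoundedCohomology k g V 2))
    (B : g →ₗ[k] g →ₗ[k] V) (hB : ∀ x, B x x = 0)
    (hbdd : ∃ C : ℝ, ∀ x y, ‖B x y‖ ≤ C * (‖x‖ * ‖y‖))
    (hcocycle : ∀ x y z, ⁅x, B y z⁆ + ⁅y, B z x⁆ + ⁅z, B x y⁆ +
      (B x ⁅y, z⁆ + B y ⁅z, x⁆ + B z ⁅x, y⁆) = 0) :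
    ∃ h : g →ₗ[k] V, (∃ K : ℝ, ∀ x, ‖h x‖ ≤ K * ‖x‖) ∧
      ∀ x y, B x y = ⁅x, h y⁆ - ⁅y, h x⁆ - h ⁅x, y⁆ := by
  have hanti : ∀ x y, B x y = - B y x := fun x y => by
    have := hB (x + y)
    simp only [map_add, LinearMap.add_apply, hB, zero_add, add_zero] at this
    exact eq_neg_of_add_eq_zero_right this
  let f : (Fin 2 → g) → V := alternatingOfBilinear B hB
  have hf : ∀ x, f x = B (x 0) (x 1) := fun _ => rfl
  have hf_mem : f ∈ boundedCocycles k g V 2 := by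
    refine ⟨⟨⟨_, rfl⟩, ?_⟩, ?_⟩
    · obtain ⟨C, hC⟩ := hbdd
      exact ⟨C, fun x => by rw [hf, Fin.prod_univ_two]; exact hC _ _⟩
    · change ceDifferential k 2 f = 0
      funext x
      -- Antisymmetry of `B` and of the bracket turns the cyclic form of the cocycle identity into
      -- the ordered one of the differential.
      have := hcocycle (x 0) (x 1) (x 2)
      rw [hanti (x 1) ⁅x 2, x 0⁆, ← lie_skew (x 2) (x 0), hanti (x 2) (x 0), hanti (x 0) ⁅x 1, x 2⁆,
        hanti (x 2) ⁅x 0, x 1⁆] at this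
      simp only [map_neg, LinearMap.neg_apply, lie_neg] at this
      simp only [ceDifferential, bracketSum, LinearMap.coe_mk, AddHom.coe_mk, Fin.sum_univ_succ, hf,
        Fin.removeNth_apply, Fin.cons_zero, Fin.cons_one]
      simp [Fin.succAbove, Fin.lt_def]
      rw [← this]
      abel
  have hmem : (⟨f, hf_mem⟩ : boundedCocycles k g V 2) ∈
      (boundedCoboundaries k g V 2).comap (boundedCocycles k g V 2).subtype :=
    (Submodule.Quotient.mk_eq_zero _).1 (Subsingleton.elim (α := BoundedCohomology k g V 2) _ _)
  obtain ⟨h, ⟨⟨η, rfl⟩, K, hK⟩, hh⟩ := hmem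
  refine ⟨(AlternatingMap.ofSubsingleton k g V (0 : Fin 1)).symm η, ⟨K, fun x => ?_⟩, fun x y => ?_⟩
  · simpa using hK fun _ => x
  · have := congrFun hh ![x, y]
    have h₁ : ∀ z : Fin 1 → g, η z =
        (AlternatingMap.ofSubsingleton k g V (0 : Fin 1)).symm η (z 0) := fun z => by
      refine congrArg η (funext fun i => ?_)
      rw [Subsingleton.elim i 0]
    simp only [ceDifferential, bracketSum, LinearMap.coe_mk, AddHom.coe_mk, Fin.sum_univ_succ, h₁,
      ] at this
    simp [Fin.removeNth_apply, Fin.succAbove] at this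
    change B x y = ⁅x, η fun _ => y⁆ - ⁅y, η fun _ => x⁆ - η fun _ => ⁅x, y⁆
    change _ = B x y at this
    rw [← this]
    abel

end LiePrimitive

/-! ### Obstruction theory for Lie homomorphisms, one power of `ħ` at a time. -/

section LieLift

variable {k : Type u} [NormedField k] {g : Type v} [LieRing g] [LieAlgebra k g]
  {V : Type w} [NormedRing V] [NormedAlgebra k V]

/-- The failure of `L : g → V⟦ħ⟧` to be a homomorphism of Lie algebras for the commutator of a star
product. -/
def lieDefect (M : StarProduct k V) (L : g →ₗ[k] PowerSeries V) (x y : g) : PowerSeries V :=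
  M.mul (L x) (L y) - M.mul (L y) (L x) - L ⁅x, y⁆

theorem lieDefect_coeff_congr (M : StarProduct k V) {L L' : g →ₗ[k] PowerSeries V} {n : ℕ}
    (h : ∀ m ≤ n, ∀ x, PowerSeries.coeff m (L x) = PowerSeries.coeff m (L' x)) (x y : g) :
    PowerSeries.coeff n (lieDefect M L x y) = PowerSeries.coeff n (lieDefect M L' x y) := by
  simp only [lieDefect, map_sub]
  rw [h n le_rfl, M.coeff_mul_congr (fun m hm => h m hm x) fun m hm => h m hm y,
    M.coeff_mul_congr (fun m hm => h m hm y) fun m hm => h m hm x]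

/-- A Bianchi identity: the mixed terms with `L ⁅y, z⁆` cancel, and what remains is the Jacobi
identity of the star commutator (from associativity) and that of `g`. Its lowest-order coefficient
will be the cocycle condition. -/
theorem lieDefect_jacobi (M : StarProduct k V) (L : g →ₗ[k] PowerSeries V) (x y z : g) :
    (M.mul (L x) (lieDefect M L y z) - M.mul (lieDefect M L y z) (L x)) +
    (M.mul (L y) (lieDefect M L z x) - M.mul (lieDefect M L z x) (L y)) +
    (M.mul (L z) (lieDefect M L x y) - M.mul (lieDefect M L x y) (L z)) +
    (lieDefect M L x ⁅y, z⁆ + lieDefect M L y ⁅z, x⁆ + lieDefect M L z ⁅x, y⁆) = 0 := by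
  have h : L ⁅x, ⁅y, z⁆⁆ + L ⁅y, ⁅z, x⁆⁆ + L ⁅z, ⁅x, y⁆⁆ = 0 := by
    rw [← map_add, ← map_add, lie_jacobi, map_zero]
  simp only [lieDefect, map_sub, LinearMap.sub_apply, M.assoc]
  rw [← neg_eq_zero, ← h]
  abel

theorem smul_coeff (c : k) (n : ℕ) (F : PowerSeries V) :
    PowerSeries.coeff n (c • F) = c • PowerSeries.coeff n F := rfl

/-- The `n`-th coefficient of the defect, as a bilinear map. -/
noncomputable def lieDefectCoeff (M : StarProduct k V) (L : g →ₗ[k] PowerSeries V) (n : ℕ) :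
    g →ₗ[k] g →ₗ[k] V :=
  LinearMap.mk₂ k (fun x y => PowerSeries.coeff n (lieDefect M L x y))
    (fun x x' y => by
      simp only [lieDefect, map_add, add_lie, LinearMap.add_apply, map_sub]
      abel)
    (fun c x y => by
      simp only [lieDefect, map_smul, smul_lie, LinearMap.smul_apply, map_sub, smul_coeff,
        smul_sub])
    (fun x y y' => by
      simp only [lieDefect, map_add, lie_add, LinearMap.add_apply, map_sub]
      abel)
    (fun c x y => by
      simp only [lieDefect, map_smul, lie_smul, LinearMap.smul_apply, map_sub, smul_coeff,
        smul_sub])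

variable [Norm g]

/-- A linear lift to `V⟦ħ⟧`, with bounded coefficients, of the linear map `ι : g → V`. -/
structure IsBddLift (ι : g →ₗ[k] V) (L : g →ₗ[k] PowerSeries V) : Prop where
  coeff_zero : ∀ x, PowerSeries.coeff 0 (L x) = ι x
  bdd : ∀ n, ∃ K : ℝ, ∀ x, ‖PowerSeries.coeff n (L x)‖ ≤ K * ‖x‖

/-- The coefficient is a finite sum of bounded bilinear terms. Nonnegativity has to be assumed
because `Norm g` is a bare function without axioms. -/
theorem coeff_mul_bound (M : StarProduct k V) (hg : ∀ x : g, 0 ≤ ‖x‖)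
    {ι : g →ₗ[k] V} {L : g →ₗ[k] PowerSeries V} (hL : IsBddLift ι L) (n : ℕ) :
    ∃ C : ℝ, ∀ x y, ‖PowerSeries.coeff n (M.mul (L x) (L y))‖ ≤ C * (‖x‖ * ‖y‖) := by
  obtain ⟨C, hC, hM⟩ := M.bdd_nonneg
  choose K hK using hL.bdd
  have hK' : ∀ n x, ‖PowerSeries.coeff n (L x)‖ ≤ |K n| * ‖x‖ := fun n x =>
    (hK n x).trans (mul_le_mul_of_nonneg_right (le_abs_self _) (hg x))
  refine ⟨∑ p ∈ Finset.HasAntidiagonal.antidiagonal n,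
    ∑ q ∈ Finset.HasAntidiagonal.antidiagonal p.2, C q.2 * |K p.1| * |K q.1|, fun x y => ?_⟩
  rw [M.coeff_mul, Finset.sum_mul]
  refine (norm_sum_le _ _).trans (Finset.sum_le_sum fun p _ => ?_)
  rw [Finset.sum_mul]
  refine (norm_sum_le _ _).trans (Finset.sum_le_sum fun q _ => (hM _ _ _).trans ?_)
  calc C q.2 * ‖PowerSeries.coeff p.1 (L x)‖ * ‖PowerSeries.coeff q.1 (L y)‖
      ≤ C q.2 * (|K p.1| * ‖x‖) * (|K q.1| * ‖y‖) := by
        have := hC q.2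
        have := hg x
        gcongr
        · exact hK' _ _
        · exact hK' _ _
    _ = C q.2 * |K p.1| * |K q.1| * (‖x‖ * ‖y‖) := by ring

variable [LieRingModule g V] [LieModule k g V]

/-- The lowest nonvanishing coefficient of the defect is a bounded cocycle, since at that order star
multiplication by `L x` is multiplication by `ι x` in `V`. Replacing `L` by `L - ħ^n h`, with `h` a
primitive, changes this coefficient by the coboundary of `h`. As `n ≠ 0`, neither the constant term
of `L` nor, at order `n`, the product of the two corrections interferes. -/
theorem IsBddLift.exists_correction (hH : Subsingleton (BoundedCohomology k g V 2))
    (M : StarProduct k V) {ι : g →ₗ[k] V} (hι : ∀ x, ‖x‖ = ‖ι x‖)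
    (hι_lie : ∀ x y, ι ⁅x, y⁆ = ι x * ι y - ι y * ι x)
    (hact : ∀ (x : g) (m : V), ⁅x, m⁆ = ι x * m - m * ι x)
    {L : g →ₗ[k] PowerSeries V} (hL : IsBddLift ι L) {n : ℕ} (hn : n ≠ 0)
    (hdef : ∀ m < n, ∀ x y, PowerSeries.coeff m (lieDefect M L x y) = 0) :
    ∃ L' : g →ₗ[k] PowerSeries V, IsBddLift ι L' ∧
      (∀ m < n, ∀ x, PowerSeries.coeff m (L' x) = PowerSeries.coeff m (L x)) ∧
      ∀ m ≤ n, ∀ x y, PowerSeries.coeff m (lieDefect M L' x y) = 0 := by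
  have hg : ∀ x : g, 0 ≤ ‖x‖ := fun x => (hι x).symm ▸ norm_nonneg _
  have hcomm : ∀ x y : g, ‖⁅x, y⁆‖ ≤ 2 * (‖x‖ * ‖y‖) := fun x y => by
    rw [hι, hι x, hι y, hι_lie]
    refine (norm_sub_le _ _).trans ?_
    linarith [norm_mul_le (ι x) (ι y), norm_mul_le (ι y) (ι x)]
  -- Divisibility of the defect by `ħ^n` is what reduces a star product with it, at order `n`, to a
  -- product of constant terms.
  have hX : ∀ x y, ∃ G, lieDefect M L x y = PowerSeries.X ^ n * G := fun x y =>
    PowerSeries.X_pow_dvd_iff.2 fun m hm => hdef m hm x y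
  have hleft : ∀ x y z, PowerSeries.coeff n (M.mul (L x) (lieDefect M L y z)) =
      ι x * PowerSeries.coeff n (lieDefect M L y z) := fun x y z => by
    obtain ⟨G, hG⟩ := hX y z
    rw [hG, M.mul_X_pow, PowerSeries.coeff_X_pow_mul', PowerSeries.coeff_X_pow_mul', if_pos le_rfl,
      if_pos le_rfl, Nat.sub_self, M.coeff_zero, hL.coeff_zero]
  have hright : ∀ x y z, PowerSeries.coeff n (M.mul (lieDefect M L y z) (L x)) =
      PowerSeries.coeff n (lieDefect M L y z) * ι x := fun x y z => by
    obtain ⟨G, hG⟩ := hX y z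
    rw [hG, M.X_pow_mul, PowerSeries.coeff_X_pow_mul', PowerSeries.coeff_X_pow_mul', if_pos le_rfl,
      if_pos le_rfl, Nat.sub_self, M.coeff_zero, hL.coeff_zero]
  obtain ⟨h, ⟨K, hK⟩, hh⟩ := exists_bounded_primitive hH (lieDefectCoeff M L n)
    (fun x => by simp [lieDefectCoeff, lieDefect]) (by
      obtain ⟨C, hC⟩ := coeff_mul_bound M hg hL n
      obtain ⟨K, hK⟩ := hL.bdd n
      refine ⟨C + C + |K| * 2, fun x y => ?_⟩
      rw [lieDefectCoeff, LinearMap.mk₂_apply, lieDefect, map_sub, map_sub]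
      refine (norm_sub_le _ _).trans ((add_le_add (norm_sub_le _ _) le_rfl).trans ?_)
      have h₁ := hC x y
      have h₂ := hC y x
      have h₃ : ‖PowerSeries.coeff n (L ⁅x, y⁆)‖ ≤ |K| * (2 * (‖x‖ * ‖y‖)) :=
        (hK _).trans (mul_le_mul (le_abs_self _) (hcomm x y) (hg _) (abs_nonneg _))
      linarith)
    -- Order `n` of the Bianchi identity: by `hleft` and `hright` the star commutators with `L x`
    -- become the action of `x` on `V`.
    (fun x y z => by
      have := congrArg (PowerSeries.coeff n) (lieDefect_jacobi M L x y z)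
      simp only [map_add, map_sub, map_zero, hleft, hright, ← hact] at this
      exact this)
  let L' : g →ₗ[k] PowerSeries V :=
    { toFun := fun x => L x - PowerSeries.X ^ n * PowerSeries.C (h x)
      map_add' := fun x y => by rw [map_add, map_add, map_add, mul_add]; abel
      map_smul' := fun c x => by
        have : (PowerSeries.C (c • h x) : PowerSeries V) = c • PowerSeries.C (h x) := by
          ext m
          rw [smul_coeff, PowerSeries.coeff_C, PowerSeries.coeff_C]
          split <;> simp
        rw [map_smul, map_smul, this, RingHom.id_apply, smul_sub, mul_smul_comm] }
  have hL' : ∀ x, L' x = L x - PowerSeries.X ^ n * PowerSeries.C (h x) := fun _ => rfl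
  have hlt : ∀ m < n, ∀ x, PowerSeries.coeff m (L' x) = PowerSeries.coeff m (L x) := by
    intro m hm x
    rw [hL', map_sub, PowerSeries.coeff_X_pow_mul', if_neg hm.not_ge, sub_zero]
  refine ⟨L', ⟨fun x => ?_, fun m => ?_⟩, hlt, fun m hm x y => ?_⟩
  · rw [hlt 0 (Nat.pos_of_ne_zero hn), hL.coeff_zero]
  · obtain ⟨K', hK'⟩ := hL.bdd m
    refine ⟨K' + |K|, fun x => ?_⟩
    rw [hL', map_sub, PowerSeries.coeff_X_pow_mul', PowerSeries.coeff_C, add_mul]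
    refine (norm_sub_le _ _).trans (add_le_add (hK' x) ?_)
    have h₁ : ‖h x‖ ≤ |K| * ‖x‖ :=
      (hK x).trans (mul_le_mul_of_nonneg_right (le_abs_self _) (hg x))
    split_ifs
    · exact h₁
    · rw [norm_zero]; exact (norm_nonneg _).trans h₁
    · rw [norm_zero]; exact (norm_nonneg _).trans h₁
  · rcases hm.lt_or_eq with hm | rfl
    · rw [lieDefect_coeff_congr M (fun j hj x => hlt j (hj.trans_lt hm) x), hdef m hm]
    -- Expansion in powers of the correction. The linear part contributes the coboundary of `h` at
    -- order `m`; the quadratic part starts at order `2m`, which exceeds `m` because `m ≠ 0`.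
    · have h₁ : lieDefect M L' x y = lieDefect M L x y - PowerSeries.X ^ m *
          (M.mul (L x) (PowerSeries.C (h y)) - M.mul (PowerSeries.C (h y)) (L x) -
            (M.mul (L y) (PowerSeries.C (h x)) - M.mul (PowerSeries.C (h x)) (L y)) -
            PowerSeries.C (h ⁅x, y⁆)) + PowerSeries.X ^ m * (PowerSeries.X ^ m *
            (M.mul (PowerSeries.C (h x)) (PowerSeries.C (h y)) -
              M.mul (PowerSeries.C (h y)) (PowerSeries.C (h x)))) := by
        simp only [lieDefect, hL', map_sub, LinearMap.sub_apply, M.X_pow_mul, M.mul_X_pow, mul_sub]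
        abel
      have h₂ := hh x y
      rw [lieDefectCoeff, LinearMap.mk₂_apply] at h₂
      rw [h₁, map_add, map_sub, PowerSeries.coeff_X_pow_mul', PowerSeries.coeff_X_pow_mul',
        if_pos le_rfl, if_pos le_rfl, Nat.sub_self, PowerSeries.coeff_X_pow_mul', if_neg (by omega),
        h₂]
      simp only [map_sub, M.coeff_zero, hL.coeff_zero, hact, PowerSeries.coeff_zero_C]
      abel

/-- If `H²_b(g, V) = 0`, then `ι : g → V` lifts to a Lie algebra homomorphism to any deformation
of `V`. -/
theorem exists_lie_lift (hH : Subsingleton (BoundedCohomology k g V 2))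
    (M : StarProduct k V) {ι : g →ₗ[k] V} (hι : ∀ x, ‖x‖ = ‖ι x‖)
    (hι_lie : ∀ x y, ι ⁅x, y⁆ = ι x * ι y - ι y * ι x)
    (hact : ∀ (x : g) (m : V), ⁅x, m⁆ = ι x * m - m * ι x) :
    ∃ L : g →ₗ[k] PowerSeries V, (∀ x, PowerSeries.coeff 0 (L x) = ι x) ∧
      (∀ n, ∃ K : ℝ, ∀ x, ‖PowerSeries.coeff n (L x)‖ ≤ K * ‖x‖) ∧
      ∀ x y, L ⁅x, y⁆ = M.mul (L x) (L y) - M.mul (L y) (L x) := by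
  -- Lifts that are Lie homomorphisms through order `n` inclusive, so that the step from `n` to `n +
  -- 1` corrects at the nonzero order `n + 1`.
  let P (n : ℕ) := {L : g →ₗ[k] PowerSeries V // IsBddLift ι L ∧
    ∀ m < n + 1, ∀ x y, PowerSeries.coeff m (lieDefect M L x y) = 0}
  have step : ∀ n (L : P n), ∃ L' : P (n + 1),
      ∀ m < n + 1, ∀ x, PowerSeries.coeff m (L'.1 x) = PowerSeries.coeff m (L.1 x) := by
    rintro n ⟨L, hL, hdef⟩
    obtain ⟨L', h₁, h₂, h₃⟩ := hL.exists_correction hH M hι hι_lie hact n.succ_ne_zero hdef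
    exact ⟨⟨L', h₁, fun m hm => h₃ m (Nat.lt_succ_iff.1 hm)⟩, h₂⟩
  choose next hnext using step
  let L₀ : g →ₗ[k] PowerSeries V :=
    { toFun := fun x => PowerSeries.C (ι x)
      map_add' := fun x y => by rw [map_add, map_add]
      map_smul' := fun c x => by
        ext m
        rw [RingHom.id_apply, smul_coeff, PowerSeries.coeff_C, PowerSeries.coeff_C]
        split <;> simp }
  have hL₀ : ∀ x, L₀ x = PowerSeries.C (ι x) := fun _ => rfl
  -- The start is the constant lift of `ι`: at order 0 the star product is the product of `V`, where
  -- `ι` respects brackets.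
  let S : ∀ n, P n := fun n => Nat.rec ⟨L₀, ⟨fun x => by rw [hL₀, PowerSeries.coeff_zero_C],
    fun n => ⟨1, fun x => by
      rw [hL₀, PowerSeries.coeff_C, one_mul, hι]
      split <;> simp⟩⟩, fun m hm x y => by
        obtain rfl : m = 0 := Nat.lt_one_iff.1 hm
        simp [lieDefect, hL₀, M.coeff_zero, hι_lie, -PowerSeries.coeff_zero_eq_constantCoeff]⟩ next n
  have hS : ∀ n, S (n + 1) = next n (S n) := fun _ => rfl
  have hstable : ∀ d n, ∀ m ≤ n, ∀ x,
      PowerSeries.coeff m ((S (n + d)).1 x) = PowerSeries.coeff m ((S n).1 x) := by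
    intro d n m hm x
    induction d with
    | zero => rfl
    | succ d ih => rw [← add_assoc, hS, hnext _ _ _ (by omega), ih]
  -- The `ħ`-adic limit, taken diagonally: order `n` no longer changes after the `n`-th
  -- approximation.
  let L : g →ₗ[k] PowerSeries V :=
    { toFun := fun x => PowerSeries.mk fun n => PowerSeries.coeff n ((S n).1 x)
      map_add' := fun x y => by ext n; simp
      map_smul' := fun c x => by
        ext n
        simp only [map_smul, smul_coeff, PowerSeries.coeff_mk, RingHom.id_apply] }
  have hL : ∀ n x, PowerSeries.coeff n (L x) = PowerSeries.coeff n ((S n).1 x) := fun n x =>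
    PowerSeries.coeff_mk n fun n => PowerSeries.coeff n ((S n).1 x)
  refine ⟨L, fun x => ?_, fun n => ?_, fun x y => ?_⟩
  · rw [hL, (S 0).2.1.coeff_zero]
  · simp only [hL]
    exact (S n).2.1.bdd n
  · refine (sub_eq_zero.1 ?_).symm
    change lieDefect M L x y = 0
    ext n
    rw [lieDefect_coeff_congr M (L' := (S n).1) (n := n), (S n).2.2 n n.lt_succ_self, map_zero]
    intro m hm z
    obtain ⟨d, rfl⟩ := Nat.exists_eq_add_of_le hm
    rw [hL, hstable d m m le_rfl]

end LieLift

/-! ### The algebra of a star product and its balls -/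

section StarAlg

variable {k : Type u} [NormedField k] {V : Type w} [NormedRing V] [NormedAlgebra k V]

/-- `V⟦ħ⟧` with the multiplication given by a star product. -/
def StarAlg (_M : StarProduct k V) : Type w := PowerSeries V

variable (M : StarProduct k V)

noncomputable instance : AddCommGroup (StarAlg M) := inferInstanceAs (AddCommGroup (PowerSeries V))

noncomputable instance : Module k (StarAlg M) := inferInstanceAs (Module k (PowerSeries V))

noncomputable instance : Ring (StarAlg M) where
  __ := (inferInstance : AddCommGroup (StarAlg M))
  mul F G := M.mul F G
  one := (1 : PowerSeries V)
  zero_mul F := (congrArg (fun f => f F) (map_zero M.mul) : _)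
  mul_zero F := map_zero (M.mul F)
  left_distrib F G H := map_add (M.mul F) G H
  right_distrib F G H := M.mul.map_add₂ F G H
  mul_assoc := M.assoc
  one_mul := M.one_mul
  mul_one := M.mul_one

noncomputable instance : Algebra k (StarAlg M) :=
  Algebra.ofModule (fun c F G => M.mul.map_smul₂ c F G) fun c F G => map_smul (M.mul F) c G

/-- Reduction modulo `ħ` of the algebra of a star product. -/
noncomputable def StarAlg.reduce : StarAlg M →ₐ[k] V :=
  AlgHom.ofLinearMap
    { toFun := fun F => PowerSeries.coeff 0 (show PowerSeries V from F)
      map_add' := fun _ _ => map_add (PowerSeries.coeff 0) _ _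
      map_smul' := fun _ _ => rfl }
    PowerSeries.coeff_zero_one M.coeff_zero

/-- The power series whose coefficients have norm at most `C / r n`. -/
def seriesBall (r : ℕ → ℝ) (C : ℝ) : Set (PowerSeries V) :=
  {F | ∀ n, r n * ‖PowerSeries.coeff n F‖ ≤ C}

variable {M} {r : ℕ → ℝ}

theorem seriesBall_mono {C C' : ℝ} (h : C ≤ C') {F : PowerSeries V} (hF : F ∈ seriesBall r C) :
    F ∈ seriesBall r C' := fun n => (hF n).trans h

theorem seriesBall_add [IsUltrametricDist V] (hr : ∀ n, 0 < r n) {C : ℝ} {F G : PowerSeries V}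
    (hF : F ∈ seriesBall r C) (hG : G ∈ seriesBall r C) : F + G ∈ seriesBall r C := fun n => by
  rw [map_add]
  refine (mul_le_mul_of_nonneg_left (IsUltrametricDist.norm_add_le_max _ _) (hr n).le).trans ?_
  rw [mul_max_of_nonneg _ _ (hr n).le]
  exact max_le (hF n) (hG n)

theorem seriesBall_smul {C : ℝ} (c : k) {F : PowerSeries V} (hF : F ∈ seriesBall r C) :
    c • F ∈ seriesBall r (‖c‖ * C) := fun n => by
  rw [smul_coeff, norm_smul, mul_left_comm]
  exact mul_le_mul_of_nonneg_left (hF n) (norm_nonneg c)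

/-- Weights for which balls of power series are stable under a bilinear product whose coefficients
are bounded by the `C n`. -/
structure IsAdapted (C : ℕ → ℝ) (r : ℕ → ℝ) : Prop where
  pos : ∀ n, 0 < r n
  zero : r 0 = 1
  mul_le : ∀ i j l, l ≠ 0 → r (i + (j + l)) * C l ≤ r i * r j
  add_le : ∀ i j, r (i + j) ≤ r i * r j

/-- Take `r n = (D n)^(-n)` with `D ≥ 1` increasing and dominating `C` and `K`. Passing from total
degree `i + j` to `i + j + l` with `l ≠ 0` gains at least one factor `D`, which absorbs `C l`. Since
`r 0 = 1`, index 0 leaves no room for a constant and is excluded from the conditions involving `C`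
and `K`. -/
theorem exists_isAdapted {C K : ℕ → ℝ} (hC : ∀ n, 0 ≤ C n) (hK : ∀ n, 0 ≤ K n) :
    ∃ r, IsAdapted C r ∧ ∀ n, n ≠ 0 → r n * K n ≤ 1 := by
  let D : ℕ → ℝ := fun n => 1 + ∑ l ∈ Finset.range (n + 1), (C l + K l)
  have hnn : ∀ l, 0 ≤ C l + K l := fun l => add_nonneg (hC l) (hK l)
  have hD1 : ∀ n, 1 ≤ D n := fun n => le_add_of_nonneg_right (Finset.sum_nonneg fun l _ => hnn l)
  have hD0 : ∀ n, 0 < D n := fun n => one_pos.trans_le (hD1 n)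
  have hDmono : Monotone D := fun m n h => by
    refine add_le_add le_rfl (Finset.sum_le_sum_of_subset_of_nonneg ?_ fun l _ _ => hnn l)
    exact Finset.range_mono (Nat.succ_le_succ h)
  have hDl : ∀ n, C n + K n ≤ D n := fun n => by
    refine le_add_of_nonneg_of_le zero_le_one ?_
    exact Finset.single_le_sum (f := fun l => C l + K l) (fun l _ => hnn l)
      (Finset.self_mem_range_succ n)
  have hpow : ∀ i j n, i ≤ n → j ≤ n → D i ^ i * D j ^ j ≤ D n ^ (i + j) := fun i j n hi hj => by
    rw [pow_add]
    exact mul_le_mul (pow_le_pow_left₀ (hD0 i).le (hDmono hi) i)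
      (pow_le_pow_left₀ (hD0 j).le (hDmono hj) j) (pow_nonneg (hD0 j).le _)
      (pow_nonneg (hD0 n).le _)
  refine ⟨fun n => (D n ^ n)⁻¹, ⟨fun n => inv_pos.2 (pow_pos (hD0 n) n), by simp,
    fun i j l hl => ?_, fun i j => ?_⟩, fun n hn => ?_⟩
  · rw [← mul_inv, inv_mul_le_iff₀ (pow_pos (hD0 _) _), ← div_eq_mul_inv,
      le_div_iff₀ (mul_pos (pow_pos (hD0 _) _) (pow_pos (hD0 _) _))]
    calc C l * (D i ^ i * D j ^ j)
        ≤ D (i + (j + l)) * D (i + (j + l)) ^ (i + j) := by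
          refine mul_le_mul ?_ (hpow i j _ (by omega) (by omega))
            (mul_pos (pow_pos (hD0 _) _) (pow_pos (hD0 _) _)).le (hD0 _).le
          exact (le_add_of_nonneg_right (hK l)).trans ((hDl l).trans (hDmono (by omega)))
      _ = D (i + (j + l)) ^ (i + j + 1) := (pow_succ' _ _).symm
      -- The spare factor `D` fits because `l ≥ 1`.
      _ ≤ D (i + (j + l)) ^ (i + (j + l)) := pow_le_pow_right₀ (hD1 _) (by omega)
  · rw [← mul_inv]
    exact inv_anti₀ (mul_pos (pow_pos (hD0 _) _) (pow_pos (hD0 _) _))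
      (hpow i j _ (by omega) (by omega))
  · rw [inv_mul_le_iff₀ (pow_pos (hD0 _) _), mul_one]
    exact (le_add_of_nonneg_left (hC n)).trans ((hDl n).trans (le_self_pow₀ (hD1 n) hn))

/-- Terms of positive order are controlled by the adapted weights, the order-zero term by
submultiplicativity in `V`; the ultrametric inequality bounds the sum without loss. The constant is
exactly 1, so the estimate survives products of arbitrary length. -/
theorem StarProduct.seriesBall_mul [IsUltrametricDist V] {C : ℕ → ℝ}
    (hM : ∀ n v w, ‖PowerSeries.coeff n (M.mul (PowerSeries.C v) (PowerSeries.C w))‖ ≤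
      C n * ‖v‖ * ‖w‖) (hr : IsAdapted C r) {a b : ℝ} {F G : PowerSeries V}
    (hF : F ∈ seriesBall r a) (hG : G ∈ seriesBall r b) : M.mul F G ∈ seriesBall r (a * b) := by
  intro n
  have ha : 0 ≤ a := (mul_nonneg (hr.pos 0).le (norm_nonneg _)).trans (hF 0)
  have hb : 0 ≤ b := (mul_nonneg (hr.pos 0).le (norm_nonneg _)).trans (hG 0)
  have hn := hr.pos n
  rw [M.coeff_mul, ← le_div_iff₀' hn]
  refine IsUltrametricDist.norm_sum_le_of_forall_le_of_nonneg (by positivity) fun p hp =>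
    IsUltrametricDist.norm_sum_le_of_forall_le_of_nonneg (by positivity) fun q hq => ?_
  obtain rfl := Finset.HasAntidiagonal.mem_antidiagonal.1 hp
  have hq' := Finset.HasAntidiagonal.mem_antidiagonal.1 hq
  rw [le_div_iff₀' hn, ← hq']
  have h₁ : r p.1 * r q.1 * (‖PowerSeries.coeff p.1 F‖ * ‖PowerSeries.coeff q.1 G‖) ≤ a * b := by
    calc _ = (r p.1 * ‖PowerSeries.coeff p.1 F‖) * (r q.1 * ‖PowerSeries.coeff q.1 G‖) := by ring
      _ ≤ a * b := mul_le_mul (hF _) (hG _)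
        (mul_nonneg (hr.pos _).le (norm_nonneg _)) ha
  refine le_trans ?_ h₁
  by_cases hl : q.2 = 0
  · rw [hl, add_zero, M.coeff_zero, PowerSeries.coeff_zero_C, PowerSeries.coeff_zero_C]
    exact mul_le_mul (hr.add_le _ _) (norm_mul_le _ _) (norm_nonneg _)
      (mul_pos (hr.pos _) (hr.pos _)).le
  · calc _ ≤ r (p.1 + (q.1 + q.2)) *
          (C q.2 * ‖PowerSeries.coeff p.1 F‖ * ‖PowerSeries.coeff q.1 G‖) :=
        mul_le_mul_of_nonneg_left (hM _ _ _) (hr.pos _).le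
      _ = r (p.1 + (q.1 + q.2)) * C q.2 *
          (‖PowerSeries.coeff p.1 F‖ * ‖PowerSeries.coeff q.1 G‖) := by ring
      _ ≤ _ := mul_le_mul_of_nonneg_right (hr.mul_le _ _ _ hl)
        (mul_nonneg (norm_nonneg _) (norm_nonneg _))

end StarAlg

/-! ### Serre elements as iterated commutators -/

section Serre

variable {I : Type v} {Φ : Type w} [AddCommGroup Φ] (D : RootDatum I Φ)

/-- Left and right multiplication by `x i` commute, so the binomial theorem expands the power of
their difference. In this form a Serre element is a bracket expression, to which a Lie homomorphism
can be applied. -/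
theorem serre_eq_iterate {R : Type*} [Ring R] (x : I → R) (i j : I) :
    serre D x i j =
      (fun z => x i * z - z * x i)^[(1 - D.coroot i (D.root j)).toNat] (x j) := by
  set m := (1 - D.coroot i (D.root j)).toNat with hm
  let a : Module.End ℤ R := -LinearMap.mulRight ℤ (x i)
  let b : Module.End ℤ R := LinearMap.mulLeft ℤ (x i)
  have hab : Commute a b := (LinearMap.commute_mulLeft_right (x i) (x i)).symm.neg_left
  have h : ∀ n z, (fun z => x i * z - z * x i)^[n] z = ((a + b) ^ n) z := by
    intro n
    induction n with
    | zero => intro z; rfl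
    | succ n ih =>
      intro z
      rw [Function.iterate_succ_apply, ih, pow_succ, Module.End.mul_apply]
      congr 1
      simp only [a, b, LinearMap.add_apply, LinearMap.neg_apply, LinearMap.mulRight_apply,
        LinearMap.mulLeft_apply]
      abel
  rw [h, hab.add_pow, LinearMap.sum_apply]
  simp only [serre, ← hm]
  refine Finset.sum_congr rfl fun l _ => ?_
  have ha : a ^ l = (-1 : ℤ) ^ l • LinearMap.mulRight ℤ (x i ^ l) := by
    rw [← LinearMap.pow_mulRight, ← smul_pow, neg_one_smul]
  rw [ha, LinearMap.pow_mulLeft]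
  simp only [Module.End.mul_apply, Module.End.natCast_apply, LinearMap.smul_apply,
    LinearMap.mulLeft_apply, LinearMap.mulRight_apply]
  rw [mul_smul, mul_smul_comm, smul_mul_assoc, natCast_zsmul]

theorem map_serre {R S : Type*} [Ring R] [Ring S] (f : R →+* S) (x : I → R) (i j : I) :
    f (serre D x i j) = serre D (fun i => f (x i)) i j := by
  simp only [serre, map_sum, map_zsmul, map_mul, map_pow]

end Serre

/-! ### Algebra homomorphisms out of the enveloping algebra -/

section EnvHom

variable {k : Type u} [NormedField k] {I : Type v} {Φ : Type w} [AddCommGroup Φ]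
  {D : RootDatum I Φ} {ρ : Radii}

/-- The weight of a Chevalley generator. -/
def ChevalleyGen.weight (ρ : Radii) : ChevalleyGen I → ℝ
  | .F _ => ρ.r
  | .H _ => 1
  | .E _ => ρ.s

theorem Env.norm_gen_le (x : ChevalleyGen I) : ‖Env.gen k D ρ x‖ ≤ x.weight ρ := by
  cases x with
  | F i =>
    have h := Env.norm_le_of_mem D ρ (Env.triBall_mon (k := k) D ρ ([i], [], []))
    simpa [Env.triMon, Env.triWeight, ChevalleyGen.weight] using h
  | H i =>
    have h := Env.norm_le_of_mem D ρ (Env.triBall_mon (k := k) D ρ ([], [i], []))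
    simpa [Env.triMon, Env.triWeight, ChevalleyGen.weight] using h
  | E i =>
    have h := Env.norm_le_of_mem D ρ (Env.triBall_mon (k := k) D ρ ([], [], [i]))
    simpa [Env.triMon, Env.triWeight, ChevalleyGen.weight] using h

theorem Env.algHom_ext {R : Type*} [Ring R] [Algebra k R] {f f' : Env k D ρ →ₐ[k] R}
    (h : ∀ x, f (Env.gen k D ρ x) = f' (Env.gen k D ρ x)) : f = f' :=
  RingQuot.ringQuot_ext' k (s := EnvRel k D) f f' (FreeAlgebra.hom_ext (funext h))

variable [IsUltrametricDist k]

/-- The canonical map from `U(g)` to its completion. -/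
noncomputable def CompletedEnv.ofEnv : Env k D ρ →ₐ[k] CompletedEnv k D ρ where
  __ := (UniformSpace.Completion.coeRingHom :
    Env k D ρ →+* UniformSpace.Completion (Env k D ρ))
  commutes' _ := rfl

theorem CompletedEnv.denseRange_ofEnv :
    DenseRange (CompletedEnv.ofEnv : Env k D ρ →ₐ[k] CompletedEnv k D ρ) :=
  UniformSpace.Completion.denseRange_coe

theorem CompletedEnv.norm_ofEnv (x : Env k D ρ) :
    ‖(CompletedEnv.ofEnv x : CompletedEnv k D ρ)‖ = ‖x‖ :=
  UniformSpace.Completion.norm_coe x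

theorem CompletedEnv.norm_one_le : ‖(1 : CompletedEnv k D ρ)‖ ≤ 1 := by
  rw [← map_one (CompletedEnv.ofEnv (k := k) (D := D) (ρ := ρ)), CompletedEnv.norm_ofEnv]
  have h := Env.norm_le_of_mem D ρ (Env.triBall_mon (k := k) D ρ ([], [], []))
  simpa [Env.triMon, Env.triWeight] using h

/-- The Chevalley generators, as elements of `g_{r,s}`. -/
noncomputable def gLie.gen (x : ChevalleyGen I) : gLie k D ρ :=
  ⟨CompletedEnv.gen k D ρ x, by
    rw [gLie, ← SetLike.mem_coe, LieSubalgebra.coe_sInf]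
    exact Set.mem_iInter₂.2 fun _ hL => hL.2 x⟩

theorem gLie.norm_gen_le (x : ChevalleyGen I) :
    ‖(gLie.gen x : gLie k D ρ)‖ ≤ x.weight ρ :=
  (CompletedEnv.norm_ofEnv _).trans_le (Env.norm_gen_le x)

theorem gLie.coe_lie (x y : gLie k D ρ) : ((⁅x, y⁆ : gLie k D ρ) : CompletedEnv k D ρ) =
    (x : CompletedEnv k D ρ) * y - y * x := rfl

theorem gLie.coe_iterate_lie (x y : gLie k D ρ) (n : ℕ) :
    (((fun z => ⁅x, z⁆)^[n] y : gLie k D ρ) : CompletedEnv k D ρ) =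
      (fun z => (x : CompletedEnv k D ρ) * z - z * x)^[n] y := by
  induction n with
  | zero => rfl
  | succ n ih =>
    rw [Function.iterate_succ_apply', Function.iterate_succ_apply', gLie.coe_lie, ih]

/-- A Lie algebra homomorphism from `g_{r,s}` to the commutator Lie algebra of an associative
algebra extends to `U(g)`. -/
theorem Env.exists_algHom {R : Type*} [Ring R] [Algebra k R] (L : gLie k D ρ →ₗ[k] R)
    (hL : ∀ x y, L ⁅x, y⁆ = L x * L y - L y * L x) :
    ∃ Ψ : Env k D ρ →ₐ[k] R, ∀ x, Ψ (Env.gen k D ρ x) = L (gLie.gen x) := by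
  let f : FreeAlgebra k (ChevalleyGen I) →ₐ[k] R :=
    FreeAlgebra.lift k fun x => L (gLie.gen x)
  -- The relations are read in the completion, where `gLie` lives; injectivity of the map from
  -- `U(g)` to it is not needed.
  let p : FreeAlgebra k (ChevalleyGen I) →ₐ[k] CompletedEnv k D ρ :=
    CompletedEnv.ofEnv.comp (RingQuot.mkAlgHom k (EnvRel k D) :
      FreeAlgebra k (ChevalleyGen I) →ₐ[k] Env k D ρ)
  have hf : ∀ x, f (FreeAlgebra.ι k x) = L (gLie.gen x) := fun x => FreeAlgebra.lift_ι_apply _ _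
  have hp : ∀ x, p (FreeAlgebra.ι k x) = (gLie.gen x : gLie k D ρ) := fun x => rfl
  have hrel : ∀ {a b}, EnvRel k D a b → p a = p b := fun h =>
    congrArg (CompletedEnv.ofEnv (k := k) (D := D) (ρ := ρ)) (RingQuot.mkAlgHom_rel k h)
  -- A relation equating a commutator of generators with an element of `gLie` is an equality in that
  -- Lie algebra, hence is carried over by `L`.
  have hcomm : ∀ x y (z : gLie k D ρ), p (FreeAlgebra.ι k x * FreeAlgebra.ι k y -
      FreeAlgebra.ι k y * FreeAlgebra.ι k x) = z →
      f (FreeAlgebra.ι k x * FreeAlgebra.ι k y - FreeAlgebra.ι k y * FreeAlgebra.ι k x) = L z := by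
    intro x y z h
    simp only [map_sub, map_mul, hp, hf] at h ⊢
    rw [← hL]
    exact congrArg L (Subtype.ext h)
  have hiter : ∀ (x y : gLie k D ρ) n,
      L ((fun z => ⁅x, z⁆)^[n] y) = (fun z => L x * z - z * L x)^[n] (L y) := by
    intro x y n
    induction n with
    | zero => rfl
    | succ n ih => rw [Function.iterate_succ_apply', Function.iterate_succ_apply', hL, ih]
  -- The Serre element is an iterated bracket in `gLie` that vanishes there, and `L` sends it to the
  -- same iterated commutator in `R`.
  have hserre : ∀ (c : I → ChevalleyGen I) i j,
      p (serre D (fun i => FreeAlgebra.ι k (c i)) i j) = 0 →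
      f (serre D (fun i => FreeAlgebra.ι k (c i)) i j) = 0 := by
    intro c i j h
    have h₁ := (map_serre D (p : FreeAlgebra k (ChevalleyGen I) →+* CompletedEnv k D ρ)
      (fun i => FreeAlgebra.ι k (c i)) i j).trans (serre_eq_iterate D _ i j)
    have h₂ := (map_serre D (f : FreeAlgebra k (ChevalleyGen I) →+* R)
      (fun i => FreeAlgebra.ι k (c i)) i j).trans (serre_eq_iterate D _ i j)
    simp only [RingHom.coe_coe, hp, hf, h] at h₁ h₂
    rw [← gLie.coe_iterate_lie] at h₁
    rw [h₂, ← hiter, show _ = (0 : gLie k D ρ) from Subtype.ext h₁.symm, map_zero]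
  have hlift : ∀ ⦃a b⦄, EnvRel k D a b → f a = f b := by
    intro a b h
    have h' := hrel h
    cases h with
    | HH i j =>
      rw [← sub_eq_zero, ← map_sub]
      rw [← sub_eq_zero, ← map_sub] at h'
      exact (hcomm _ _ 0 h').trans (map_zero L)
    | HE i j =>
      rw [map_smul, hp] at h'
      rw [map_smul, hf, ← map_smul]
      exact hcomm _ _ _ h'
    | HF i j =>
      rw [map_smul, hp] at h'
      rw [map_smul, hf, ← map_smul]
      exact hcomm _ _ _ h'
    | EF i =>
      rw [hp] at h'
      rw [hf]
      exact hcomm _ _ _ h'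
    | EF_ne i j hij =>
      rw [map_zero] at h'
      rw [map_zero, ← map_zero L]
      exact hcomm _ _ 0 h'
    | serreE i j hij =>
      rw [map_zero] at h' ⊢
      exact hserre .E i j h'
    | serreF i j hij =>
      rw [map_zero] at h' ⊢
      exact hserre .F i j h'
  refine ⟨(RingQuot.liftAlgHom k ⟨f, hlift⟩ : RingQuot (EnvRel k D) →ₐ[k] R), fun x => ?_⟩
  exact (RingQuot.liftAlgHom_mkAlgHom_apply k f hlift _).trans (hf x)

variable {V : Type w₁} [NormedRing V] [NormedAlgebra k V] [IsUltrametricDist V]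
  {M : StarProduct k V}

/-- The bound on generators passes to triangular monomials by multiplicativity of the balls, and to
linear combinations by the ultrametric inequality. The norm of `U(g)` is defined by exactly such
expressions. -/
theorem StarProduct.algHom_mem_seriesBall {C r : ℕ → ℝ}
    (hM : ∀ n v w, ‖PowerSeries.coeff n (M.mul (PowerSeries.C v) (PowerSeries.C w))‖ ≤
      C n * ‖v‖ * ‖w‖) (hr : IsAdapted C r) (hone : ‖(1 : V)‖ ≤ 1)
    (Ψ : Env k D ρ →ₐ[k] StarAlg M)
    (hΨ : ∀ x, (Ψ (Env.gen k D ρ x) : PowerSeries V) ∈ seriesBall r (x.weight ρ))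
    (x : Env k D ρ) : (Ψ x : PowerSeries V) ∈ seriesBall r ‖x‖ := by
  have hmul : ∀ {a b : ℝ} {y z : Env k D ρ}, (Ψ y : PowerSeries V) ∈ seriesBall r a →
      (Ψ z : PowerSeries V) ∈ seriesBall r b →
      (Ψ (y * z) : PowerSeries V) ∈ seriesBall r (a * b) := by
    intro a b y z hy hz
    rw [map_mul]
    exact M.seriesBall_mul hM hr hy hz
  have hone' : (Ψ 1 : PowerSeries V) ∈ seriesBall r 1 := by
    rw [map_one]
    intro n
    change r n * ‖PowerSeries.coeff n (1 : PowerSeries V)‖ ≤ 1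
    rw [PowerSeries.coeff_one]
    split_ifs with h
    · rw [h, hr.zero, _root_.one_mul]; exact hone
    · rw [norm_zero, mul_zero]; exact zero_le_one
  have hlist : ∀ (c : I → ChevalleyGen I) (a : ℝ), (∀ i, (c i).weight ρ = a) → ∀ l : List I,
      (Ψ ((l.map fun i => Env.gen k D ρ (c i)).prod) : PowerSeries V) ∈
        seriesBall r (a ^ l.length) := by
    intro c a hc l
    induction l with
    | nil => simpa using hone'
    | cons i l ih =>
      rw [List.map_cons, List.prod_cons, List.length_cons, pow_succ']
      exact hmul (hc i ▸ hΨ (c i)) ih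
  have hmon : ∀ t, (Ψ (Env.triMon k D ρ t) : PowerSeries V) ∈
      seriesBall r (Env.triWeight ρ t) := by
    intro t
    have h := hmul (hlist .F ρ.r (fun _ => rfl) t.1)
      (hmul (hlist .H 1 (fun _ => rfl) t.2.1) (hlist .E ρ.s (fun _ => rfl) t.2.2))
    rw [one_pow, _root_.one_mul] at h
    exact h
  have hball : ∀ B, x ∈ Env.triBall k D ρ B → (Ψ x : PowerSeries V) ∈ seriesBall r B := by
    rintro B hB
    have hB0 := Env.triBall_nonneg D ρ hB
    obtain ⟨c, hc, rfl⟩ := hB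
    rw [Finsupp.linearCombination_apply, Finsupp.sum, map_sum]
    refine Finset.sum_induction (fun t => Ψ (c t • Env.triMon k D ρ t))
      (fun F : StarAlg M => (F : PowerSeries V) ∈ seriesBall r B)
      (fun F G hF hG => seriesBall_add hr.pos hF hG) ?_ fun t _ => ?_
    · intro n
      change r n * ‖PowerSeries.coeff n (0 : PowerSeries V)‖ ≤ B
      rwa [map_zero, norm_zero, mul_zero]
    · rw [map_smul]
      exact seriesBall_mono (hc t) (seriesBall_smul (c t) (hmon t))
  intro n
  -- The norm is an infimum that need not be attained, so the estimate is made for every larger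
  -- radius.
  refine le_of_forall_gt_imp_ge_of_dense fun B hB => ?_
  exact hball B (Env.mem_of_norm_lt D ρ hB) n

end EnvHom

/-! ### Rigidity at the level of power series -/

section Continuity

variable {k : Type u} [NormedField k]

/-- Each coefficient is a finite sum of continuous terms. With the version for the right factor,
this lets multiplicativity pass from the dense image of `U(g)` to the completion. -/
theorem StarProduct.continuous_coeff_mul_left {V : Type w₁} [NormedRing V] [NormedAlgebra k V]
    (M : StarProduct k V) {T : ℕ → V →ₗ[k] V} (hT : ∀ n, Continuous (T n)) (G : PowerSeries V)
    (n : ℕ) :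
    Continuous fun v => PowerSeries.coeff n (M.mul (PowerSeries.mk fun n => T n v) G) := by
  obtain ⟨C, hC, hM⟩ := M.bdd_nonneg
  refine Continuous.congr ?_ fun v => (M.coeff_mul _ _ _).symm
  simp only [PowerSeries.coeff_mk]
  refine continuous_finsetSum _ fun p _ => continuous_finsetSum _ fun q _ => ?_
  let f : V →+ V :=
    { toFun := fun v => PowerSeries.coeff q.2 (M.mul (PowerSeries.C v)
        (PowerSeries.C (PowerSeries.coeff q.1 G)))
      map_zero' := by simp
      map_add' := by simp }
  have hf : Continuous f := AddMonoidHomClass.continuous_of_bound f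
    (C q.2 * ‖PowerSeries.coeff q.1 G‖) fun v => (hM _ _ _).trans_eq (by ring)
  exact hf.comp (hT p.1)

theorem StarProduct.continuous_coeff_mul_right {V : Type w₁} [NormedRing V] [NormedAlgebra k V]
    (M : StarProduct k V) {T : ℕ → V →ₗ[k] V} (hT : ∀ n, Continuous (T n)) (F : PowerSeries V)
    (n : ℕ) :
    Continuous fun v => PowerSeries.coeff n (M.mul F (PowerSeries.mk fun n => T n v)) := by
  obtain ⟨C, hC, hM⟩ := M.bdd_nonneg
  refine Continuous.congr ?_ fun v => (M.coeff_mul _ _ _).symm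
  simp only [PowerSeries.coeff_mk]
  refine continuous_finsetSum _ fun p _ => continuous_finsetSum _ fun q _ => ?_
  let f : V →+ V :=
    { toFun := fun v => PowerSeries.coeff q.2 (M.mul (PowerSeries.C (PowerSeries.coeff p.1 F))
        (PowerSeries.C v))
      map_zero' := by simp
      map_add' := by simp }
  have hf : Continuous f := AddMonoidHomClass.continuous_of_bound f
    (C q.2 * ‖PowerSeries.coeff p.1 F‖) fun v => hM _ _ _
  exact hf.comp (hT q.1)

end Continuity

/-! ### Trivialization of star products on the completed enveloping algebra. -/

section Rigidity

variable {k : Type u} [NormedField k] [IsUltrametricDist k] {I : Type v} {Φ : Type w}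
  [AddCommGroup Φ] {D : RootDatum I Φ} {ρ : Radii}

/-- If `H²_b(g, U(g)^an) = 0`, the map from `U(g)` to its completion lifts to a bounded
homomorphism to any deformation of the completion. -/
theorem StarProduct.exists_bounded_algHom
    (hH : Subsingleton (BoundedCohomology k (gLie k D ρ) (CompletedEnv k D ρ) 2))
    (M : StarProduct k (CompletedEnv k D ρ)) :
    ∃ Ψ : Env k D ρ →ₐ[k] StarAlg M, (∀ x, StarAlg.reduce M (Ψ x) = CompletedEnv.ofEnv x) ∧
      ∃ r : ℕ → ℝ, (∀ n, 0 < r n) ∧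
        ∀ x, (Ψ x : PowerSeries (CompletedEnv k D ρ)) ∈ seriesBall r ‖x‖ := by
  obtain ⟨L, hL₀, hLb, hL⟩ := exists_lie_lift hH M
    (ι := (gLie k D ρ).toSubmodule.subtype) (fun _ => rfl) (fun _ _ => rfl) (fun _ _ => rfl)
  obtain ⟨C, hC, hM⟩ := M.bdd_nonneg
  choose K hK using hLb
  -- The same weights serve two purposes: they are adapted to the star product and they make `L`
  -- contracting. At order 0 no smallness is needed, since `L` is there the isometric inclusion and
  -- `r 0 = 1`.
  obtain ⟨r, hr, hrK⟩ := exists_isAdapted hC (K := fun n => |K n|) fun n => abs_nonneg _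
  obtain ⟨Ψ, hΨ⟩ := Env.exists_algHom (R := StarAlg M) L hL
  have hLball : ∀ x, L x ∈ seriesBall r ‖x‖ := by
    intro x n
    have hx : 0 ≤ ‖x‖ := norm_nonneg (x : CompletedEnv k D ρ)
    by_cases hn : n = 0
    · rw [hn, hr.zero, hL₀, _root_.one_mul]; exact le_rfl
    · calc r n * ‖PowerSeries.coeff n (L x)‖ ≤ r n * (|K n| * ‖x‖) :=
            mul_le_mul_of_nonneg_left ((hK n x).trans
              (mul_le_mul_of_nonneg_right (le_abs_self _) hx)) (hr.pos n).le
        _ = r n * |K n| * ‖x‖ := by ring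
        _ ≤ ‖x‖ := mul_le_of_le_one_left hx (hrK n hn)
  refine ⟨Ψ, fun x => ?_, r, hr.pos, M.algHom_mem_seriesBall hM hr CompletedEnv.norm_one_le Ψ
    fun x => ?_⟩
  · have h₀ : (StarAlg.reduce M).comp Ψ = CompletedEnv.ofEnv := Env.algHom_ext fun x => by
      rw [AlgHom.comp_apply, hΨ]
      exact hL₀ _
    exact AlgHom.congr_fun h₀ x
  · rw [hΨ]
    exact seriesBall_mono (gLie.norm_gen_le x) (hLball _)

/-- A bounded linear map on `U(g)` extends to the completion. -/
theorem CompletedEnv.exists_extension {E : Type w₁} [NormedAddCommGroup E]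
    [NormedSpace k E] [CompleteSpace E] (f : Env k D ρ →ₗ[k] E) {K : ℝ}
    (hf : ∀ x, ‖f x‖ ≤ K * ‖x‖) : ∃ T : CompletedEnv k D ρ →ₗ[k] E, Continuous T ∧
      (∀ v, ‖T v‖ ≤ K * ‖v‖) ∧ ∀ x, T (CompletedEnv.ofEnv x) = f x := by
  have hf' : ∀ x, ‖f x‖ ≤ K * ‖(CompletedEnv.ofEnv : Env k D ρ →ₐ[k] _).toLinearMap x‖ := fun x =>
    (hf x).trans_eq (congrArg _ (CompletedEnv.norm_ofEnv x).symm)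
  have hd : DenseRange (CompletedEnv.ofEnv : Env k D ρ →ₐ[k] _).toLinearMap :=
    CompletedEnv.denseRange_ofEnv
  exact ⟨(f.extendOfNorm CompletedEnv.ofEnv.toLinearMap).toLinearMap,
    (f.extendOfNorm CompletedEnv.ofEnv.toLinearMap).continuous,
    LinearMap.norm_extendOfNorm_apply_le hd K hf', LinearMap.extendOfNorm_eq hd ⟨K, hf'⟩⟩

/-- If `H²_b(g, U(g)^an) = 0`, every star product on `U(g)^an⟦ħ⟧` is equivalent to the undeformed
multiplication. -/
theorem StarProduct.exists_trivialization
    (hH : Subsingleton (BoundedCohomology k (gLie k D ρ) (CompletedEnv k D ρ) 2))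
    (M : StarProduct k (CompletedEnv k D ρ)) :
    ∃ T : ℕ → CompletedEnv k D ρ →ₗ[k] CompletedEnv k D ρ,
      (∀ n, ∃ K : ℝ, ∀ v, ‖T n v‖ ≤ K * ‖v‖) ∧ T 0 = LinearMap.id ∧
      (PowerSeries.mk fun n => T n 1) = 1 ∧
      ∀ v w, (PowerSeries.mk fun n => T n (v * w)) =
        M.mul (PowerSeries.mk fun n => T n v) (PowerSeries.mk fun n => T n w) := by
  obtain ⟨Ψ, hΨ₀, r, hr, hΨ⟩ := M.exists_bounded_algHom hH
  let Ψc (n : ℕ) : Env k D ρ →ₗ[k] CompletedEnv k D ρ :=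
    { toFun := fun x => PowerSeries.coeff n (show PowerSeries (CompletedEnv k D ρ) from Ψ x)
      map_add' := fun x y => by rw [map_add]; exact map_add (PowerSeries.coeff n) _ _
      map_smul' := fun c x => by rw [map_smul]; rfl }
  have hΨc : ∀ n x, ‖Ψc n x‖ ≤ (r n)⁻¹ * ‖x‖ := by
    intro n x
    rw [inv_mul_eq_div, le_div_iff₀' (hr n)]
    exact hΨ x n
  choose T hTcont hTb hT using fun n => CompletedEnv.exists_extension (Ψc n) (hΨc n)
  have hTmk : ∀ x, (PowerSeries.mk fun n => T n (CompletedEnv.ofEnv x)) = Ψ x := by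
    intro x
    ext n
    rw [PowerSeries.coeff_mk, hT]
    rfl
  refine ⟨T, fun n => ⟨_, hTb n⟩, ?_, ?_, fun v w => ?_⟩
  · refine LinearMap.ext fun v => CompletedEnv.denseRange_ofEnv.induction_on
      (p := fun v => T 0 v = v) v (isClosed_eq (hTcont 0) continuous_id) fun x => ?_
    rw [hT, ← hΨ₀ x]
    rfl
  · have h := hTmk 1
    rw [map_one, map_one] at h
    exact h
  · ext n
    rw [PowerSeries.coeff_mk]
    -- Both sides are continuous in each variable separately, so `v` and then `w` may be taken from
    -- the dense image of `U(g)`, where `Ψ` is multiplicative.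
    refine CompletedEnv.denseRange_ofEnv.induction_on (p := fun v => T n (v * w) =
      PowerSeries.coeff n (M.mul (PowerSeries.mk fun n => T n v) (PowerSeries.mk fun n => T n w)))
      v (isClosed_eq ((hTcont n).comp (continuous_id.mul continuous_const))
        (M.continuous_coeff_mul_left hTcont _ n)) fun x => ?_
    refine CompletedEnv.denseRange_ofEnv.induction_on (p := fun w => T n (CompletedEnv.ofEnv x * w) =
      PowerSeries.coeff n (M.mul (PowerSeries.mk fun n => T n (CompletedEnv.ofEnv x))
        (PowerSeries.mk fun n => T n w)))
      w (isClosed_eq ((hTcont n).comp (continuous_const.mul continuous_id))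
        (M.continuous_coeff_mul_right hTcont _ n)) fun y => ?_
    rw [hTmk, hTmk, ← map_mul, hT]
    change PowerSeries.coeff n (Ψ (x * y) : PowerSeries (CompletedEnv k D ρ)) = _
    rw [map_mul]
    rfl

end Rigidity

/-! ### Automorphisms of `V⟦ħ⟧` given by power series of bounded operators -/

section SeriesMap

variable {k : Type u} [NormedField k] {V : Type w} [NormedRing V] [NormedAlgebra k V]

/-- The ring of bounded operators. -/
def boundedEnd (k : Type u) [NormedField k] (V : Type w) [NormedRing V] [NormedAlgebra k V] :
    Subring (Module.End k V) where
  carrier := {f | ∃ K : ℝ, ∀ v, ‖f v‖ ≤ K * ‖v‖}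
  mul_mem' := by
    rintro f g ⟨K, hK⟩ ⟨K', hK'⟩
    refine ⟨|K| * K', fun v => (hK _).trans ?_⟩
    rw [mul_assoc]
    exact mul_le_mul (le_abs_self _) (hK' v) (norm_nonneg _) (abs_nonneg _)
  one_mem' := ⟨1, fun v => by simp⟩
  add_mem' := by
    rintro f g ⟨K, hK⟩ ⟨K', hK'⟩
    refine ⟨K + K', fun v => ?_⟩
    rw [add_mul]
    exact (norm_add_le _ _).trans (add_le_add (hK v) (hK' v))
  zero_mem' := ⟨0, fun v => by simp⟩
  neg_mem' := by
    rintro f ⟨K, hK⟩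
    exact ⟨K, fun v => by simpa using hK v⟩

/-- The `k⟦ħ⟧`-linear operator `∑ S_n ħ^n` on power series. -/
noncomputable def seriesMap (S : PowerSeries (boundedEnd k V)) :
    PowerSeries V →ₗ[k] PowerSeries V where
  toFun F := PowerSeries.mk fun n => ∑ p ∈ Finset.HasAntidiagonal.antidiagonal n,
    (PowerSeries.coeff p.1 S).1 (PowerSeries.coeff p.2 F)
  map_add' F G := by ext n; simp [Finset.sum_add_distrib]
  map_smul' c F := by
    ext n
    simp only [smul_coeff, PowerSeries.coeff_mk, map_smul, Finset.smul_sum, RingHom.id_apply]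

theorem coeff_seriesMap (S : PowerSeries (boundedEnd k V)) (n : ℕ) (F : PowerSeries V) :
    PowerSeries.coeff n (seriesMap S F) = ∑ p ∈ Finset.HasAntidiagonal.antidiagonal n,
      (PowerSeries.coeff p.1 S).1 (PowerSeries.coeff p.2 F) :=
  PowerSeries.coeff_mk n fun n => ∑ p ∈ Finset.HasAntidiagonal.antidiagonal n,
    (PowerSeries.coeff p.1 S).1 (PowerSeries.coeff p.2 F)

theorem coeff_zero_seriesMap (S : PowerSeries (boundedEnd k V)) (F : PowerSeries V) :
    PowerSeries.coeff 0 (seriesMap S F) =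
      (PowerSeries.coeff 0 S).1 (PowerSeries.coeff 0 F) := by
  rw [coeff_seriesMap, Finset.Nat.antidiagonal_zero, Finset.sum_singleton]

theorem seriesMap_C (S : PowerSeries (boundedEnd k V)) (v : V) :
    seriesMap S (PowerSeries.C v) =
      PowerSeries.mk fun n => (PowerSeries.coeff n S).1 v := by
  ext n
  rw [coeff_seriesMap, PowerSeries.coeff_mk, Finset.sum_eq_single (n, 0)]
  · rw [PowerSeries.coeff_zero_C]
  · rintro ⟨a, b⟩ hp hne
    have hab := Finset.HasAntidiagonal.mem_antidiagonal.1 hp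
    have hb : b ≠ 0 := by
      rintro rfl
      exact hne (Prod.ext (by simpa using hab) rfl)
    rw [PowerSeries.coeff_C, if_neg hb, map_zero]
  · intro h
    exact absurd (Finset.HasAntidiagonal.mem_antidiagonal.2 (add_zero n)) h

theorem seriesMap_X_mul (S : PowerSeries (boundedEnd k V)) (F : PowerSeries V) :
    seriesMap S (PowerSeries.X * F) = PowerSeries.X * seriesMap S F := by
  ext n
  cases n with
  | zero =>
    rw [coeff_zero_seriesMap, PowerSeries.coeff_zero_X_mul, PowerSeries.coeff_zero_X_mul, map_zero]
  | succ n =>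
    rw [PowerSeries.coeff_succ_X_mul, coeff_seriesMap, coeff_seriesMap,
      Finset.Nat.antidiagonal_succ']
    simp [PowerSeries.coeff_succ_X_mul]

theorem seriesMap_seriesMap (S T : PowerSeries (boundedEnd k V)) (F : PowerSeries V) :
    seriesMap S (seriesMap T F) = seriesMap (S * T) F := by
  refine ext_of_X_linear (L := (seriesMap S ∘ₗ seriesMap T).toAddMonoidHom)
    (L' := (seriesMap (S * T)).toAddMonoidHom) (fun F => ?_) (seriesMap_X_mul _) (fun v => ?_) F
  · change seriesMap S (seriesMap T _) = PowerSeries.X * seriesMap S (seriesMap T _)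
    rw [seriesMap_X_mul, seriesMap_X_mul]
  · change seriesMap S (seriesMap T _) = seriesMap (S * T) _
    ext n
    rw [seriesMap_C, seriesMap_C, coeff_seriesMap, PowerSeries.coeff_mk, PowerSeries.coeff_mul]
    simp [PowerSeries.coeff_mk, LinearMap.sum_apply]

theorem seriesMap_one (F : PowerSeries V) :
    seriesMap (1 : PowerSeries (boundedEnd k V)) F = F := by
  refine ext_of_X_linear (L := (seriesMap (1 : PowerSeries (boundedEnd k V))).toAddMonoidHom)
    (L' := AddMonoidHom.id _) (seriesMap_X_mul _) (fun _ => rfl) (fun v => ?_) F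
  change seriesMap 1 _ = PowerSeries.C v
  ext n
  rw [seriesMap_C, PowerSeries.coeff_mk, PowerSeries.coeff_one, PowerSeries.coeff_C]
  split <;> simp

theorem seriesMap_map_mul (S : PowerSeries (boundedEnd k V)) (f : PowerSeries k)
    (F : PowerSeries V) : seriesMap S (PowerSeries.map (algebraMap k V) f * F) =
      PowerSeries.map (algebraMap k V) f * seriesMap S F := by
  let m := AddMonoidHom.mulLeft (PowerSeries.map (algebraMap k V) f)
  have hm : ∀ F, m (PowerSeries.X * F) = PowerSeries.X * m F := fun F => by
    simp only [m, AddMonoidHom.coe_mulLeft]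
    rw [← mul_assoc, (PowerSeries.commute_X _).eq, mul_assoc]
  refine ext_of_X_linear (L := (seriesMap S).toAddMonoidHom.comp m)
    (L' := m.comp (seriesMap S).toAddMonoidHom) (fun F => ?_) (fun F => ?_) (fun v => ?_) F
  · change seriesMap S (m _) = PowerSeries.X * seriesMap S (m F)
    rw [hm, seriesMap_X_mul]
  · change m (seriesMap S _) = PowerSeries.X * m (seriesMap S F)
    rw [seriesMap_X_mul, hm]
  · change seriesMap S (PowerSeries.map (algebraMap k V) f * _) =
      PowerSeries.map (algebraMap k V) f * seriesMap S _
    ext n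
    rw [seriesMap_C, coeff_seriesMap, PowerSeries.coeff_mul, ← Finset.Nat.sum_antidiagonal_swap]
    refine Finset.sum_congr rfl fun p _ => ?_
    simp only [Prod.fst_swap, Prod.snd_swap, PowerSeries.coeff_mul_C, PowerSeries.coeff_map,
      PowerSeries.coeff_mk, ← Algebra.smul_def, map_smul]

/-- Both sides are `ħ`-linear in `F` and in `G`, so `ext_of_X_linear`, used once for each variable,
reduces the identity to constants. -/
theorem StarProduct.seriesMap_mul (M : StarProduct k V) (T : PowerSeries (boundedEnd k V))
    (hT : ∀ v w, seriesMap T (PowerSeries.C (v * w)) =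
      M.mul (seriesMap T (PowerSeries.C v)) (seriesMap T (PowerSeries.C w)))
    (F G : PowerSeries V) : seriesMap T (F * G) = M.mul (seriesMap T F) (seriesMap T G) := by
  refine ext_of_X_linear (L := (seriesMap T).toAddMonoidHom.comp (AddMonoidHom.mulRight G))
    (L' := ((M.mul.flip (seriesMap T G)) ∘ₗ seriesMap T).toAddMonoidHom)
    (fun F => ?_) (fun F => ?_) (fun v => ?_) F
  · change seriesMap T (PowerSeries.X * F * G) = PowerSeries.X * seriesMap T (F * G)
    rw [mul_assoc, seriesMap_X_mul]
  · change M.mul (seriesMap T _) _ = PowerSeries.X * M.mul (seriesMap T _) _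
    rw [seriesMap_X_mul, M.X_mul]
  · refine ext_of_X_linear
      (L := (seriesMap T).toAddMonoidHom.comp (AddMonoidHom.mulLeft (PowerSeries.C v)))
      (L' := ((M.mul (seriesMap T (PowerSeries.C v))) ∘ₗ seriesMap T).toAddMonoidHom)
      (fun G => ?_) (fun G => ?_) (fun w => ?_) G
    · change seriesMap T (PowerSeries.C v * (PowerSeries.X * G)) =
        PowerSeries.X * seriesMap T (PowerSeries.C v * G)
      rw [← mul_assoc, (PowerSeries.commute_X _).eq, mul_assoc, seriesMap_X_mul]
    · change M.mul _ (seriesMap T _) = PowerSeries.X * M.mul _ (seriesMap T _)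
      rw [seriesMap_X_mul, M.mul_X]
    · change seriesMap T (PowerSeries.C v * PowerSeries.C w) = _
      rw [← map_mul]
      exact hT v w

/-- A power series of bounded operators with constant term the identity is invertible. -/
theorem exists_seriesMap_inverse (T : ℕ → V →ₗ[k] V) (hT : ∀ n, ∃ K : ℝ, ∀ v, ‖T n v‖ ≤ K * ‖v‖)
    (hT₀ : T 0 = LinearMap.id) :
    ∃ S τ : PowerSeries (boundedEnd k V), S * τ = 1 ∧ τ * S = 1 ∧
      (PowerSeries.coeff 0 S).1 = 1 ∧
      ∀ v, seriesMap τ (PowerSeries.C v) = PowerSeries.mk fun n => T n v := by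
  let τ : PowerSeries (boundedEnd k V) := PowerSeries.mk fun n => ⟨T n, hT n⟩
  have hτ : PowerSeries.constantCoeff τ = ((1 : (boundedEnd k V)ˣ) : boundedEnd k V) := by
    rw [← PowerSeries.coeff_zero_eq_constantCoeff_apply, PowerSeries.coeff_mk]
    exact Subtype.ext hT₀
  -- Inversion takes place over the noncommutative ring of bounded operators, so the coefficients of
  -- the inverse are automatically bounded.
  refine ⟨PowerSeries.invOfUnit τ 1, τ, PowerSeries.invOfUnit_mul τ 1 hτ,
    PowerSeries.mul_invOfUnit τ 1 hτ, ?_, fun v => ?_⟩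
  · rw [PowerSeries.coeff_zero_eq_constantCoeff_apply, PowerSeries.constantCoeff_invOfUnit]
    simp
  · rw [seriesMap_C]
    simp only [τ, PowerSeries.coeff_mk]

variable [IsUltrametricDist V]

/-- Order `n` of the image involves only finitely many operators, so a smaller `n`-th weight absorbs
their bounds; no uniformity in `n` is required. -/
theorem exists_weights_seriesMap (S : PowerSeries (boundedEnd k V)) (r : Weights) :
    ∃ r' : Weights, ∀ (x : WSeq r V) (n : ℕ),
      r' n * ‖PowerSeries.coeff n (seriesMap S (WSeq.ps k V x))‖ ≤ ‖x‖ := by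
  choose K hK using fun n => (PowerSeries.coeff n S).2
  -- Adding 1 keeps the weight positive and finite even when the bound is zero.
  have hpos : ∀ n, 0 < (|K n| + 1)⁻¹ := fun n => by positivity
  refine ⟨Weights.conv ⟨fun n => ⟨_, hpos n⟩⟩ r, fun x n => ?_⟩
  have hc := (Weights.conv ⟨fun n => ⟨_, hpos n⟩⟩ r n).2
  rw [coeff_seriesMap, ← le_div_iff₀' hc]
  refine IsUltrametricDist.norm_sum_le_of_forall_le_of_nonneg (by positivity) fun p hp => ?_
  rw [le_div_iff₀' hc, WSeq.coeff_ps]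
  have h₁ : (Weights.conv ⟨fun n => ⟨_, hpos n⟩⟩ r n : ℝ) ≤ (|K p.1| + 1)⁻¹ * r p.2 :=
    Finset.inf'_le _ hp
  have h₂ : ‖(PowerSeries.coeff p.1 S).1 (WSeq.coeff k p.2 x)‖ ≤
      (|K p.1| + 1) * ‖WSeq.coeff k p.2 x‖ :=
    (hK _ _).trans (mul_le_mul_of_nonneg_right
      ((le_abs_self _).trans (le_add_of_nonneg_right zero_le_one)) (norm_nonneg _))
  have hr : (0 : ℝ) < r p.2 := (r p.2).2
  calc _ ≤ (|K p.1| + 1)⁻¹ * r p.2 * ((|K p.1| + 1) * ‖WSeq.coeff k p.2 x‖) :=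
        mul_le_mul h₁ h₂ (norm_nonneg _) (by positivity)
    _ = r p.2 * ‖WSeq.coeff k p.2 x‖ := by
        have : |K p.1| + 1 ≠ 0 := by positivity
        field_simp
    _ ≤ ‖x‖ := WSeq.norm_coeff_le x _

theorem exists_seriesMap_stage (S : PowerSeries (boundedEnd k V)) (r : Weights) :
    ∃ (r' : Weights) (f : BddLin k (WSeq r V) (WSeq r' V)),
      ∀ x, WSeq.ps k V (f.lin x) = seriesMap S (WSeq.ps k V x) := by
  obtain ⟨r', hr'⟩ := exists_weights_seriesMap S r
  obtain ⟨g, hg⟩ : ∃ g : WSeq r V → WSeq r' V,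
      ∀ x, WSeq.psLin k r' (g x) = seriesMap S (WSeq.psLin k r x) :=
    ⟨fun x => WSeq.mk r' (fun n => PowerSeries.coeff n (seriesMap S (WSeq.ps k V x))) ⟨_, hr' x⟩,
      fun x => PowerSeries.ext fun n => PowerSeries.coeff_mk n
        fun n => PowerSeries.coeff n (seriesMap S (WSeq.ps k V x))⟩
  -- A weighted sequence is determined by its power series, so linearity of `g` follows from that of
  -- `seriesMap S`.
  have hinj : Function.Injective (WSeq.psLin (V := V) k r') := fun x y h =>
    WSeq.ext (k := k) (WSeq.ext_ps k h)
  refine ⟨r', ⟨⟨⟨g, fun x y => hinj ?_⟩, fun c x => hinj ?_⟩, 1, fun x => ?_⟩, hg⟩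
  · rw [hg, map_add, map_add, map_add, hg, hg]
  · change WSeq.psLin k r' (g (c • x)) = WSeq.psLin k r' (c • g x)
    rw [hg, map_smul, map_smul, map_smul, hg]
  · rw [one_mul]
    refine WSeq.norm_le (k := k) (norm_nonneg x) fun n => ?_
    rw [← WSeq.coeff_ps]
    exact (congrArg (fun F => (r' n : ℝ) * ‖PowerSeries.coeff n F‖) (hg x)).trans_le (hr' x n)

variable [CompleteSpace V]

theorem pSeries.ps_tr {r r' : Weights} (a : r ⟶ r') (x : WSeq r V) :
    WSeq.ps k V ((pSeries k V).tr (i := r) (j := r') a x : WSeq r' V) = WSeq.ps k V x :=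
  PowerSeries.ext fun n => (WSeq.coeff_ps (r := r') _ n).trans (WSeq.coeff_ps x n).symm

/-- A power series of bounded operators as an endomorphism of the IndBanach space `V⟦ħ⟧`. -/
theorem exists_seriesHom (S : PowerSeries (boundedEnd k V)) :
    ∃ f : IndBan.Hom (pSeries k V) (pSeries k V), ∀ (r : Weights) (x : WSeq r V),
      f.series r x = seriesMap S (WSeq.ps k V x) := by
  choose idx f hf using exists_seriesMap_stage S
  have hcompat : ∀ {r r' : Weights} (a : r ⟶ r') (x : WSeq r V), WSeq.ps k V ((f r).lin x) =
      WSeq.ps k V ((f r').lin ((pSeries k V).tr (i := r) (j := r') a x)) := fun {r r'} a x =>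
    (hf r x).trans ((congrArg (seriesMap S) (pSeries.ps_tr a x)).symm.trans (hf r' _).symm)
  let h : IndBan.Hom (pSeries k V) (pSeries k V) :=
    ⟨idx, f, fun a => pSeries.evEq_of_ps (hcompat a)⟩
  have hh : ∀ (r : Weights) (x : WSeq r V), h.series r x = WSeq.ps k V ((f r).lin x) :=
    fun _ _ => rfl
  exact ⟨h, fun r x => (hh r x).trans (hf r x)⟩

end SeriesMap

/-! ### Changing the isomorphism to `V⟦ħ⟧` by an automorphism. -/

section Main

variable {k : Type u} [NormedField k] {V : Type w} [NormedRing V] [NormedAlgebra k V]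
  [IsUltrametricDist V] [CompleteSpace V] {X : IndBan.{u, v₁, w₁} k}

/-- Composition of an isomorphism to `V⟦ħ⟧` with an invertible power series of operators. -/
theorem IndBan.Iso.exists_seriesMap_comp (φ : IndBan.Iso X (pSeries k V))
    {S T : PowerSeries (boundedEnd k V)} (hST : S * T = 1) (hTS : T * S = 1) :
    ∃ ψ : IndBan.Iso X (pSeries k V),
      ∀ i a, ψ.hom.series i a = seriesMap S (φ.hom.series i a) := by
  obtain ⟨s, hs⟩ := exists_seriesHom S
  obtain ⟨t, ht⟩ := exists_seriesHom T
  have hψ : ∀ i a, (s.comp φ.hom).series i a = seriesMap S (φ.hom.series i a) :=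
    fun i a => hs _ _
  refine ⟨⟨s.comp φ.hom, φ.inv.comp t, fun i => ?_, fun r => ?_⟩, hψ⟩
  · refine IndBan.EvEq.trans (IndBan.EvEq.map φ.inv (j := φ.hom.idx i)
      (g := fun x => (φ.hom.map i).lin x) (pSeries.evEq_of_ps fun x => ?_)) (φ.hom_inv i)
    refine (ht _ _).trans ((congrArg (seriesMap T) (hs _ _)).trans ?_)
    rw [seriesMap_seriesMap, hTS, seriesMap_one]
  · refine pSeries.evEq_of_ps fun x => ?_
    refine (hψ _ _).trans ?_
    refine (congrArg (seriesMap S) (φ.series_inv _ _)).trans ?_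
    refine (congrArg (seriesMap S) (ht r x)).trans ?_
    rw [seriesMap_seriesMap, hST, seriesMap_one]
    rfl

end Main

end AnalyticRigidity

open AnalyticRigidity
theorem theorem3p68 {k : Type*} [NormedField k] [CompleteSpace k] [IsUltrametricDist k]
    {I Φ : Type*} [AddCommGroup Φ] (D : RootDatum I Φ) (ρ : Radii)
    (A : IndBanAlgOver (kPowerSeries k))
    (φ : IndBan.Iso A.toIndBan (pSeriesAlgOver k (CompletedEnv k D ρ)).toIndBan)
    (hφ : IndBanAlgOver.IsLinear φ.hom)
    (hφ_one : IndBanAlg.PreservesOne φ.hom)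
    (Q : IndBanAlg k) (q : IndBan.Hom A.toIndBan Q.toIndBan)
    (hq : IndBanAlg.IsAlgHom q) (hcoker : IndBan.IsCokernel (hbarMul A) q)
    (θ : IndBan.Iso Q.toIndBan (IndBanAlg.const k (CompletedEnv k D ρ)).toIndBan)
    (hθ : (θ.hom.comp q).Equiv ((pSeries.modHbar k (CompletedEnv k D ρ)).comp φ.hom))
    (hθ_alg : IndBanAlg.IsAlgHom θ.hom)
    (hH : Subsingleton
      (BoundedCohomology k (gLie k D ρ) (CompletedEnv k D ρ) 2)) :
    ∃ ψ : IndBan.Iso A.toIndBan (pSeriesAlgOver k (CompletedEnv k D ρ)).toIndBan,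
      IndBanAlg.IsAlgHom ψ.hom ∧ IndBanAlgOver.IsLinear ψ.hom ∧
        ((pSeries.modHbar k (CompletedEnv k D ρ)).comp ψ.hom).Equiv (θ.hom.comp q) := by
  let φ' : IndBan.Iso A.toIndBan (pSeries k (CompletedEnv k D ρ)) := φ
  have hone : φ'.hom.series A.one.idx A.one.val = 1 :=
    (pSeries.ps_eq_of_evEq hφ_one ()).trans (WSeq.ps_one k)
  -- The constant term of the series of `a` is its class modulo `ħ`, read through `θ`;
  -- multiplicativity of `q` and `θ` then makes the transported product a deformation of that of
  -- `V`.
  have hred : ∀ i (a : A.sp i), (θ.hom.map (q.idx i)).lin ((q.map i).lin a) =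
      PowerSeries.coeff 0 (φ'.hom.series i a) := fun i a =>
    (IndBan.EvEq.const_eq (hθ i) a).trans (PowerSeries.coeff_mk _ _).symm
  have hmul : ∀ i j (a : A.sp i) (b : A.sp j),
      PowerSeries.coeff 0 (φ'.hom.series _ ((A.mul.map i j).lin a b)) =
        PowerSeries.coeff 0 (φ'.hom.series i a) * PowerSeries.coeff 0 (φ'.hom.series j b) := by
    intro i j a b
    rw [← hred, ← hred, ← hred]
    exact IndBan.EvEq.const_eq (((hq.2 i j).map θ.hom).trans
      ((hθ_alg.2 (q.idx i) (q.idx j)).precomp fun p : A.sp i × A.sp j =>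
        ((q.map i).lin p.1, (q.map j).lin p.2)))
      (a, b)
  obtain ⟨M, hM⟩ := exists_starProduct φ' hφ hone hmul
  obtain ⟨T, hTb, hT₀, hT_one, hT_mul⟩ := M.exists_trivialization hH
  obtain ⟨S, τ, hSτ, hτS, hS₀, hτ⟩ := exists_seriesMap_inverse T hTb hT₀
  have hτ_mul := M.seriesMap_mul τ fun v w => by rw [hτ, hτ, hτ, hT_mul]
  have hinv : ∀ F, seriesMap τ (seriesMap S F) = F := fun F => by
    rw [seriesMap_seriesMap, hτS, seriesMap_one]
  have hinv' : ∀ F, seriesMap S (seriesMap τ F) = F := fun F => by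
    rw [seriesMap_seriesMap, hSτ, seriesMap_one]
  -- Since `τ` carries the Cauchy product to the star product, its inverse `S` must follow `φ`.
  obtain ⟨ψ, hψ⟩ := φ'.exists_seriesMap_comp hSτ hτS
  refine ⟨ψ, ⟨pSeries.evEq_of_ps fun _ => ?_, fun i j => pSeries.evEq_of_ps fun p => ?_⟩,
    fun r i => pSeries.evEq_of_ps fun p => ?_, fun i => ?_⟩
  · refine (hψ _ _).trans (Eq.trans ?_ (WSeq.ps_one k).symm)
    rw [hone, ← hT_one, ← hτ, hinv', hτ, hT_one, map_one]
  · refine (hψ _ _).trans (Eq.trans ?_ (WSeq.ps_mul k _ _).symm)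
    refine Eq.trans ?_ (congrArg₂ (· * ·) (hψ i p.1) (hψ j p.2)).symm
    rw [hM, ← hinv (φ'.hom.series i p.1), ← hinv (φ'.hom.series j p.2), ← hτ_mul, hinv', hinv,
      hinv]
  · refine (hψ _ _).trans (Eq.trans ?_ (WSeq.ps_smul k _ _).symm)
    refine Eq.trans ?_ (congrArg (_ * ·) (hψ i p.2)).symm
    exact (congrArg (seriesMap S) (IndBanAlgOver.IsLinear.series_act hφ r i p.1 p.2)).trans
      (seriesMap_map_mul S _ _)
  -- The constant term of `S` is the identity, so reduction modulo `ħ` is the same for `ψ` as for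
  -- `φ`.
  · refine IndBan.EvEq.trans ?_ (hθ i).symm
    refine IndBan.EvEq.of_const_eq fun x => ?_
    have h := congrArg (PowerSeries.coeff 0) (hψ i x)
    rw [coeff_zero_seriesMap, hS₀] at h
    exact (PowerSeries.coeff_mk _ _).symm.trans (h.trans (PowerSeries.coeff_mk _ _))
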